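/- **Problem and network.** Let $m\ge 2$, $d\ge 0$, and consider $\min_{x\in\mathbb R^d}\sum_{i=1}^m f_i(x)+\sum_{i=1}^m r_i(x)$, where each $f_i:\mathbb R^d\to\mathbb R$ is convex and differentiable with locally Lipschitz gradient, each $r_i:\mathbb R^d\to(-\infty,+\infty]$ is convex, proper and lower semicontinuous, and the objective is bounded below. For $\mathbf X\in\mathbb R^{m\times d}$ with rows $x_i$ put $F(\mathbf X)=\sum_i f_i(x_i)$ and $R(\mathbf X)=\sum_i r_i(x_i)$; $\|\cdot\|$ is the Frobenius norm. Let $\mathcal G$ be a connected undirected graph on $\{1,\dots,m\}$, let $\widetilde W$ be symmetric and doubly stochastic with $\widetilde w_{ii}>0$, $\widetilde w_{ij}>0$ for every edge $ij$ and $\widetilde w_{ij}=0$ for all other $i\ne j$, and let $\lambda_2(\widetilde W)$ be its second largest eigenvalue. Let $c\in(0,1/2)$, $\eta,\delta\in(0,1)$, $W=(1-c)I+c\widetilde W$. **Algorithm.** Given $\alpha^{-1}>0$, a summable sequence $n^k\ge 0$ ($k\ge 0$), arbitrary $\mathbf X^0,\mathbf S^0$, and $\mathbf X^{-1}=\mathbf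 A^0=\mathbf D^0=\mathbf T^0=0$, iterate for $k\ge 0$: 1. $\mathbf X^{k+1/2}=W\mathbf X^k$, $\ \mathbf D^{k+1/2}=W(\nabla F(\mathbf X^k)+\mathbf S^k+\mathbf D^k)$. 2. Each agent $i$ sets $\widetilde\alpha_i^k=\Big((\alpha^{k-1})^2+\min\Big\{\tfrac{1-\delta}{4}\tfrac{\|a_i^k-x_i^{k-1}\|^2}{\|s_i^k-s_i^0\|^2+2c\|t_i^k\|^2},\,n^k\Big\}\Big)^{1/2}$ (a fraction with denominator $0$ counts as $+\infty$), and lets $\alpha_i^k$ be the first $\alpha\in\{\widetilde\alpha_i^k,\eta\widetilde\alpha_i^k,\eta^2\widetilde\alpha_i^k,\dots\}$ for which the trial point $x^+=x_i^{k+1/2}-\alpha d_i^{k+1/2}$ satisfies $f_i(x^+)\le f_i(x_i^k)+\langle\nabla f_i(x_i^k),x^+-x_i^k\rangle+\tfrac{\delta}{2\alpha}\|x^+-x_i^k\|^2$. 3. $\alpha^k=\min_i\alpha_i^k$. 4. $\mathbf A^{k+1}=\mathbf X^{k+1/2}-\alpha^k\mathbf D^{k+1/2}$, $\ \mathbf X^{k+1}=\mathrm{prox}_{\alpha^kR}(\mathbf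 A^{k+1}+\alpha^k\mathbf S^k)$, $\ \mathbf S^{k+1}=\mathbf S^k+\tfrac1{\alpha^k}(\mathbf A^{k+1}-\mathbf X^{k+1})$, $\ \mathbf D^{k+1}=\mathbf D^{k+1/2}-\nabla F(\mathbf X^k)-\mathbf S^k+\tfrac1{\alpha^k}(\mathbf X^k-\mathbf X^{k+1/2})$, $\ \mathbf T^{k+1}=\mathbf T^k-\mathbf S^k-\mathbf D^k-\nabla F(\mathbf X^k)+\tfrac1{\alpha^k}\mathbf X^k$. (Lower-case letters with index $i$ are the $i$-th rows.) **Local structure at the limit.** Let $\mathbf X^k\to\mathbf X^\star=\mathbf 1(x^\star)^\top$ and $\mathbf S^k\to\mathbf S^\star$, and assume: * $F$ is $\mu$-strongly convex, $\mu>0$, on a neighborhood of $\mathbf X^\star$; * there is an affine subspace $\mathcal M\ni x^\star$ of $\mathbb R^d$ with direction space $\mathcal T$ such that every $r_i$ is partly smooth at $x^\star$ relative to $\mathcal M$: $\partial r_i(z)\neq\emptyset$ for all $z\in\mathcal M$ near $x^\star$; near $x^\star$ the restriction $r_i|_{\mathcal M}$ agrees with a $C^2$ function defined on a neighborhood of $x^\star$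 in $\mathbb R^d$; $\mathcal T=\mathrm{par}(\partial r_i(x^\star))^\perp$; and $\partial r_i$ is inner semicontinuous at $x^\star$ relative to $\mathcal M$; * (non-degeneracy) $\mathbf S^\star\in\mathrm{ri}(\partial R(\mathbf X^\star))$. **Constants.** Let $L_f>0$ be such that, for each $i$, $\nabla f_i$ is $L_f$-Lipschitz on the convex hull of all points $x_i^k$, $a_i^{k+1}$ ($k\ge 0$) and all points tested by the line search of agent $i$. Let $L_r\ge 0$ be such that $\|P_{\mathcal T}(\mathbf S^k)-P_{\mathcal T}(\mathbf S^\star)\|\le L_r\|\mathbf X^k-\mathbf X^\star\|$ for all large $k$, where $P_{\mathcal T}$ projects each row orthogonally onto $\mathcal T$. Put $\kappa_f=L_f/\mu$, $\kappa_r=L_r/\mu$. **Claim.** Such constants $L_f$ and $L_r$ exist. For all such constants there are numbers $N_\varepsilon\in\mathbb N$ ($\varepsilon>0$) with $\|\mathbf X^k-\mathbf X^\star\|\le\varepsilon$ for all $k\ge N_\varepsilon$, and $$N_\varepsilon\le C\,\frac{\kappa_f(1+\kappa_r^2)}{1-\lambda_2(\widetilde W)}\,\log\frac1\varepsilon\qquad\text{for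 all sufficiently small }\varepsilon>0,$$ where $C$ depends only on $c$, $\eta$, $\delta$, $L_f\alpha^{-1}$ and $L_f^2\sum_{k\ge0}n^k$ (how small $\varepsilon$ must be may depend on the whole run). -/

import Mathlib

open Filter Topology

noncomputable section

/-- The decision space `ℝ^d` with its Euclidean norm. -/
abbrev Vec (d : ℕ) : Type := EuclideanSpace ℝ (Fin d)

/-- Stacked variables `𝐗 ∈ ℝ^{m × d}`; row `i` is the vector of agent `i`.
The norm is the Frobenius norm. -/
abbrev Stack (m d : ℕ) : Type := PiLp 2 (fun _ : Fin m => Vec d)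

/-! ### Convex analysis -/

/-- Convex (its epigraph is convex), proper and lower semicontinuous extended-valued function. -/
structure IsProperConvexLSC {d : ℕ} (r : Vec d → EReal) : Prop where
  convex : Convex ℝ {p : Vec d × ℝ | r p.1 ≤ (p.2 : EReal)}
  ne_bot : ∀ x, r x ≠ ⊥
  exists_ne_top : ∃ x, r x ≠ ⊤
  lsc : LowerSemicontinuous r

/-- Convex subdifferential `∂r(x)`. For a proper `r` it is empty where `r x = ⊤`. -/
def subdiff {H : Type*} [NormedAddCommGroup H] [InnerProductSpace ℝ H]
    (r : H → EReal) (x : H) : Set H :=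
  {v | ∀ y, r x + ((inner ℝ v (y - x) : ℝ) : EReal) ≤ r y}

/-- `p = prox_{α r}(u)`: `p` minimizes `y ↦ r(y) + ‖u - y‖² / (2α)`
(for a proper convex lower semicontinuous `r` there is exactly one such point). -/
def IsProx {d : ℕ} (α : ℝ) (r : Vec d → EReal) (u p : Vec d) : Prop :=
  ∀ y, r p + ((‖u - p‖ ^ 2 / (2 * α) : ℝ) : EReal)
    ≤ r y + ((‖u - y‖ ^ 2 / (2 * α) : ℝ) : EReal)

/-- Locally smooth: differentiable with locally Lipschitz gradient. -/
def IsLocallySmooth {d : ℕ} (f : Vec d → ℝ) : Prop :=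
  Differentiable ℝ f ∧ LocallyLipschitz (gradient f)

/-- `r` is partly smooth at `x ∈ M` relative to the affine subspace `M`, which is a `C²` manifold
with tangent space `M.direction` at each of its points. -/
structure IsPartlySmoothAt {d : ℕ} (r : Vec d → EReal) (M : AffineSubspace ℝ (Vec d))
    (x : Vec d) : Prop where
  mem : x ∈ M
  proper : IsProperConvexLSC r
  /-- `r` has a subgradient at `x` and at all points of `M` close to `x`. -/
  exists_subgrad : ∀ᶠ z in 𝓝[(M : Set (Vec d))] x, (subdiff r z).Nonempty
  /-- The restriction of `r` to `M` is `C²` around `x`. -/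
  smooth : ∃ (V : Set (Vec d)) (rhat : Vec d → ℝ), IsOpen V ∧ x ∈ V ∧ ContDiffOn ℝ 2 rhat V ∧
    ∀ z ∈ (M : Set (Vec d)) ∩ V, r z = (rhat z : EReal)
  /-- The tangent space is the orthogonal complement of the linear subspace parallel to
  `∂r(x)`. -/
  sharp : M.direction = (vectorSpan ℝ (subdiff r x))ᗮ
  /-- `∂r` is inner semicontinuous at `x` relative to `M`. -/
  inner_semicont : ∀ v ∈ subdiff r x, ∀ ε : ℝ, 0 < ε →
    ∀ᶠ z in 𝓝[(M : Set (Vec d))] x, ∃ w ∈ subdiff r z, ‖w - v‖ < ε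

/-! ### The network and the problem -/

/-- Symmetric doubly stochastic gossip matrices compliant with the graph `G`. -/
structure IsGossipMatrix {m : ℕ} (G : SimpleGraph (Fin m)) (W : Matrix (Fin m) (Fin m) ℝ) :
    Prop where
  symm : W.IsSymm
  row_sum : ∀ i, ∑ j, W i j = 1
  diag_pos : ∀ i, 0 < W i i
  adj_pos : ∀ i j, G.Adj i j → 0 < W i j
  eq_zero : ∀ i j, i ≠ j → ¬ G.Adj i j → W i j = 0

theorem IsGossipMatrix.isHermitian {m : ℕ} {G : SimpleGraph (Fin m)}
    {W : Matrix (Fin m) (Fin m) ℝ} (h : IsGossipMatrix G W) : W.IsHermitian := by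
  rw [Matrix.IsHermitian, Matrix.conjTranspose_eq_transpose_of_trivial]
  exact h.symm

/-- The second largest eigenvalue `λ₂` of a symmetric matrix of order `m ≥ 2`
(`eigenvalues₀` lists the eigenvalues in nonincreasing order, with multiplicity). -/
def lambda2 {m : ℕ} (hm : 2 ≤ m) {W : Matrix (Fin m) (Fin m) ℝ} (hW : W.IsHermitian) : ℝ :=
  hW.eigenvalues₀ ⟨1, by rw [Fintype.card_fin]; omega⟩

/-- `W = (1 - c) I + c W̃`. -/
def lazyMatrix {m : ℕ} (c : ℝ) (Wt : Matrix (Fin m) (Fin m) ℝ) : Matrix (Fin m) (Fin m) ℝ :=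
  (1 - c) • (1 : Matrix (Fin m) (Fin m) ℝ) + c • Wt

/-- The product `W 𝐙` of a matrix with a stacked variable. -/
def mix {m d : ℕ} (W : Matrix (Fin m) (Fin m) ℝ) (Z : Stack m d) : Stack m d :=
  WithLp.toLp 2 (fun i => ∑ j, W i j • Z j)

/-- The consensual point `𝟏 xᵀ`. -/
def consensus (m : ℕ) {d : ℕ} (x : Vec d) : Stack m d := WithLp.toLp 2 (fun _ => x)

/-- `F(𝐗) = ∑ᵢ fᵢ(xᵢ)`. -/
def sumF {m d : ℕ} (f : Fin m → Vec d → ℝ) (X : Stack m d) : ℝ := ∑ i, f i (X i)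

/-- `R(𝐗) = ∑ᵢ rᵢ(xᵢ)`. -/
def sumR {m d : ℕ} (r : Fin m → Vec d → EReal) (X : Stack m d) : EReal := ∑ i, r i (X i)

/-- `∇F(𝐗)`, whose rows are the gradients `∇fᵢ(xᵢ)`. -/
def gradF {m d : ℕ} (f : Fin m → Vec d → ℝ) (X : Stack m d) : Stack m d :=
  WithLp.toLp 2 (fun i => gradient (f i) (X i))

/-- Row-wise orthogonal projection onto the subspace `T` of `ℝ^d`. -/
def rowProj {m d : ℕ} (T : Submodule ℝ (Vec d)) (Z : Stack m d) : Stack m d :=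
  WithLp.toLp 2 (fun i => T.starProjection (Z i))

/-- Standing assumptions on the problem `min_x ∑ᵢ fᵢ(x) + ∑ᵢ rᵢ(x)`. -/
structure IsAdmissibleProblem {m d : ℕ} (f : Fin m → Vec d → ℝ) (r : Fin m → Vec d → EReal) :
    Prop where
  f_convex : ∀ i, ConvexOn ℝ Set.univ (f i)
  f_smooth : ∀ i, IsLocallySmooth (f i)
  r_convex : ∀ i, IsProperConvexLSC (r i)
  bddBelow : ∃ b : ℝ, ∀ x : Vec d, (b : EReal) ≤ ((∑ i, f i x : ℝ) : EReal) + ∑ i, r i x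

/-! ### The algorithm -/

/-- A tuple of sequences to be related by the algorithm: the iterates `𝐗^k, 𝐒^k, 𝐃^k, 𝐀^k, 𝐓^k`,
the common stepsizes `α^k` (`k ≥ 0`) and the numbers `back k i` of backtracking reductions made by
agent `i` in iteration `k`. -/
structure Trajectory (m d : ℕ) where
  X : ℕ → Stack m d
  S : ℕ → Stack m d
  D : ℕ → Stack m d
  A : ℕ → Stack m d
  T : ℕ → Stack m d
  α : ℕ → ℝ
  back : ℕ → Fin m → ℕ

/-- The sequence `k ↦ u^{k-1}` with `u^{-1} = z`. -/
def shiftSeq {β : Type*} (z : β) (u : ℕ → β) : ℕ → β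
  | 0 => z
  | k + 1 => u k

/-- Condition that stops the backtracking for the agent with loss `f`, at the current point `x`
and the trial point `y` obtained with the stepsize `α`. -/
def LineSearchTest {d : ℕ} (f : Vec d → ℝ) (δ α : ℝ) (x y : Vec d) : Prop :=
  f y ≤ f x + inner ℝ (gradient f x) (y - x) + δ / (2 * α) * ‖y - x‖ ^ 2

namespace Trajectory

variable {m d : ℕ}

/-- `𝐗^{k+1/2} = W 𝐗^k`. -/
def Xhalf (τ : Trajectory m d) (W : Matrix (Fin m) (Fin m) ℝ) (k : ℕ) : Stack m d :=
  mix W (τ.X k)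

/-- `𝐃^{k+1/2} = W (∇F(𝐗^k) + 𝐒^k + 𝐃^k)`. -/
def Dhalf (τ : Trajectory m d) (f : Fin m → Vec d → ℝ) (W : Matrix (Fin m) (Fin m) ℝ) (k : ℕ) :
    Stack m d :=
  mix W (gradF f (τ.X k) + τ.S k + τ.D k)

/-- `min {(1-δ)/4 · ‖a_i^k - x_i^{k-1}‖² / (‖s_i^k - s_i^0‖² + 2c ‖t_i^k‖²), n^k}`,
with `𝐗^{-1} = 0`; a fraction with denominator `0` (including `0/0`) counts as `+∞`. -/
def increment (τ : Trajectory m d) (c δ : ℝ) (n : ℕ → ℝ) (k : ℕ) (i : Fin m) : ℝ :=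
  if ‖τ.S k i - τ.S 0 i‖ ^ 2 + 2 * c * ‖τ.T k i‖ ^ 2 = 0 then n k
  else min ((1 - δ) / 4 * (‖τ.A k i - shiftSeq 0 τ.X k i‖ ^ 2 /
    (‖τ.S k i - τ.S 0 i‖ ^ 2 + 2 * c * ‖τ.T k i‖ ^ 2))) (n k)

/-- The stepsize `α̃_i^k` from which the line search of agent `i` starts;
`αinit` is `α^{-1}`. -/
def alphaTilde (τ : Trajectory m d) (c δ αinit : ℝ) (n : ℕ → ℝ) (k : ℕ) (i : Fin m) : ℝ :=
  √(shiftSeq αinit τ.α k ^ 2 + τ.increment c δ n k i)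

/-- The stepsize of agent `i` in iteration `k` after `s` backtracking reductions. -/
def trialStep (τ : Trajectory m d) (c η δ αinit : ℝ) (n : ℕ → ℝ) (k : ℕ) (i : Fin m) (s : ℕ) :
    ℝ :=
  η ^ s * τ.alphaTilde c δ αinit n k i

/-- The point that the line search of agent `i` tests in iteration `k` after `s` reductions. -/
def trialPoint (τ : Trajectory m d) (f : Fin m → Vec d → ℝ) (W : Matrix (Fin m) (Fin m) ℝ)
    (c η δ αinit : ℝ) (n : ℕ → ℝ) (k : ℕ) (i : Fin m) (s : ℕ) : Vec d :=
  τ.Xhalf W k i - τ.trialStep c η δ αinit n k i s • τ.Dhalf f W k i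

end Trajectory

/-- `τ` is generated by the decentralized adaptive three-operator splitting algorithm with global
min-consensus, with mixing matrix `W`, parameters `c, η, δ`, initial stepsize `αinit = α^{-1}` and
slack sequence `n`; `𝐗^0` and `𝐒^0` are arbitrary. -/
structure IsGenerated {m d : ℕ} (f : Fin m → Vec d → ℝ) (r : Fin m → Vec d → EReal)
    (W : Matrix (Fin m) (Fin m) ℝ) (c η δ αinit : ℝ) (n : ℕ → ℝ) (τ : Trajectory m d) :
    Prop where
  A_zero : τ.A 0 = 0
  D_zero : τ.D 0 = 0
  T_zero : τ.T 0 = 0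
  /-- The line search of each agent stops at the first trial point that passes the test. -/
  search_pass : ∀ k i, LineSearchTest (f i) δ
    (τ.trialStep c η δ αinit n k i (τ.back k i)) (τ.X k i)
    (τ.trialPoint f W c η δ αinit n k i (τ.back k i))
  search_fail : ∀ k i, ∀ s < τ.back k i, ¬ LineSearchTest (f i) δ
    (τ.trialStep c η δ αinit n k i s) (τ.X k i) (τ.trialPoint f W c η δ αinit n k i s)
  /-- Global min-consensus. -/
  alpha_min : ∀ k, IsLeast
    (Set.range fun i => τ.trialStep c η δ αinit n k i (τ.back k i)) (τ.α k)
  A_succ : ∀ k, τ.A (k + 1) = τ.Xhalf W k - τ.α k • τ.Dhalf f W k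
  X_succ : ∀ k i, IsProx (τ.α k) (r i) (τ.A (k + 1) i + τ.α k • τ.S k i) (τ.X (k + 1) i)
  S_succ : ∀ k, τ.S (k + 1) = τ.S k + (1 / τ.α k) • (τ.A (k + 1) - τ.X (k + 1))
  D_succ : ∀ k, τ.D (k + 1) =
    τ.Dhalf f W k - gradF f (τ.X k) - τ.S k + (1 / τ.α k) • (τ.X k - τ.Xhalf W k)
  T_succ : ∀ k, τ.T (k + 1) =
    τ.T k - τ.S k - τ.D k - gradF f (τ.X k) + (1 / τ.α k) • τ.X k

/-! ### The constants of the rate -/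

/-- Convex hull of the points at which the algorithm visits the loss of agent `i`: the iterates
`x_i^k`, `a_i^{k+1}` and the points tested by its line search. -/
def agentHull {m d : ℕ} (τ : Trajectory m d) (f : Fin m → Vec d → ℝ)
    (W : Matrix (Fin m) (Fin m) ℝ) (c η δ αinit : ℝ) (n : ℕ → ℝ) (i : Fin m) : Set (Vec d) :=
  convexHull ℝ {z | ∃ k, z = τ.X k i ∨ z = τ.A (k + 1) i ∨
    ∃ s ≤ τ.back k i, z = τ.trialPoint f W c η δ αinit n k i s}

/-- `F` is `Lf`-smooth on the product of the hulls `agentHull i`; since `F` is separable this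
means that each `∇fᵢ` is `Lf`-Lipschitz on the hull of agent `i`. -/
def IsSmoothnessConstant {m d : ℕ} (τ : Trajectory m d) (f : Fin m → Vec d → ℝ)
    (W : Matrix (Fin m) (Fin m) ℝ) (c η δ αinit : ℝ) (n : ℕ → ℝ) (Lf : ℝ) : Prop :=
  0 < Lf ∧ ∀ i, ∀ x ∈ agentHull τ f W c η δ αinit n i, ∀ y ∈ agentHull τ f W c η δ αinit n i,
    ‖gradient (f i) x - gradient (f i) y‖ ≤ Lf * ‖x - y‖

/-- Tangent control of the subgradients: `‖(𝐒^k)_T - (𝐒*)_T‖ ≤ Lr ‖𝐗^k - 𝐗*‖` for all large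
`k`, with row-wise projections onto `T`. -/
def IsTangentConstant {m d : ℕ} (τ : Trajectory m d) (T : Submodule ℝ (Vec d))
    (Xstar Sstar : Stack m d) (Lr : ℝ) : Prop :=
  0 ≤ Lr ∧ ∀ᶠ k in atTop,
    ‖rowProj T (τ.S k) - rowProj T Sstar‖ ≤ Lr * ‖τ.X k - Xstar‖

end

/-!
The iteration is a primal-dual splitting whose fixed points satisfy
`∇F(𝐗*) + 𝐒* + (I - W) 𝐓* = 0`; `𝐃^k = (I - W) 𝐓^k` is the multiplier of the consensus constraint.
The proof has three parts.

*Energy.* With `q(t) = ⟨(I - W) t, W t⟩`, one step with stepsize `α` decreases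
`‖𝐗^k - 𝐗*‖² + α² (‖𝐒^k - 𝐒*‖² + q(𝐓^k - 𝐓*))` by a multiple of `‖𝐗^k - 𝐀^{k+1}‖²` plus
`α μ ‖𝐗^k - 𝐗*‖²` (`energy_step`, `inner_gradF_sub_ge`). Three effects of the adaptive stepsize
have to be controlled. The stepsizes converge, since their squares decrease up to summable terms
(`exists_alpha_tendsto`), so the changing weights of the energy cost a factor `1 + o(1)`. The
limit is positive (`exists_pos_le_alpha`): this is shown before any global Lipschitz constant is
available, from the fact that trial points with stepsizes up to `α^{k-1} / η` approach `x*`; it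
also yields the existence of `L_f`. The stepsize of an agent may exceed the common one, but the
two merge, so the test passed by the agent's own trial point holds at `𝐀^{k+1}` up to `o(1)` times
the energy (`eventually_bregman_le`).

*Local structure.* Monotonicity of `∂rᵢ`, non-degeneracy and inner semicontinuity force
`x_i^k ∈ M` for all large `k` (`IsPartlySmoothAt.eventually_mem`), and the tangential components
of subgradients on `M` are those of the gradient of a `C²` function, which gives `L_r`
(`IsPartlySmoothAt.exists_tangent_lipschitz`). Since `M` is affine and common to all agents,
projection onto the normal space commutes with mixing. The normal part of the recursion then
telescopes and determines the normal components of `𝐃^{k+1}` and `𝐒^{k+1}` from `∇F(𝐗^k)`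
(`normal_components_eq`).

*Rate.* The tangential component of `𝐒^k` is bounded through `L_r`, that of `𝐃^{k+1}` through the
primal-dual equation, and `q(t) ≤ ‖(I - W) t‖² / (c (1 - λ₂))` by the spectral gap. Hence the
dissipation of two consecutive steps bounds the energy up to a factor of order
`κ_f (1 + κ_r²) / (1 - λ₂)` (`eventually_energy_le`), and linear convergence follows
(`exists_le_exp_of_dissipation`). When `L_f < μ` this factor may be too small to be a valid rate,
but then the run stops at the solution after finitely many steps (`eventually_eq_of_lt`).
-/

noncomputable section

/-! ### Spectrum of the gossip matrix -/

section Spectrum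

variable {m : ℕ} {G : SimpleGraph (Fin m)} {Wt : Matrix (Fin m) (Fin m) ℝ}

theorem IsGossipMatrix.nonneg (h : IsGossipMatrix G Wt) (i j : Fin m) : 0 ≤ Wt i j := by
  by_cases hij : i = j
  · subst hij; exact (h.diag_pos i).le
  · by_cases ha : G.Adj i j
    · exact (h.adj_pos i j ha).le
    · exact (h.eq_zero i j hij ha).ge

/-- On an eigenvector with eigenvalue `lam`, the Dirichlet form of the network
(`s = 1`) and its signless analogue (`s = -1`) both reduce to multiples of `‖v‖²`. -/
theorem IsGossipMatrix.dirichlet_eq (h : IsGossipMatrix G Wt) {v : Fin m → ℝ} {lam : ℝ}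
    (hv : Wt.mulVec v = lam • v) {s : ℝ} (hs : s ^ 2 = 1) :
    ∑ i, ∑ j, Wt i j * (v i - s * v j) ^ 2 = 2 * (1 - s * lam) * ∑ i, v i ^ 2 := by
  have h1 : ∀ i, ∑ j, Wt i j * v j = lam * v i := fun i => by
    have := congrFun hv i
    simpa [Matrix.mulVec, dotProduct] using this
  have h2 : ∑ i, ∑ j, Wt i j * v j ^ 2 = ∑ i, v i ^ 2 := by
    rw [Finset.sum_comm]
    refine Finset.sum_congr rfl fun j _ => ?_
    rw [← Finset.sum_mul]
    have : ∑ i, Wt i j = 1 := by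
      rw [← h.row_sum j]
      exact Finset.sum_congr rfl fun i _ => h.symm.apply j i
    rw [this, one_mul]
  calc ∑ i, ∑ j, Wt i j * (v i - s * v j) ^ 2
      = ∑ i, (v i ^ 2 * ∑ j, Wt i j - 2 * s * v i * ∑ j, Wt i j * v j
          + s ^ 2 * ∑ j, Wt i j * v j ^ 2) := by
        refine Finset.sum_congr rfl fun i _ => ?_
        simp only [Finset.mul_sum, ← Finset.sum_sub_distrib, ← Finset.sum_add_distrib]
        exact Finset.sum_congr rfl fun j _ => by ring
    _ = _ := by
        simp only [h.row_sum, h1, hs, one_mul, Finset.sum_add_distrib, h2]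
        rw [← Finset.sum_add_distrib, Finset.mul_sum]
        exact Finset.sum_congr rfl fun i _ => by ring

theorem IsGossipMatrix.abs_eigenvalue_le (h : IsGossipMatrix G Wt) {v : Fin m → ℝ} {lam : ℝ}
    (hv : Wt.mulVec v = lam • v) (hpos : 0 < ∑ i, v i ^ 2) : |lam| ≤ 1 := by
  have key : ∀ s : ℝ, s ^ 2 = 1 → 0 ≤ 1 - s * lam := fun s hs => by
    have h0 : 0 ≤ ∑ i, ∑ j, Wt i j * (v i - s * v j) ^ 2 :=
      Finset.sum_nonneg fun i _ => Finset.sum_nonneg fun j _ =>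
        mul_nonneg (h.nonneg i j) (sq_nonneg _)
    rw [h.dirichlet_eq hv hs] at h0
    by_contra hneg
    nlinarith
  have h1 := key 1 (by norm_num)
  have h2 := key (-1) (by norm_num)
  exact abs_le.2 ⟨by linarith, by linarith⟩

/-- On a connected network, fixed vectors of the gossip matrix are constant. -/
theorem IsGossipMatrix.const_of_fixed (h : IsGossipMatrix G Wt) (hG : G.Connected)
    {v : Fin m → ℝ} (hv : Wt.mulVec v = v) (i j : Fin m) : v i = v j := by
  have h0 := h.dirichlet_eq (lam := 1) (v := v) (by simpa using hv) (s := 1) (by norm_num)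
  simp only [one_mul, sub_self, mul_zero, zero_mul] at h0
  have hterm : ∀ i j, 0 ≤ Wt i j * (v i - v j) ^ 2 := fun i j =>
    mul_nonneg (h.nonneg i j) (sq_nonneg _)
  have hadj : ∀ i j, G.Adj i j → v i = v j := fun i j hij => by
    have h1 := (Finset.sum_eq_zero_iff_of_nonneg
      (fun i _ => Finset.sum_nonneg fun j _ => hterm i j)).1 h0 i (Finset.mem_univ i)
    have h2 := (Finset.sum_eq_zero_iff_of_nonneg (fun j _ => hterm i j)).1 h1 j (Finset.mem_univ j)
    rcases mul_eq_zero.1 h2 with h3 | h3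
    · exact absurd h3 (h.adj_pos i j hij).ne'
    · exact sub_eq_zero.1 (pow_eq_zero_iff two_ne_zero |>.1 h3)
  obtain ⟨p⟩ := hG.preconnected i j
  induction p with
  | nil => rfl
  | cons hij _ ih => exact (hadj _ _ hij).trans ih

theorem sum_sq_eigenvectorBasis (hA : Wt.IsHermitian) (i : Fin m) :
    ∑ k, (hA.eigenvectorBasis i) k ^ 2 = 1 := by
  have := (hA.eigenvectorBasis).orthonormal.1 i
  have h2 := EuclideanSpace.norm_sq_eq (hA.eigenvectorBasis i)
  rw [this] at h2
  simpa using h2.symm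

theorem IsGossipMatrix.abs_eigenvalues_le (h : IsGossipMatrix G Wt) (i : Fin m) :
    |h.isHermitian.eigenvalues i| ≤ 1 :=
  h.abs_eigenvalue_le (h.isHermitian.mulVec_eigenvectorBasis i)
    (by rw [sum_sq_eigenvectorBasis]; norm_num)

/-- A connected network has a simple leading eigenvalue. -/
theorem IsGossipMatrix.eigenvalues_eq_one_unique (h : IsGossipMatrix G Wt) (hG : G.Connected)
    {i j : Fin m} (hi : h.isHermitian.eigenvalues i = 1) (hj : h.isHermitian.eigenvalues j = 1) :
    i = j := by
  by_contra hij
  have hfix : ∀ l, h.isHermitian.eigenvalues l = 1 →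
      Wt.mulVec (h.isHermitian.eigenvectorBasis l).ofLp =
        (h.isHermitian.eigenvectorBasis l).ofLp := fun l hl => by
    rw [h.isHermitian.mulVec_eigenvectorBasis l, hl, one_smul]
  have ci := h.const_of_fixed hG (hfix i hi)
  have cj := h.const_of_fixed hG (hfix j hj)
  have ho : inner ℝ (h.isHermitian.eigenvectorBasis i) (h.isHermitian.eigenvectorBasis j) = 0 :=
    h.isHermitian.eigenvectorBasis.orthonormal.2 hij
  have si := sum_sq_eigenvectorBasis h.isHermitian i
  have sj := sum_sq_eigenvectorBasis h.isHermitian j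
  rw [PiLp.inner_apply] at ho
  simp only [RCLike.inner_apply, conj_trivial] at ho
  simp only [ci _ i, cj _ i, Finset.sum_const, nsmul_eq_mul] at ho si sj
  have hm : ((Finset.univ : Finset (Fin m)).card : ℝ) ≠ 0 := fun h0 => by
    rw [h0, zero_mul] at si; norm_num at si
  rcases mul_eq_zero.1 ho with h1 | h1
  · exact hm h1
  · rcases mul_eq_zero.1 h1 with h2 | h2
    · rw [h2] at sj; norm_num at sj
    · rw [h2] at si; norm_num at si

theorem inner_eigenvectorBasis_mulVec (hA : Wt.IsHermitian) (i : Fin m)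
    (v : EuclideanSpace ℝ (Fin m)) :
    inner ℝ (hA.eigenvectorBasis i) (WithLp.toLp 2 (Wt.mulVec v.ofLp)) =
      hA.eigenvalues i * inner ℝ (hA.eigenvectorBasis i) v := by
  have hs : Wt.transpose = Wt := by
    rw [Matrix.IsHermitian, Matrix.conjTranspose_eq_transpose_of_trivial] at hA; exact hA
  have h1 := hA.mulVec_eigenvectorBasis i
  have h2 : ∀ x y : EuclideanSpace ℝ (Fin m), inner ℝ x y = x.ofLp ⬝ᵥ y.ofLp := fun x y => by
    simp [PiLp.inner_apply, dotProduct, mul_comm]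
  rw [h2, h2]
  rw [Matrix.dotProduct_mulVec, ← Matrix.mulVec_transpose, hs, h1, smul_dotProduct, smul_eq_mul]

theorem exists_eigenvalues_eq (hm : 2 ≤ m) (hA : Wt.IsHermitian) :
    ∃ i0 i1 : Fin m, i0 ≠ i1 ∧ hA.eigenvalues i1 = lambda2 hm hA ∧
      (∀ i, hA.eigenvalues i ≤ hA.eigenvalues i0) ∧
      ∀ i, i ≠ i0 → hA.eigenvalues i ≤ lambda2 hm hA := by
  let e : Fin (Fintype.card (Fin m)) ≃ Fin m :=
    Fintype.equivOfCardEq (Fintype.card_fin (Fintype.card (Fin m)))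
  have hev : ∀ i, hA.eigenvalues i = hA.eigenvalues₀ (e.symm i) := fun i => rfl
  have hc : Fintype.card (Fin m) = m := Fintype.card_fin m
  refine ⟨e ⟨0, by omega⟩, e ⟨1, by omega⟩, ?_, ?_, ?_, ?_⟩
  · intro h0
    have := e.injective h0
    simp at this
  · rw [hev, Equiv.symm_apply_apply]; rfl
  · intro i
    rw [hev, hev, Equiv.symm_apply_apply]
    exact hA.eigenvalues₀_antitone (Fin.mk_le_of_le_val (Nat.zero_le _))
  · intro i hi
    rw [hev]
    refine hA.eigenvalues₀_antitone (Fin.mk_le_of_le_val ?_)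
    by_contra hlt
    have h0 : (e.symm i).val = 0 := by omega
    exact hi ((Equiv.symm_apply_eq e).1 (Fin.ext h0))

theorem IsGossipMatrix.lambda2_lt_one (h : IsGossipMatrix G Wt) (hG : G.Connected) (hm : 2 ≤ m) :
    lambda2 hm h.isHermitian < 1 := by
  obtain ⟨i0, i1, hne, h1, hmax, -⟩ := exists_eigenvalues_eq hm h.isHermitian
  by_contra hge
  have b0 := (abs_le.1 (h.abs_eigenvalues_le i0)).2
  have b1 := (abs_le.1 (h.abs_eigenvalues_le i1)).2
  have := hmax i1
  exact hne (h.eigenvalues_eq_one_unique hG (by linarith) (by linarith))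

theorem IsGossipMatrix.neg_one_le_lambda2 (h : IsGossipMatrix G Wt) (hm : 2 ≤ m) :
    -1 ≤ lambda2 hm h.isHermitian := by
  obtain ⟨i0, i1, hne, h1, -⟩ := exists_eigenvalues_eq hm h.isHermitian
  rw [← h1]
  exact (abs_le.1 (h.abs_eigenvalues_le i1)).1

/-- The spectrum of the gossip matrix is contained in `[-1, λ₂] ∪ {1}`. -/
theorem IsGossipMatrix.eigenvalues_eq_one_or_le (h : IsGossipMatrix G Wt)
    (hm : 2 ≤ m) (i : Fin m) :
    h.isHermitian.eigenvalues i = 1 ∨ h.isHermitian.eigenvalues i ≤ lambda2 hm h.isHermitian := by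
  obtain ⟨i0, i1, hne, h1, hmax, hoth⟩ := exists_eigenvalues_eq hm h.isHermitian
  by_cases hi : i = i0
  · subst hi
    left
    by_contra hn
    have hlt : ∀ j, h.isHermitian.eigenvalues j ≠ 1 := fun j hj => by
      have b0 := (abs_le.1 (h.abs_eigenvalues_le i)).2
      have := hmax j
      exact hn (by linarith)
    -- the all-ones vector is fixed, hence orthogonal to the whole eigenbasis
    let o : EuclideanSpace ℝ (Fin m) := WithLp.toLp 2 fun _ => 1
    have ho : WithLp.toLp 2 (Wt.mulVec o.ofLp) = o := by
      ext k
      simp [o, Matrix.mulVec, dotProduct, h.row_sum]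
    have hz : ∀ j, inner ℝ (h.isHermitian.eigenvectorBasis j) o = 0 := fun j => by
      have h2 := inner_eigenvectorBasis_mulVec h.isHermitian j o
      rw [ho] at h2
      have h3 : (1 - h.isHermitian.eigenvalues j) *
          inner ℝ (h.isHermitian.eigenvectorBasis j) o = 0 := by linarith
      exact (mul_eq_zero.1 h3).resolve_left (sub_ne_zero.2 (hlt j).symm)
    have h4 := h.isHermitian.eigenvectorBasis.sum_inner_mul_inner o o
    simp only [hz, mul_zero, Finset.sum_const_zero] at h4
    have h5 : o = 0 := inner_self_eq_zero.1 h4.symm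
    have h6 : o i = 0 := by rw [h5]; rfl
    simp [o] at h6
  · exact Or.inr (hoth i hi)

/-- The normalized Laplacian `I - W̃` satisfies `(1 - λ₂) (I - W̃) ≤ (I - W̃)² ≤ 2 (I - W̃)`. -/
theorem IsGossipMatrix.laplacian_bounds (h : IsGossipMatrix G Wt)
    (hm : 2 ≤ m) (v : Fin m → ℝ) :
    (1 - lambda2 hm h.isHermitian) * ∑ i, (v i - Wt.mulVec v i) * v i ≤
        ∑ i, (v i - Wt.mulVec v i) ^ 2 ∧
      ∑ i, (v i - Wt.mulVec v i) ^ 2 ≤ 2 * ∑ i, (v i - Wt.mulVec v i) * v i := by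
  let b := h.isHermitian.eigenvectorBasis
  let V : EuclideanSpace ℝ (Fin m) := WithLp.toLp 2 v
  let Z : EuclideanSpace ℝ (Fin m) := V - WithLp.toLp 2 (Wt.mulVec v)
  have hb : ∀ i, inner ℝ (b i) Z = (1 - h.isHermitian.eigenvalues i) * inner ℝ (b i) V :=
    fun i => by
      have := inner_eigenvectorBasis_mulVec h.isHermitian i V
      simp only [Z, inner_sub_right]
      rw [this]; ring
  have hZV : ∑ i, (v i - Wt.mulVec v i) * v i
      = ∑ i, (1 - h.isHermitian.eigenvalues i) * inner ℝ (b i) V ^ 2 := by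
    have h1 : inner ℝ Z V = ∑ i, (v i - Wt.mulVec v i) * v i := by
      simp [PiLp.inner_apply, Z, V, mul_comm]
    rw [← h1, ← b.sum_inner_mul_inner Z V]
    exact Finset.sum_congr rfl fun i _ => by rw [real_inner_comm, hb]; ring
  have hZZ : ∑ i, (v i - Wt.mulVec v i) ^ 2
      = ∑ i, (1 - h.isHermitian.eigenvalues i) ^ 2 * inner ℝ (b i) V ^ 2 := by
    have h1 : inner ℝ Z Z = ∑ i, (v i - Wt.mulVec v i) ^ 2 := by
      rw [PiLp.inner_apply]; simp [Z, V, sq]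
    rw [← h1, ← b.sum_inner_mul_inner Z Z]
    exact Finset.sum_congr rfl fun i _ => by rw [real_inner_comm, hb]; ring
  rw [hZV, hZZ, Finset.mul_sum, Finset.mul_sum]
  constructor
  · refine Finset.sum_le_sum fun i _ => ?_
    rcases h.eigenvalues_eq_one_or_le hm i with h1 | h1
    · rw [h1]; simp
    · have h2 := (abs_le.1 (h.abs_eigenvalues_le i)).2
      rw [← mul_assoc]
      refine mul_le_mul_of_nonneg_right ?_ (sq_nonneg _)
      nlinarith
  · refine Finset.sum_le_sum fun i _ => ?_
    have h2 := abs_le.1 (h.abs_eigenvalues_le i)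
    rw [← mul_assoc]
    refine mul_le_mul_of_nonneg_right ?_ (sq_nonneg _)
    nlinarith

end Spectrum

/-! ### Mixing and row projections on stacked variables -/

section Mixing

variable {m d : ℕ}

/-- Multiplication by a matrix, as a continuous linear map on stacked variables. -/
def mixCLM (B : Matrix (Fin m) (Fin m) ℝ) : Stack m d →L[ℝ] Stack m d where
  toFun := mix B
  map_add' Y Z := by
    ext i l; simp [mix, smul_add, Finset.sum_add_distrib]
  map_smul' a Z := by
    ext i l; simp [mix, Finset.mul_sum, mul_left_comm]
  cont := by unfold mix; fun_prop

theorem mixCLM_apply (B : Matrix (Fin m) (Fin m) ℝ) (Z : Stack m d) : mixCLM B Z = mix B Z := rfl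

/-- `I - W = c (I - W̃)`. -/
def gossipLaplacian (c : ℝ) (Wt : Matrix (Fin m) (Fin m) ℝ) : Matrix (Fin m) (Fin m) ℝ :=
  c • (1 - Wt)

theorem mix_apply_apply (B : Matrix (Fin m) (Fin m) ℝ) (Z : Stack m d) (i : Fin m) (l : Fin d) :
    mix B Z i l = B.mulVec (fun j => Z j l) i := by
  simp [mix, Matrix.mulVec, dotProduct]

theorem mix_lazyMatrix (c : ℝ) (Wt : Matrix (Fin m) (Fin m) ℝ) (Z : Stack m d) :
    mix (lazyMatrix c Wt) Z = Z - mixCLM (gossipLaplacian c Wt) Z := by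
  ext i l
  simp only [mixCLM_apply, PiLp.sub_apply, mix_apply_apply, lazyMatrix, gossipLaplacian,
    Matrix.add_mulVec, Matrix.smul_mulVec, Matrix.sub_mulVec, Matrix.one_mulVec, Pi.add_apply,
    Pi.smul_apply, Pi.sub_apply, smul_eq_mul]
  ring

theorem Stack.inner_eq (Y Z : Stack m d) : inner ℝ Y Z = ∑ l, ∑ i, Y i l * Z i l := by
  rw [PiLp.inner_apply, Finset.sum_comm]
  refine Finset.sum_congr rfl fun i _ => ?_
  simp [PiLp.inner_apply, mul_comm]

theorem mixCLM_isSymm {B : Matrix (Fin m) (Fin m) ℝ} (hB : B.IsSymm) (Y Z : Stack m d) :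
    inner ℝ (mixCLM B Y) Z = inner ℝ Y (mixCLM B Z) := by
  simp only [Stack.inner_eq, mixCLM_apply, mix_apply_apply, Matrix.mulVec, dotProduct,
    Finset.sum_mul, Finset.mul_sum]
  refine Finset.sum_congr rfl fun l _ => ?_
  rw [Finset.sum_comm]
  refine Finset.sum_congr rfl fun i _ => Finset.sum_congr rfl fun j _ => ?_
  rw [hB.apply i j]; ring

theorem IsGossipMatrix.gossipLaplacian_isSymm {G : SimpleGraph (Fin m)}
    {Wt : Matrix (Fin m) (Fin m) ℝ} (h : IsGossipMatrix G Wt) (c : ℝ) :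
    (gossipLaplacian c Wt).IsSymm :=
  (Matrix.isSymm_one.sub h.symm).smul c

theorem mixCLM_gossipLaplacian_apply (c : ℝ) (Wt : Matrix (Fin m) (Fin m) ℝ) (Z : Stack m d)
    (i : Fin m) (l : Fin d) :
    mixCLM (gossipLaplacian c Wt) Z i l = c * (Z i l - Wt.mulVec (fun j => Z j l) i) := by
  simp only [mixCLM_apply, mix_apply_apply, gossipLaplacian, Matrix.smul_mulVec,
    Matrix.sub_mulVec, Matrix.one_mulVec, Pi.smul_apply, Pi.sub_apply, smul_eq_mul]

theorem IsGossipMatrix.mixCLM_bounds {G : SimpleGraph (Fin m)} {Wt : Matrix (Fin m) (Fin m) ℝ}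
    (h : IsGossipMatrix G Wt) (hm : 2 ≤ m) (c : ℝ) (Z : Stack m d) :
    c * (1 - lambda2 hm h.isHermitian) * inner ℝ (mixCLM (gossipLaplacian c Wt) Z) Z ≤
        ‖mixCLM (gossipLaplacian c Wt) Z‖ ^ 2 ∧
      ‖mixCLM (gossipLaplacian c Wt) Z‖ ^ 2 ≤
        2 * c * inner ℝ (mixCLM (gossipLaplacian c Wt) Z) Z := by
  have h1 : inner ℝ (mixCLM (gossipLaplacian c Wt) Z) Z =
      c * ∑ l, ∑ i, (Z i l - Wt.mulVec (fun j => Z j l) i) * Z i l := by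
    simp only [Stack.inner_eq, mixCLM_gossipLaplacian_apply, Finset.mul_sum, mul_assoc]
  have h2 : ‖mixCLM (gossipLaplacian c Wt) Z‖ ^ 2 =
      c ^ 2 * ∑ l, ∑ i, (Z i l - Wt.mulVec (fun j => Z j l) i) ^ 2 := by
    rw [← real_inner_self_eq_norm_sq]
    simp only [Stack.inner_eq, mixCLM_gossipLaplacian_apply, Finset.mul_sum]
    exact Finset.sum_congr rfl fun l _ => Finset.sum_congr rfl fun i _ => by ring
  have h3 : ∀ l : Fin d, _ := fun l => h.laplacian_bounds hm (fun j => Z j l)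
  have h4 := Finset.sum_le_sum fun l (_ : l ∈ Finset.univ) => (h3 l).1
  have h5 := Finset.sum_le_sum fun l (_ : l ∈ Finset.univ) => (h3 l).2
  rw [← Finset.mul_sum] at h4 h5
  rw [h1, h2]
  constructor
  · have := mul_le_mul_of_nonneg_left h4 (sq_nonneg c)
    linarith
  · have := mul_le_mul_of_nonneg_left h5 (sq_nonneg c)
    linarith

theorem IsGossipMatrix.mixCLM_consensus {G : SimpleGraph (Fin m)} {Wt : Matrix (Fin m) (Fin m) ℝ}
    (h : IsGossipMatrix G Wt) (c : ℝ) (x : Vec d) :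
    mixCLM (gossipLaplacian c Wt) (consensus m x) = 0 := by
  ext i l
  simp [mixCLM_gossipLaplacian_apply, consensus, Matrix.mulVec, dotProduct, ← Finset.sum_mul,
    h.row_sum]

/-- Row-wise orthogonal projection as a continuous linear map. -/
def rowProjCLM (m : ℕ) (T : Submodule ℝ (Vec d)) : Stack m d →L[ℝ] Stack m d where
  toFun := rowProj T
  map_add' Y Z := by ext i l; simp [rowProj]
  map_smul' a Z := by ext i l; simp [rowProj]
  cont := by unfold rowProj; fun_prop

theorem rowProjCLM_apply (T : Submodule ℝ (Vec d)) (Z : Stack m d) :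
    rowProjCLM m T Z = rowProj T Z := rfl

theorem rowProjCLM_apply_row (T : Submodule ℝ (Vec d)) (Z : Stack m d) (i : Fin m) :
    rowProjCLM m T Z i = T.starProjection (Z i) := rfl

theorem rowProjCLM_mixCLM (T : Submodule ℝ (Vec d)) (B : Matrix (Fin m) (Fin m) ℝ)
    (Z : Stack m d) : rowProjCLM m T (mixCLM B Z) = mixCLM B (rowProjCLM m T Z) := by
  refine PiLp.ext fun i => ?_
  simp [rowProjCLM_apply, mixCLM_apply, rowProj, mix]

theorem norm_sq_eq_rowProjCLM (T : Submodule ℝ (Vec d)) (Z : Stack m d) :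
    ‖Z‖ ^ 2 = ‖rowProjCLM m T Z‖ ^ 2 + ‖Z - rowProjCLM m T Z‖ ^ 2 := by
  rw [PiLp.norm_sq_eq_of_L2 _ Z, PiLp.norm_sq_eq_of_L2 _ (rowProjCLM m T Z),
    PiLp.norm_sq_eq_of_L2 _ (Z - _), ← Finset.sum_add_distrib]
  refine Finset.sum_congr rfl fun i _ => ?_
  rw [PiLp.sub_apply, rowProjCLM_apply_row,
    Submodule.norm_sq_eq_add_norm_sq_starProjection (Z i) T,
    Submodule.starProjection_orthogonal_val]

end Mixing

/-! ### Convexity and subgradients -/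

section Convex

variable {H : Type*} [NormedAddCommGroup H] [InnerProductSpace ℝ H]

/-- First-order lower bound for strongly convex functions, from one directional derivative. -/
theorem StrongConvexOn.add_deriv_le {f : H → ℝ} {U : Set H} {μ : ℝ} (hf : StrongConvexOn U μ f)
    {x y : H} (hx : x ∈ U) (hy : y ∈ U) {f' : ℝ}
    (hd : HasDerivAt (fun t : ℝ => f (x + t • (y - x))) f' 0) :
    f x + f' + μ / 2 * ‖y - x‖ ^ 2 ≤ f y := by
  have hlim : Tendsto (fun t : ℝ => t⁻¹ • (f (x + t • (y - x)) - f x)) (𝓝[>] 0) (𝓝 f') := by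
    have := hd.tendsto_slope_zero_right
    simpa using this
  have hlim2 : Tendsto (fun t : ℝ => f y - f x - (1 - t) * (μ / 2 * ‖y - x‖ ^ 2)) (𝓝[>] 0)
      (𝓝 (f y - f x - (1 - 0) * (μ / 2 * ‖y - x‖ ^ 2))) := by
    refine Tendsto.mono_left ?_ nhdsWithin_le_nhds
    exact Continuous.tendsto (by fun_prop) 0
  have hle : ∀ᶠ t : ℝ in 𝓝[>] 0, t⁻¹ • (f (x + t • (y - x)) - f x)
      ≤ f y - f x - (1 - t) * (μ / 2 * ‖y - x‖ ^ 2) := by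
    filter_upwards [Ioo_mem_nhdsGT (show (0 : ℝ) < 1 by norm_num)] with t ht
    have h1 := hf.2 hx hy (show 0 ≤ 1 - t by linarith [ht.2]) ht.1.le (by ring)
    have h2 : (1 - t) • x + t • y = x + t • (y - x) := by module
    rw [h2, norm_sub_rev x y] at h1
    simp only [smul_eq_mul] at h1
    rw [smul_eq_mul, inv_mul_le_iff₀ ht.1]
    nlinarith
  have := le_of_tendsto_of_tendsto hlim hlim2 hle
  linarith

theorem hasDerivAt_comp_line [CompleteSpace H] {f : H → ℝ} {x : H} (hf : DifferentiableAt ℝ f x)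
    (v : H) : HasDerivAt (fun t : ℝ => f (x + t • v)) (inner ℝ (gradient f x) v) 0 := by
  have h1 : HasFDerivAt f (fderiv ℝ f x) (x + (0 : ℝ) • v) := by
    rw [zero_smul, add_zero]; exact hf.hasFDerivAt
  have h2 : HasDerivAt (fun t : ℝ => x + t • v) v 0 := by
    simpa using ((hasDerivAt_id (0 : ℝ)).smul_const v).const_add x
  have h3 := h1.comp_hasDerivAt (0 : ℝ) h2
  rwa [← inner_gradient_left] at h3

theorem ConvexOn.add_inner_gradient_le [CompleteSpace H] {f : H → ℝ}
    (hf : ConvexOn ℝ Set.univ f) {x : H} (hd : DifferentiableAt ℝ f x) (y : H) :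
    f x + inner ℝ (gradient f x) (y - x) ≤ f y := by
  have := (strongConvexOn_zero.2 hf).add_deriv_le (Set.mem_univ x) (Set.mem_univ y)
    (hasDerivAt_comp_line hd (y - x))
  simpa using this

theorem hasDerivAt_sumF_line {m d : ℕ} {f : Fin m → Vec d → ℝ} (hf : ∀ i, Differentiable ℝ (f i))
    (X V : Stack m d) :
    HasDerivAt (fun t : ℝ => sumF f (X + t • V)) (inner ℝ (gradF f X) V) 0 := by
  have := HasDerivAt.fun_sum (u := Finset.univ) fun i _ =>
    hasDerivAt_comp_line (hf i (X i)) (V i)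
  rw [PiLp.inner_apply]
  exact this

theorem subdiff_ne_top {r : H → EReal} {x : H} (hproper : ∃ y, r y ≠ ⊤)
    (hx : (subdiff r x).Nonempty) : r x ≠ ⊤ := by
  obtain ⟨v, hv⟩ := hx
  obtain ⟨y, hy⟩ := hproper
  intro h
  have := hv y
  rw [h, EReal.top_add_coe, top_le_iff] at this
  exact hy this

theorem inner_sub_nonneg_of_mem_subdiff {r : H → EReal} {x y v w : H} (hbot : ∀ z, r z ≠ ⊥)
    (hproper : ∃ y, r y ≠ ⊤) (hv : v ∈ subdiff r x) (hw : w ∈ subdiff r y) :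
    0 ≤ inner ℝ (v - w) (x - y) := by
  have hx := EReal.coe_toReal (subdiff_ne_top hproper ⟨v, hv⟩) (hbot x)
  have hy := EReal.coe_toReal (subdiff_ne_top hproper ⟨w, hw⟩) (hbot y)
  have h1 := hv y
  have h2 := hw x
  rw [← hx, ← hy] at h1 h2
  norm_cast at h1 h2
  have h3 : inner ℝ v (y - x) = - inner ℝ v (x - y) := by rw [← inner_neg_right, neg_sub]
  rw [inner_sub_left]
  linarith

theorem IsProx.mem_subdiff {d : ℕ} {r : Vec d → EReal} (hr : IsProperConvexLSC r) {α : ℝ}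
    (hα : 0 < α) {u p : Vec d} (hp : IsProx α r u p) : (1 / α) • (u - p) ∈ subdiff r p := by
  have hpt : r p ≠ ⊤ := by
    obtain ⟨y, hy⟩ := hr.exists_ne_top
    intro h
    have h1 := hp y
    rw [h, EReal.top_add_coe, top_le_iff] at h1
    rw [← EReal.coe_toReal hy (hr.ne_bot y), ← EReal.coe_add] at h1
    exact EReal.coe_ne_top _ h1
  have hpr := EReal.coe_toReal hpt (hr.ne_bot p)
  intro y
  by_cases hyt : r y = ⊤
  · rw [hyt]; exact le_top
  have hyr := EReal.coe_toReal hyt (hr.ne_bot y)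
  set a := (r p).toReal
  set b := (r y).toReal
  rw [← hpr, ← hyr]
  norm_cast
  -- compare `p` with the points `p + t (y - p)`
  have hle : ∀ᶠ t : ℝ in 𝓝[>] 0,
      a + inner ℝ ((1 / α) • (u - p)) (y - p) ≤ b + t * (‖y - p‖ ^ 2 / (2 * α)) := by
    filter_upwards [Ioo_mem_nhdsGT (show (0 : ℝ) < 1 by norm_num)] with t ht
    have h1 := hr.convex (x := (p, a)) (by simp [← hpr]) (y := (y, b)) (by simp [← hyr])
      (a := 1 - t) (b := t) (by linarith [ht.2]) ht.1.le (by ring)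
    have h2 : (1 - t) • (p, a) + t • (y, b) = (p + t • (y - p), (1 - t) * a + t * b) := by
      ext1
      · simp only [Prod.fst_add, Prod.smul_fst]; module
      · simp
    rw [h2] at h1
    have h3 : r (p + t • (y - p)) ≤ (((1 - t) * a + t * b : ℝ) : EReal) := h1
    have h4 := (hp (p + t • (y - p))).trans (add_le_add_left h3 _)
    rw [← hpr] at h4
    norm_cast at h4
    have h5 : ‖u - (p + t • (y - p))‖ ^ 2
        = ‖u - p‖ ^ 2 - 2 * t * inner ℝ (u - p) (y - p) + t ^ 2 * ‖y - p‖ ^ 2 := by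
      rw [← sub_sub, norm_sub_sq_real, inner_smul_right, norm_smul, mul_pow, Real.norm_eq_abs,
        sq_abs]
      ring
    rw [h5] at h4
    rw [inner_smul_left]
    simp only [conj_trivial]
    have h6 : (‖u - p‖ ^ 2 - 2 * t * inner ℝ (u - p) (y - p) + t ^ 2 * ‖y - p‖ ^ 2) / (2 * α)
        = ‖u - p‖ ^ 2 / (2 * α) - t * (1 / α * inner ℝ (u - p) (y - p))
          + t * (t * (‖y - p‖ ^ 2 / (2 * α))) := by
      field_simp
    rw [h6] at h4
    have h7 : t * (a + 1 / α * inner ℝ (u - p) (y - p))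
        ≤ t * (b + t * (‖y - p‖ ^ 2 / (2 * α))) := by linarith
    exact le_of_mul_le_mul_left h7 ht.1
  have hlim : Tendsto (fun t : ℝ => b + t * (‖y - p‖ ^ 2 / (2 * α))) (𝓝[>] 0)
      (𝓝 (b + 0 * (‖y - p‖ ^ 2 / (2 * α)))) :=
    Tendsto.mono_left (Continuous.tendsto (by fun_prop) 0) nhdsWithin_le_nhds
  simpa using ge_of_tendsto hlim hle

theorem ereal_coe_sum {ι : Type*} (s : Finset ι) (f : ι → ℝ) :
    ((∑ i ∈ s, f i : ℝ) : EReal) = ∑ i ∈ s, (f i : EReal) :=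
  map_sum (⟨⟨Real.toEReal, EReal.coe_zero⟩, EReal.coe_add⟩ : ℝ →+ EReal) f s

/-- The subdifferential of a separable sum is the product of the subdifferentials. -/
theorem mem_subdiff_sumR {m d : ℕ} {r : Fin m → Vec d → EReal} (hbot : ∀ i x, r i x ≠ ⊥)
    {X : Stack m d} (hX : ∀ i, r i (X i) ≠ ⊤) {V : Stack m d} :
    V ∈ subdiff (sumR r) X ↔ ∀ i, V i ∈ subdiff (r i) (X i) := by
  have hc : ∀ i, ((r i (X i)).toReal : EReal) = r i (X i) := fun i =>
    EReal.coe_toReal (hX i) (hbot i _)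
  constructor
  · intro hV i y
    by_cases hy : r i y = ⊤
    · rw [hy]; exact le_top
    have hb := EReal.coe_toReal hy (hbot i y)
    have h1 := hV (WithLp.toLp 2 (Function.update X.ofLp i y))
    have h2 : sumR r (WithLp.toLp 2 (Function.update X.ofLp i y))
        = ((∑ j, Function.update (fun j => (r j (X j)).toReal) i (r i y).toReal j : ℝ) :
          EReal) := by
      rw [sumR, ereal_coe_sum]
      refine Finset.sum_congr rfl fun j _ => ?_
      by_cases hj : j = i
      · subst hj; simp [hb]
      · simp [hj, hc]
    have h3 : sumR r X = ((∑ j, (r j (X j)).toReal : ℝ) : EReal) := by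
      rw [sumR, ereal_coe_sum]
      exact Finset.sum_congr rfl fun j _ => (hc j).symm
    have h4 : inner ℝ V (WithLp.toLp 2 (Function.update X.ofLp i y) - X)
        = inner ℝ (V i) (y - X i) := by
      rw [PiLp.inner_apply, Finset.sum_eq_single i]
      · simp
      · intro j _ hj; simp [hj]
      · simp
    rw [h2, h3, h4] at h1
    norm_cast at h1
    rw [Finset.sum_update_of_mem (Finset.mem_univ i),
      ← Finset.add_sum_erase _ _ (Finset.mem_univ i), Finset.sdiff_singleton_eq_erase] at h1
    rw [← hb, ← hc i]
    norm_cast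
    linarith
  · intro hV Y
    have h1 : sumR r X + ((inner ℝ V (Y - X) : ℝ) : EReal)
        = ∑ i, (r i (X i) + ((inner ℝ (V i) (Y i - X i) : ℝ) : EReal)) := by
      rw [Finset.sum_add_distrib, PiLp.inner_apply, ereal_coe_sum]
      rfl
    rw [h1]
    exact Finset.sum_le_sum fun i _ => hV i (Y i)

/-- A relative interior point of the subdifferential of a separable sum is, row by row,
the center of a ball of the affine hull of `∂rᵢ` contained in `∂rᵢ`. -/
theorem exists_ball_of_mem_intrinsicInterior {m d : ℕ} {r : Fin m → Vec d → EReal}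
    (hbot : ∀ i x, r i x ≠ ⊥) {X : Stack m d} (hX : ∀ i, r i (X i) ≠ ⊤) {S : Stack m d}
    (hS : S ∈ intrinsicInterior ℝ (subdiff (sumR r) X)) :
    ∃ ρ > 0, ∀ i, ∀ u ∈ vectorSpan ℝ (subdiff (r i) (X i)), ‖u‖ ≤ ρ →
      S i + u ∈ subdiff (r i) (X i) := by
  have hSmem : S ∈ subdiff (sumR r) X := intrinsicInterior_subset hS
  obtain ⟨y, hy, rfl⟩ := mem_intrinsicInterior.1 hS
  obtain ⟨ρ, hρ, hball⟩ := Metric.mem_nhds_iff.1 (mem_interior_iff_mem_nhds.1 hy)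
  set S : Stack m d := (y : Stack m d) with hSy
  refine ⟨ρ / 2, by positivity, fun i u hu hun => ?_⟩
  have hdir : (WithLp.toLp 2 (Pi.single i u) : Stack m d) ∈
      vectorSpan ℝ (subdiff (sumR r) X) := by
    clear hun
    unfold vectorSpan at hu
    induction hu using Submodule.span_induction with
    | mem u hu =>
      obtain ⟨a, ha, b, hb, rfl⟩ := Set.mem_vsub.1 hu
      have hmem : ∀ a ∈ subdiff (r i) (X i),
          (WithLp.toLp 2 (Function.update S.ofLp i a) : Stack m d) ∈ subdiff (sumR r) X := by
        intro a ha
        rw [mem_subdiff_sumR hbot hX]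
        intro j
        by_cases hj : j = i
        · subst hj; simpa using ha
        · simpa [hj] using (mem_subdiff_sumR hbot hX).1 hSmem j
      have h1 := vsub_mem_vectorSpan ℝ (hmem a ha) (hmem b hb)
      convert h1 using 1
      refine PiLp.ext fun j => ?_
      by_cases hj : j = i
      · subst hj; simp
      · simp [hj]
    | zero => simp
    | add a b _ _ iha ihb =>
      rw [Pi.single_add, WithLp.toLp_add]
      exact Submodule.add_mem _ iha ihb
    | smul t a _ iha =>
      rw [Pi.single_smul, WithLp.toLp_smul]
      exact Submodule.smul_mem _ _ iha
  have hZ : (WithLp.toLp 2 (Pi.single i u) : Stack m d) +ᵥ S ∈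
      affineSpan ℝ (subdiff (sumR r) X) :=
    AffineSubspace.vadd_mem_of_mem_direction (by rwa [direction_affineSpan])
      (subset_affineSpan ℝ _ hSmem)
  have hdist : (⟨_, hZ⟩ : affineSpan ℝ (subdiff (sumR r) X)) ∈ Metric.ball y ρ := by
    rw [Metric.mem_ball, Subtype.dist_eq]
    simp only [vadd_eq_add, dist_eq_norm]
    rw [show (WithLp.toLp 2 (Pi.single i u) : Stack m d) + S - (y : Stack m d)
      = WithLp.toLp 2 (Pi.single i u) by simp [S]]
    have hsingle : ‖(WithLp.toLp 2 (Pi.single i u) : Stack m d)‖ = ‖u‖ :=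
      PiLp.norm_single 2 (fun _ : Fin m => Vec d) i u
    rw [hsingle]
    linarith
  have hfin := (mem_subdiff_sumR hbot hX).1 (hball hdist) i
  simpa [add_comm] using hfin

end Convex

/-! ### Partial smoothness: identification and tangential Lipschitz continuity -/

section PartlySmooth

variable {d : ℕ} {r : Vec d → EReal} {M : AffineSubspace ℝ (Vec d)} {x : Vec d}

/-- Finite identification. If an iterate `y` had a normal component `u ≠ 0` relative to `M`, the
subgradient of `r` near `s + ρ u / ‖u‖` at the projection of `y` onto `M` would
contradict monotonicity. -/
theorem IsPartlySmoothAt.eventually_mem (h : IsPartlySmoothAt r M x) {s : Vec d} {ρ : ℝ}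
    (hρ : 0 < ρ)
    (hball : ∀ u ∈ vectorSpan ℝ (subdiff r x), ‖u‖ ≤ ρ → s + u ∈ subdiff r x)
    {y v : ℕ → Vec d} (hy : Tendsto y atTop (𝓝 x)) (hv : Tendsto v atTop (𝓝 s))
    (hvy : ∀ᶠ k in atTop, v k ∈ subdiff r (y k)) : ∀ᶠ k in atTop, y k ∈ M := by
  set N := vectorSpan ℝ (subdiff r x)
  set T := M.direction
  have hT : Tᗮ = N := by
    rw [show T = Nᗮ from h.sharp, Submodule.orthogonal_orthogonal]
  let K : Set (Vec d) := Metric.sphere s ρ ∩ (fun w => w - s) ⁻¹' (N : Set (Vec d))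
  have hK : IsCompact K :=
    (isCompact_sphere s ρ).inter_right
      ((Submodule.closed_of_finiteDimensional N).preimage (by fun_prop))
  have hKsub : ∀ w ∈ K, w ∈ subdiff r x := fun w hw => by
    have h1 := hball (w - s) hw.2 (by have := hw.1; rw [mem_sphere_iff_norm] at this; exact this.le)
    simpa using h1
  obtain ⟨F, hFK, hF, hcov⟩ := hK.finite_cover_balls (e := ρ / 4) (by positivity)
  have hsemi : ∀ᶠ z in 𝓝[(M : Set (Vec d))] x, ∀ w ∈ F, ∃ w' ∈ subdiff r z, ‖w' - w‖ < ρ / 4 :=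
    (eventually_all_finite hF).2 fun w hw =>
      h.inner_semicont w (hKsub w (hFK hw)) _ (by positivity)
  let z : ℕ → Vec d := fun k => T.starProjection (y k - x) + x
  have hzM : ∀ k, z k ∈ M := fun k =>
    AffineSubspace.vadd_mem_of_mem_direction (Submodule.starProjection_apply_mem _ _) h.mem
  have hz : Tendsto z atTop (𝓝[(M : Set (Vec d))] x) := by
    refine tendsto_nhdsWithin_iff.2 ⟨?_, Eventually.of_forall hzM⟩
    have h1 : Tendsto (fun k => T.starProjection (y k - x) + x) atTop
        (𝓝 (T.starProjection (x - x) + x)) :=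
      ((T.starProjection.continuous.tendsto _).comp (hy.sub_const x)).add_const x
    rw [sub_self, map_zero, zero_add] at h1
    exact h1
  filter_upwards [hz.eventually hsemi, hvy,
    (tendsto_iff_norm_sub_tendsto_zero.1 hv).eventually_lt_const (show 0 < ρ / 4 by positivity)]
    with k h1 h2 h3
  set u := y k - z k with hu
  have huN : u ∈ N := by
    rw [← hT]
    have : u = (y k - x) - T.starProjection (y k - x) := by simp [hu, z]; abel
    rw [this]
    exact Submodule.sub_starProjection_mem_orthogonal _
  by_cases hu0 : u = 0
  · rw [sub_eq_zero.1 (hu ▸ hu0 : y k - z k = 0)]; exact hzM k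
  exfalso
  have hun : 0 < ‖u‖ := norm_pos_iff.2 hu0
  have hwK : s + (ρ / ‖u‖) • u ∈ K := by
    refine ⟨?_, ?_⟩
    · rw [mem_sphere_iff_norm, add_sub_cancel_left, norm_smul, Real.norm_eq_abs, abs_div,
        abs_of_pos hρ, abs_of_pos hun, div_mul_cancel₀ _ hun.ne']
    · show s + (ρ / ‖u‖) • u - s ∈ N
      rw [add_sub_cancel_left]; exact N.smul_mem _ huN
  obtain ⟨w, hwF, hww⟩ := Set.mem_iUnion₂.1 (hcov hwK)
  obtain ⟨w', hw', hw'w⟩ := h1 w hwF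
  have hmon := inner_sub_nonneg_of_mem_subdiff h.proper.ne_bot h.proper.exists_ne_top h2 hw'
  rw [← hu] at hmon
  rw [Metric.mem_ball, dist_eq_norm] at hww
  have hsplit : v k - w' = (v k - s) + ((s + (ρ / ‖u‖) • u) - w) - (w' - w) - (ρ / ‖u‖) • u := by
    module
  rw [hsplit, inner_sub_left, inner_sub_left, inner_add_left, inner_smul_left,
    real_inner_self_eq_norm_sq] at hmon
  simp only [conj_trivial] at hmon
  have e1 := real_inner_le_norm (v k - s) u
  have e2 := real_inner_le_norm (s + (ρ / ‖u‖) • u - w) u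
  have e3 := neg_le_of_abs_le (abs_real_inner_le_norm (w' - w) u)
  have e4 : ρ / ‖u‖ * ‖u‖ ^ 2 = ρ * ‖u‖ := by field_simp
  have e5 : ‖v k - s‖ * ‖u‖ ≤ ρ / 4 * ‖u‖ := by gcongr
  have e6 : ‖s + (ρ / ‖u‖) • u - w‖ * ‖u‖ ≤ ρ / 4 * ‖u‖ := by gcongr
  have e7 : ‖w' - w‖ * ‖u‖ ≤ ρ / 4 * ‖u‖ := by gcongr
  have e8 : 0 < ρ * ‖u‖ := by positivity
  linarith

/-- On `M`, subgradients and the derivative of a smooth representative have the same tangential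
component. -/
theorem inner_eq_fderiv_of_mem_subdiff {V : Set (Vec d)} {rhat : Vec d → ℝ} (hV : IsOpen V)
    (hr : ∀ z ∈ (M : Set (Vec d)) ∩ V, r z = (rhat z : EReal)) {y v : Vec d} (hyM : y ∈ M)
    (hyV : y ∈ V) (hd : DifferentiableAt ℝ rhat y) (hv : v ∈ subdiff r y) {τ : Vec d}
    (hτ : τ ∈ M.direction) : inner ℝ v τ = fderiv ℝ rhat y τ := by
  have h1 : HasDerivAt (fun t : ℝ => rhat (y + t • τ)) (inner ℝ (gradient rhat y) τ) 0 :=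
    hasDerivAt_comp_line hd τ
  rw [inner_gradient_left] at h1
  have h2 : HasDerivAt (fun t : ℝ => rhat (y + t • τ) - t * inner ℝ v τ)
      (fderiv ℝ rhat y τ - 1 * inner ℝ v τ) 0 :=
    h1.sub ((hasDerivAt_id (0 : ℝ)).mul_const _)
  have hmin : IsLocalMin (fun t : ℝ => rhat (y + t • τ) - t * inner ℝ v τ) 0 := by
    have hcont : Tendsto (fun t : ℝ => y + t • τ) (𝓝 0) (𝓝 y) := by
      have : Continuous fun t : ℝ => y + t • τ := by fun_prop
      simpa using this.tendsto 0
    filter_upwards [hcont.eventually (hV.mem_nhds hyV)] with t ht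
    have hM : y + t • τ ∈ M := by
      rw [add_comm]
      exact AffineSubspace.vadd_mem_of_mem_direction (M.direction.smul_mem t hτ) hyM
    have h3 := hv (y + t • τ)
    rw [hr y ⟨hyM, hyV⟩, hr _ ⟨hM, ht⟩, add_sub_cancel_left, inner_smul_right] at h3
    norm_cast at h3
    simp only [zero_smul, add_zero, zero_mul, sub_zero]
    linarith
  have := hmin.hasDerivAt_eq_zero h2
  linarith

/-- Tangential components of subgradients on `M` vary in a Lipschitz way with the base point. -/
theorem IsPartlySmoothAt.exists_tangent_lipschitz (h : IsPartlySmoothAt r M x) :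
    ∃ L : ℝ, 0 ≤ L ∧ ∀ᶠ y in 𝓝 x, y ∈ M → ∀ v ∈ subdiff r y, ∀ w ∈ subdiff r x,
      ‖M.direction.starProjection v - M.direction.starProjection w‖ ≤ L * ‖y - x‖ := by
  obtain ⟨V, rhat, hV, hxV, hC, hr⟩ := h.smooth
  have hC1 : ContDiffAt ℝ 1 (fderiv ℝ rhat) x :=
    (hC.contDiffAt (hV.mem_nhds hxV)).fderiv_right (by norm_num)
  obtain ⟨L, t, ht, hL⟩ := hC1.exists_lipschitzOnWith
  refine ⟨L, L.2, ?_⟩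
  filter_upwards [ht, hV.mem_nhds hxV] with y hyt hyV hyM v hv w hw
  have hdiff : ∀ z ∈ V, DifferentiableAt ℝ rhat z := fun z hz =>
    (hC.contDiffAt (hV.mem_nhds hz)).differentiableAt (by norm_num)
  set p := M.direction.starProjection (v - w) with hp
  have hpT : p ∈ M.direction := Submodule.starProjection_apply_mem _ _
  have h1 := inner_eq_fderiv_of_mem_subdiff hV hr hyM hyV (hdiff y hyV) hv hpT
  have h2 := inner_eq_fderiv_of_mem_subdiff hV hr h.mem hxV (hdiff x hxV) hw hpT
  have h3 : ‖p‖ ^ 2 = inner ℝ (v - w) p := by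
    rw [← real_inner_self_eq_norm_sq]
    have := Submodule.starProjection_inner_eq_zero (K := M.direction) (v - w) p hpT
    rw [inner_sub_left] at this
    linarith
  have h4 : ‖fderiv ℝ rhat y - fderiv ℝ rhat x‖ ≤ L * ‖y - x‖ :=
    hL.norm_sub_le hyt (mem_of_mem_nhds ht)
  have h5 : ‖p‖ ^ 2 ≤ L * ‖y - x‖ * ‖p‖ := by
    rw [h3, inner_sub_left, h1, h2]
    calc fderiv ℝ rhat y p - fderiv ℝ rhat x p = (fderiv ℝ rhat y - fderiv ℝ rhat x) p := rfl
      _ ≤ ‖(fderiv ℝ rhat y - fderiv ℝ rhat x) p‖ := Real.le_norm_self _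
      _ ≤ ‖fderiv ℝ rhat y - fderiv ℝ rhat x‖ * ‖p‖ := ContinuousLinearMap.le_opNorm _ _
      _ ≤ _ := by gcongr
  rw [← map_sub, ← hp]
  by_contra hlt
  push Not at hlt
  have h6 : 0 < ‖p‖ := lt_of_le_of_lt (by positivity) hlt
  nlinarith

end PartlySmooth

/-! ### Energy of the primal-dual recursion -/

section Energy

variable {H : Type*} [NormedAddCommGroup H] [InnerProductSpace ℝ H]

/-- The quadratic form of `L (1 - L)`. For `L = I - W` it is `‖d‖²` in the metric
`W (I - W)⁻¹` on the range of `I - W`, evaluated at `d = L t`. -/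
def lapEnergy (L : H →L[ℝ] H) (t : H) : ℝ := inner ℝ (L t) t - ‖L t‖ ^ 2

theorem inner_nonneg_of_norm_sq_le {L : H →L[ℝ] H} {b : ℝ} (hb : 0 < b)
    (hup : ∀ u, ‖L u‖ ^ 2 ≤ b * inner ℝ (L u) u) (u : H) : 0 ≤ inner ℝ (L u) u := by
  by_contra h
  nlinarith [hup u, sq_nonneg ‖L u‖]

theorem mul_norm_sq_le_lapEnergy {L : H →L[ℝ] H} {b : ℝ}
    (hup : ∀ u, ‖L u‖ ^ 2 ≤ b * inner ℝ (L u) u) (u : H) :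
    (1 - b) * ‖L u‖ ^ 2 ≤ b * lapEnergy L u := by
  unfold lapEnergy
  nlinarith [hup u]

theorem lapEnergy_nonneg {L : H →L[ℝ] H} {b : ℝ} (hb : 0 < b) (hb1 : b < 1)
    (hup : ∀ u, ‖L u‖ ^ 2 ≤ b * inner ℝ (L u) u) (u : H) : 0 ≤ lapEnergy L u := by
  by_contra h
  nlinarith [mul_norm_sq_le_lapEnergy hup u, sq_nonneg ‖L u‖]

theorem lapEnergy_le {L : H →L[ℝ] H} {γ : ℝ} (hγ : 0 < γ)
    (hlo : ∀ u, γ * inner ℝ (L u) u ≤ ‖L u‖ ^ 2) (u : H) : lapEnergy L u ≤ ‖L u‖ ^ 2 / γ := by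
  rw [le_div_iff₀ hγ]
  unfold lapEnergy
  nlinarith [hlo u, sq_nonneg ‖L u‖]

theorem norm_apply_le_of_norm_sq_le {L : H →L[ℝ] H} {b : ℝ} (hb : 0 < b) (hb1 : b ≤ 1)
    (hup : ∀ u, ‖L u‖ ^ 2 ≤ b * inner ℝ (L u) u) (u : H) : ‖L u‖ ≤ ‖u‖ := by
  have h1 := real_inner_le_norm (L u) u
  have h2 := hup u
  by_contra h
  push Not at h
  have h3 : 0 < ‖L u‖ := lt_of_le_of_lt (norm_nonneg _) h
  have h4 : b * inner ℝ (L u) u ≤ 1 * (‖L u‖ * ‖u‖) := by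
    have := inner_nonneg_of_norm_sq_le hb hup u
    nlinarith
  nlinarith

theorem norm_sub_apply_le_of_norm_sq_le {L : H →L[ℝ] H} {b : ℝ} (hb : 0 < b) (hb1 : b ≤ 1)
    (hup : ∀ u, ‖L u‖ ^ 2 ≤ b * inner ℝ (L u) u) (u : H) : ‖u - L u‖ ≤ ‖u‖ := by
  have h1 := norm_sub_sq_real u (L u)
  have h2 := inner_nonneg_of_norm_sq_le hb hup u
  rw [real_inner_comm] at h1
  refine le_of_sq_le_sq ?_ (norm_nonneg _)
  nlinarith [hup u]

theorem mul_norm_le_norm_sub_apply {L : H →L[ℝ] H} {b : ℝ} (hb : 0 < b)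
    (hup : ∀ u, ‖L u‖ ^ 2 ≤ b * inner ℝ (L u) u) (u : H) : (1 - b) * ‖u‖ ≤ ‖u - L u‖ := by
  have h3 : ‖L u‖ ≤ b * ‖u‖ := by
    by_contra h
    push Not at h
    have h1 := real_inner_le_norm (L u) u
    have h2 := hup u
    have h4 : 0 < ‖L u‖ := lt_of_le_of_lt (by positivity) h
    nlinarith
  have := norm_sub_norm_le u (L u)
  linarith

/-- One step of the recursion decreases `‖x‖² + α² (‖s‖² + ‖d‖²)`. The vectors are deviations from
the limit, `x'`, `s'`, `t'` being the next iterates; `z` accounts for the consensual limit, which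
is in the kernel of `L`. -/
theorem energy_step {L : H →L[ℝ] H} {b : ℝ} (hb : 0 < b) (hb1 : b < 1)
    (hsymm : ∀ u v, inner ℝ (L u) v = inner ℝ u (L v))
    (hup : ∀ u, ‖L u‖ ^ 2 ≤ b * inner ℝ (L u) u)
    {x s g t t' a x' s' z : H} {α : ℝ} (hα : 0 < α) (hz : L z = 0)
    (ha : a = x - α • (g + s + L t')) (ht : a + z = α • ((t' - t) - L (t' - t)))
    (hx : x' + α • s' = a + α • s) (hmon : 0 ≤ inner ℝ x' s') :
    ‖x'‖ ^ 2 + α ^ 2 * (‖s'‖ ^ 2 + lapEnergy L t') + ‖x - a‖ ^ 2 + 2 * α * inner ℝ g a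
      ≤ ‖x‖ ^ 2 + α ^ 2 * (‖s‖ ^ 2 + lapEnergy L t) := by
  have e1 : ‖x'‖ ^ 2 + 2 * α * inner ℝ x' s' + α ^ 2 * ‖s'‖ ^ 2
      = ‖a‖ ^ 2 + 2 * α * inner ℝ a s + α ^ 2 * ‖s‖ ^ 2 := by
    have h1 := norm_add_sq_real x' (α • s')
    have h2 := norm_add_sq_real a (α • s)
    rw [hx, h2] at h1
    simp only [norm_smul, inner_smul_right, mul_pow, Real.norm_eq_abs, sq_abs] at h1
    linarith
  have e2 : ‖x‖ ^ 2 = ‖a‖ ^ 2 + 2 * α * (inner ℝ g a + inner ℝ a s + inner ℝ (L t') a)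
      + ‖x - a‖ ^ 2 := by
    have h1 := norm_add_sq_real a (x - a)
    rw [add_sub_cancel] at h1
    have h2 : inner ℝ a (x - a) = α * (inner ℝ g a + inner ℝ a s + inner ℝ (L t') a) := by
      have h3 : x - a = α • (g + s + L t') := by rw [ha]; abel
      rw [h3, inner_smul_right, inner_add_right, inner_add_right, real_inner_comm g a,
        real_inner_comm (L t') a]
    rw [h1, h2]; ring
  have e3 : inner ℝ (L t') a
      = α * (inner ℝ (L t') (t' - t) - inner ℝ (L t') (L (t' - t))) := by
    have h1 : inner ℝ (L t') z = 0 := by rw [hsymm, hz, inner_zero_right]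
    have h2 : inner ℝ (L t') a = inner ℝ (L t') (a + z) := by rw [inner_add_right, h1, add_zero]
    rw [h2, ht, inner_smul_right, inner_sub_right]
  have e4 : lapEnergy L t = lapEnergy L t'
      - 2 * (inner ℝ (L t') (t' - t) - inner ℝ (L t') (L (t' - t))) + lapEnergy L (t' - t) := by
    obtain ⟨u, hu⟩ : ∃ u, u = t' - t := ⟨_, rfl⟩
    rw [← hu]
    have htu : t = t' - u := by rw [hu]; abel
    have h1 : inner ℝ (L u) t' = inner ℝ (L t') u := by rw [hsymm, real_inner_comm]
    unfold lapEnergy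
    rw [htu, map_sub, norm_sub_sq_real, inner_sub_left, inner_sub_right, inner_sub_right, h1]
    ring
  have e5 := lapEnergy_nonneg hb hb1 hup (t' - t)
  rw [e4, e2]
  rw [e3]
  have e6 : 0 ≤ α ^ 2 * lapEnergy L (t' - t) := by positivity
  have e7 : 0 ≤ 2 * α * inner ℝ x' s' := by positivity
  linarith

/-- Once the primal iterates stay in the kernel of `Q` (the normal component), the normal
components of both dual variables are determined by the previous gradient: the recursion
telescopes, and the constant of summation vanishes in the limit. -/
theorem normal_components_eq {L Q : H →L[ℝ] H} (hcomm : ∀ u, Q (L u) = L (Q u))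
    {x s g d : ℕ → H} {α : ℕ → ℝ} (hα : ∀ k, 0 < α k) {K : ℕ}
    (hx0 : ∀ k ≥ K, Q (x k) = 0)
    (hx : ∀ k ≥ K, x (k + 1) + α k • s (k + 1) = x k - α k • (g k + d (k + 1)))
    (hd : ∀ k ≥ K, α k • (d (k + 1) - d k) = L (x k - α k • (g k + s k + d k)))
    (hg : Tendsto g atTop (𝓝 0)) (hdl : Tendsto d atTop (𝓝 0)) :
    ∀ k ≥ K, Q (d (k + 1)) = -L (Q (g k)) ∧ Q (s (k + 1)) = -(Q (g k) - L (Q (g k))) := by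
  have hs : ∀ k ≥ K, Q (s (k + 1)) = -(Q (g k) + Q (d (k + 1))) := fun k hk => by
    have h1 := congrArg Q (hx k hk)
    simp only [map_add, map_sub, map_smul, hx0 k hk, hx0 (k + 1) (by omega), zero_add,
      zero_sub] at h1
    rw [← smul_neg] at h1
    exact smul_right_injective H (hα k).ne' h1
  have hstep : ∀ k ≥ K, Q (d (k + 2)) + L (Q (g (k + 1))) = Q (d (k + 1)) + L (Q (g k)) :=
    fun k hk => by
      have h1 := congrArg Q (hd (k + 1) (by omega))
      rw [hcomm] at h1
      simp only [map_add, map_sub, map_smul, hx0 (k + 1) (by omega), zero_sub,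
        hs k hk] at h1
      rw [map_neg, map_smul, ← smul_neg] at h1
      have h2 := smul_right_injective H (hα (k + 1)).ne' h1
      simp only [map_add, map_neg] at h2
      rw [sub_eq_iff_eq_add] at h2
      rw [h2]; abel
  have hconst : ∀ j, ∀ k ≥ K,
      Q (d (k + j + 1)) + L (Q (g (k + j))) = Q (d (k + 1)) + L (Q (g k)) := by
    intro j k hk
    induction j with
    | zero => rfl
    | succ j ih => rw [← ih]; exact hstep (k + j) (by omega)
  have hzero : ∀ k ≥ K, Q (d (k + 1)) + L (Q (g k)) = 0 := fun k hk => by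
    have hlim : Tendsto (fun j => Q (d (k + j + 1)) + L (Q (g (k + j)))) atTop (𝓝 0) := by
      have h1 : Tendsto (fun j => Q (d (k + j + 1))) atTop (𝓝 (Q 0)) :=
        (Q.continuous.tendsto 0).comp
          (hdl.comp (tendsto_atTop_mono (fun j => by simp only [id]; omega) tendsto_id))
      have h2 : Tendsto (fun j => L (Q (g (k + j)))) atTop (𝓝 (L (Q 0))) :=
        ((L.continuous.comp Q.continuous).tendsto 0).comp
          (hg.comp (tendsto_atTop_mono (fun j => by simp only [id]; omega) tendsto_id))
      simpa using h1.add h2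
    refine tendsto_nhds_unique (tendsto_const_nhds.congr fun j => (hconst j k hk).symm) hlim
  intro k hk
  have h1 : Q (d (k + 1)) = -L (Q (g k)) := eq_neg_of_add_eq_zero_left (hzero k hk)
  exact ⟨h1, by rw [hs k hk, h1]; abel⟩

end Energy

/-! ### Linear rates -/

section Rates

/-- A perturbed energy decrease `E_{k+1} + Δ_k ≤ (1 + o(1)) E_k` whose dissipation over two steps
controls the energy yields linear convergence. -/
theorem exists_le_exp_of_dissipation {E Δ : ℕ → ℝ} {K : ℝ} (hK : 1 ≤ K) (hE : ∀ k, 0 ≤ E k)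
    (hΔ : ∀ k, 0 ≤ Δ k)
    (hdec : ∀ ε > 0, ∀ᶠ k in atTop, E (k + 1) + Δ k ≤ (1 + ε) * E k)
    (hbd : ∀ᶠ k in atTop, E (k + 1) ≤ K * (Δ k + Δ (k + 1))) :
    ∃ C, ∀ k : ℕ, E k ≤ C * Real.exp (-(k / (8 * K))) := by
  have hK0 : 0 < K := by linarith
  obtain ⟨K0, hK0'⟩ := eventually_atTop.1 ((hdec (1 / (8 * K)) (by positivity)).and hbd)
  set w := 1 / K with hw
  have hw0 : 0 < w := by positivity
  have hw1 : w ≤ 1 := by rw [hw, div_le_one hK0]; exact hK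
  have h8 : 1 / (8 * K) = w / 8 := by rw [hw]; field_simp
  have htwo : ∀ k ≥ K0, E (k + 2) ≤ (1 - w / 4) * E k := fun k hk => by
    obtain ⟨h1, h2⟩ := hK0' k hk
    have h3 := (hK0' (k + 1) (by omega)).1
    rw [h8] at h1 h3
    have h4 : w * E (k + 1) ≤ Δ k + Δ (k + 1) := by
      rw [hw, one_div, inv_mul_le_iff₀ hK0]; exact h2
    have h3' : E (k + 2) ≤ (1 + w / 8) * E (k + 1) := by
      have := hΔ (k + 1); linarith
    have h5 : E (k + 2) + w * E (k + 1) ≤ (1 + w / 8) * E k + w / 8 * E (k + 1) := by linarith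
    -- with `w ≤ 1` the factor `1 + w / 8` is at most `9 / 8`
    have h6 : E (k + 2) ≤ 9 / 8 * E (k + 1) := by nlinarith [hE (k + 1)]
    have h7 : (1 + 7 / 9 * w) * E (k + 2) ≤ (1 + w / 8) * E k := by nlinarith
    have h9 : (1 + w / 8) ≤ (1 + 7 / 9 * w) * (1 - w / 4) := by nlinarith
    have h10 : (1 + 7 / 9 * w) * E (k + 2) ≤ (1 + 7 / 9 * w) * ((1 - w / 4) * E k) := by
      rw [← mul_assoc]
      exact h7.trans (mul_le_mul_of_nonneg_right h9 (hE k))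
    exact le_of_mul_le_mul_left h10 (by positivity)
  have hexp : ∀ k : ℕ, 0 < Real.exp (-(k / (8 * K))) := fun k => Real.exp_pos _
  refine ⟨∑ j ∈ Finset.range (K0 + 2), E j / Real.exp (-(j / (8 * K))), fun k => ?_⟩
  induction k using Nat.strong_induction_on with
  | _ k ih =>
    by_cases hk : k < K0 + 2
    · rw [← div_le_iff₀ (hexp k)]
      exact Finset.single_le_sum (f := fun j : ℕ => E j / Real.exp (-(j / (8 * K))))
        (fun j _ => div_nonneg (hE j) (hexp j).le) (Finset.mem_range.2 hk)
    · obtain ⟨j, rfl⟩ : ∃ j, k = j + 2 := ⟨k - 2, by omega⟩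
      have h1 := htwo j (by omega)
      have h2 := ih j (by omega)
      have h3 : Real.exp (-(((j + 2 : ℕ) : ℝ) / (8 * K)))
          = Real.exp (-(w / 4)) * Real.exp (-(j / (8 * K))) := by
        rw [← Real.exp_add]; congr 1; rw [hw]; push_cast; field_simp; ring
      have h4 : 1 - w / 4 ≤ Real.exp (-(w / 4)) := by
        have := Real.add_one_le_exp (-(w / 4)); linarith
      rw [h3]
      calc E (j + 2) ≤ (1 - w / 4) * E j := h1
        _ ≤ Real.exp (-(w / 4)) * E j := mul_le_mul_of_nonneg_right h4 (hE j)
        _ ≤ Real.exp (-(w / 4)) * (_ * Real.exp (-(j / (8 * K)))) :=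
            mul_le_mul_of_nonneg_left h2 (Real.exp_pos _).le
        _ = _ := by ring

/-- Iteration count of a linearly convergent sequence. -/
theorem exists_iteration_count {u : ℕ → ℝ} {C b : ℝ} (hb : 0 < b)
    (hu : ∀ k : ℕ, u k ≤ C * Real.exp (-(k / b))) :
    ∃ N : ℝ → ℕ, (∀ ε > 0, ∀ k ≥ N ε, u k ≤ ε) ∧
      ∀ᶠ ε in 𝓝[>] (0 : ℝ), (N ε : ℝ) ≤ 2 * b * Real.log (1 / ε) := by
  set C' := max C 1
  have hC' : 1 ≤ C' := le_max_right _ _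
  have hC0 : 0 < C' := by linarith
  refine ⟨fun ε => ⌈b * Real.log (C' / ε)⌉₊, fun ε hε k hk => ?_, ?_⟩
  · have h1 : b * Real.log (C' / ε) ≤ k := (Nat.le_ceil _).trans (by exact_mod_cast hk)
    have h2 : Real.log (C' / ε) ≤ k / b := by rw [le_div_iff₀ hb]; linarith
    have h3 : C' / ε ≤ Real.exp (k / b) := (Real.log_le_iff_le_exp (by positivity)).1 h2
    refine (hu k).trans ?_
    calc C * Real.exp (-(k / b)) ≤ C' * Real.exp (-(k / b)) :=
          mul_le_mul_of_nonneg_right (le_max_left _ _) (Real.exp_pos _).le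
      _ ≤ ε := by
          rw [Real.exp_neg, ← div_eq_mul_inv, div_le_iff₀ (Real.exp_pos _)]
          rw [div_le_iff₀ hε] at h3; linarith
  · have hlim : Tendsto (fun ε : ℝ => Real.log (1 / ε)) (𝓝[>] 0) atTop := by
      simp only [one_div]
      exact Real.tendsto_log_atTop.comp tendsto_inv_nhdsGT_zero
    filter_upwards [hlim.eventually_ge_atTop (Real.log C' + 1 / b), hlim.eventually_ge_atTop 0,
      self_mem_nhdsWithin] with ε h1 h0 hε
    have hε : 0 < ε := hε
    have h2 : Real.log (C' / ε) = Real.log C' + Real.log (1 / ε) := by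
      rw [div_eq_mul_one_div, Real.log_mul hC0.ne' (by positivity)]
    have h3 : 0 ≤ Real.log C' := Real.log_nonneg hC'
    have h4 := (Nat.ceil_lt_add_one (a := b * Real.log (C' / ε))
      (by rw [h2]; positivity)).le
    have h5 : b * (Real.log C' + 1 / b) ≤ b * Real.log (1 / ε) :=
      mul_le_mul_of_nonneg_left h1 hb.le
    have h6 : b * (1 / b) = 1 := by field_simp
    rw [h2] at h4
    simp only [h2]
    nlinarith

end Rates

/-! ### Stepsizes and elementary relations of the algorithm -/

section Algorithm

variable {m d : ℕ} {c η δ αinit : ℝ} {n : ℕ → ℝ} {G : SimpleGraph (Fin m)}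
  {Wt : Matrix (Fin m) (Fin m) ℝ} {f : Fin m → Vec d → ℝ} {r : Fin m → Vec d → EReal}
  {τ : Trajectory m d} {xstar : Vec d} {Sstar : Stack m d}

/-- A run of the algorithm on an admissible problem over a connected network, whose iterates `𝐗^k`
and `𝐒^k` converge, the former to the consensual point `𝟏 (x*)ᵀ`. -/
structure IsConvergentRun (c η δ αinit : ℝ) (n : ℕ → ℝ) (G : SimpleGraph (Fin m))
    (Wt : Matrix (Fin m) (Fin m) ℝ) (f : Fin m → Vec d → ℝ) (r : Fin m → Vec d → EReal)
    (τ : Trajectory m d) (xstar : Vec d) (Sstar : Stack m d) : Prop where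
  c_mem : c ∈ Set.Ioo (0 : ℝ) (1 / 2)
  eta_mem : η ∈ Set.Ioo (0 : ℝ) 1
  delta_mem : δ ∈ Set.Ioo (0 : ℝ) 1
  two_le : 2 ≤ m
  connected : G.Connected
  gossip : IsGossipMatrix G Wt
  problem : IsAdmissibleProblem f r
  alpha_init_pos : 0 < αinit
  n_nonneg : ∀ k, 0 ≤ n k
  n_summable : Summable n
  generated : IsGenerated f r (lazyMatrix c Wt) c η δ αinit n τ
  X_tendsto : Tendsto τ.X atTop (𝓝 (consensus m xstar))
  S_tendsto : Tendsto τ.S atTop (𝓝 Sstar)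

/-- `∇F(𝐗^k) + 𝐒^k + 𝐃^k`, which vanishes at a solution. -/
def Trajectory.residual (τ : Trajectory m d) (f : Fin m → Vec d → ℝ) (k : ℕ) : Stack m d :=
  gradF f (τ.X k) + τ.S k + τ.D k

theorem Trajectory.increment_le (τ : Trajectory m d) (c δ : ℝ) (n : ℕ → ℝ) (k : ℕ) (i : Fin m) :
    τ.increment c δ n k i ≤ n k := by
  unfold Trajectory.increment
  split_ifs
  · exact le_rfl
  · exact min_le_right _ _

theorem Trajectory.increment_nonneg (τ : Trajectory m d) (hc : 0 ≤ c) (hδ : δ ≤ 1)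
    (hn : ∀ k, 0 ≤ n k) (k : ℕ) (i : Fin m) : 0 ≤ τ.increment c δ n k i := by
  unfold Trajectory.increment
  split_ifs
  · exact hn k
  · have : 0 ≤ 1 - δ := by linarith
    exact le_min (by positivity) (hn k)

/-- A convex function passes the line search test at stepsizes up to `δ / (2 L)`, if `L` is a
Lipschitz constant of its gradient between the two points. -/
theorem lineSearchTest_of_le {f : Vec d → ℝ} (hf : ConvexOn ℝ Set.univ f)
    (hd : Differentiable ℝ f) {x y : Vec d} {L a : ℝ} (hL : 0 < L) (ha : 0 < a)
    (hlip : ‖gradient f y - gradient f x‖ ≤ L * ‖y - x‖) (hle : a ≤ δ / (2 * L)) :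
    LineSearchTest f δ a x y := by
  have h1 := hf.add_inner_gradient_le (hd y) x
  have h2 : inner ℝ (gradient f y) (x - y) = - inner ℝ (gradient f y) (y - x) := by
    rw [← inner_neg_right, neg_sub]
  have h3 := real_inner_le_norm (gradient f y - gradient f x) (y - x)
  rw [inner_sub_left] at h3
  have h4 : ‖gradient f y - gradient f x‖ * ‖y - x‖ ≤ L * ‖y - x‖ * ‖y - x‖ := by gcongr
  have h5 : L ≤ δ / (2 * a) := by
    rw [le_div_iff₀ (by positivity)] at hle ⊢
    linarith
  have h6 : L * ‖y - x‖ ^ 2 ≤ δ / (2 * a) * ‖y - x‖ ^ 2 := by gcongr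
  unfold LineSearchTest
  nlinarith

theorem exists_apply_eq_of_tendsto {H : Type*} [NormedAddCommGroup H] [InnerProductSpace ℝ H]
    [FiniteDimensional ℝ H] {Λ : H →L[ℝ] H} {t : ℕ → H} {y : H}
    (ht : Tendsto (fun k => Λ (t k)) atTop (𝓝 y)) : ∃ x, Λ x = y := by
  have hcl : IsClosed (LinearMap.range Λ.toLinearMap : Set H) :=
    Submodule.closed_of_finiteDimensional _
  exact hcl.mem_of_tendsto ht (Eventually.of_forall fun k => ⟨t k, rfl⟩)

namespace IsConvergentRun

theorem c_pos (h : IsConvergentRun c η δ αinit n G Wt f r τ xstar Sstar) : 0 < 2 * c := by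
  have := h.c_mem.1; linarith

theorem two_c_lt_one (h : IsConvergentRun c η δ αinit n G Wt f r τ xstar Sstar) : 2 * c < 1 := by
  have := h.c_mem.2; linarith

theorem lap_symm (h : IsConvergentRun c η δ αinit n G Wt f r τ xstar Sstar) (u v : Stack m d) :
    inner ℝ (mixCLM (gossipLaplacian c Wt) u) v = inner ℝ u (mixCLM (gossipLaplacian c Wt) v) :=
  mixCLM_isSymm (h.gossip.gossipLaplacian_isSymm c) u v

theorem lap_upper (h : IsConvergentRun c η δ αinit n G Wt f r τ xstar Sstar) (u : Stack m d) :
    ‖mixCLM (gossipLaplacian c Wt) u‖ ^ 2 ≤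
      2 * c * inner ℝ (mixCLM (gossipLaplacian c Wt) u) u :=
  (h.gossip.mixCLM_bounds h.two_le c u).2

theorem lap_lower (h : IsConvergentRun c η δ αinit n G Wt f r τ xstar Sstar) (u : Stack m d) :
    c * (1 - lambda2 h.two_le h.gossip.isHermitian) *
      inner ℝ (mixCLM (gossipLaplacian c Wt) u) u ≤ ‖mixCLM (gossipLaplacian c Wt) u‖ ^ 2 :=
  (h.gossip.mixCLM_bounds h.two_le c u).1

theorem lap_consensus (h : IsConvergentRun c η δ αinit n G Wt f r τ xstar Sstar) (x : Vec d) :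
    mixCLM (gossipLaplacian c Wt) (consensus m x) = 0 :=
  h.gossip.mixCLM_consensus c x

theorem step_eq (h : IsConvergentRun c η δ αinit n G Wt f r τ xstar Sstar) (k : ℕ) :
    ∃ i, τ.α k = τ.trialStep c η δ αinit n k i (τ.back k i) := by
  obtain ⟨i, hi⟩ := (h.generated.alpha_min k).1
  exact ⟨i, hi.symm⟩

theorem step_le (h : IsConvergentRun c η δ αinit n G Wt f r τ xstar Sstar) (k : ℕ) (i : Fin m) :
    τ.α k ≤ τ.trialStep c η δ αinit n k i (τ.back k i) :=
  (h.generated.alpha_min k).2 ⟨i, rfl⟩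

theorem increment_nonneg (h : IsConvergentRun c η δ αinit n G Wt f r τ xstar Sstar) (k : ℕ)
    (i : Fin m) : 0 ≤ τ.increment c δ n k i :=
  τ.increment_nonneg h.c_mem.1.le h.delta_mem.2.le h.n_nonneg k i

theorem shift_le_alphaTilde (h : IsConvergentRun c η δ αinit n G Wt f r τ xstar Sstar) (k : ℕ)
    (i : Fin m) : shiftSeq αinit τ.α k ≤ τ.alphaTilde c δ αinit n k i :=
  Real.le_sqrt_of_sq_le (by have := h.increment_nonneg k i; linarith)

theorem shift_pos_of (h : IsConvergentRun c η δ αinit n G Wt f r τ xstar Sstar) (k : ℕ)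
    (hk : 0 < shiftSeq αinit τ.α k) : 0 < τ.α k := by
  obtain ⟨i, hi⟩ := h.step_eq k
  rw [hi, Trajectory.trialStep]
  exact mul_pos (pow_pos h.eta_mem.1 _) (hk.trans_le (h.shift_le_alphaTilde k i))

theorem shift_pos (h : IsConvergentRun c η δ αinit n G Wt f r τ xstar Sstar) (k : ℕ) :
    0 < shiftSeq αinit τ.α k := by
  induction k with
  | zero => exact h.alpha_init_pos
  | succ k ih => exact h.shift_pos_of k ih

theorem alpha_pos (h : IsConvergentRun c η δ αinit n G Wt f r τ xstar Sstar) (k : ℕ) :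
    0 < τ.α k := h.shift_pos (k + 1)

theorem alphaTilde_pos (h : IsConvergentRun c η δ αinit n G Wt f r τ xstar Sstar) (k : ℕ)
    (i : Fin m) : 0 < τ.alphaTilde c δ αinit n k i :=
  (h.shift_pos k).trans_le (h.shift_le_alphaTilde k i)

theorem trialStep_pos (h : IsConvergentRun c η δ αinit n G Wt f r τ xstar Sstar) (k : ℕ)
    (i : Fin m) (s : ℕ) : 0 < τ.trialStep c η δ αinit n k i s :=
  mul_pos (pow_pos h.eta_mem.1 _) (h.alphaTilde_pos k i)

theorem trialStep_le_alphaTilde (h : IsConvergentRun c η δ αinit n G Wt f r τ xstar Sstar) (k : ℕ)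
    (i : Fin m) (s : ℕ) :
    τ.trialStep c η δ αinit n k i s ≤ τ.alphaTilde c δ αinit n k i :=
  mul_le_of_le_one_left (h.alphaTilde_pos k i).le
    (pow_le_one₀ h.eta_mem.1.le h.eta_mem.2.le)

theorem alphaTilde_le (k : ℕ) (i : Fin m) :
    τ.alphaTilde c δ αinit n k i ≤ √(shiftSeq αinit τ.α k ^ 2 + n k) :=
  Real.sqrt_le_sqrt (by have := τ.increment_le c δ n k i; linarith)

theorem trialStep_le (h : IsConvergentRun c η δ αinit n G Wt f r τ xstar Sstar) (k : ℕ)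
    (i : Fin m) (s : ℕ) :
    τ.trialStep c η δ αinit n k i s ≤ √(shiftSeq αinit τ.α k ^ 2 + n k) :=
  (h.trialStep_le_alphaTilde k i s).trans (alphaTilde_le k i)

theorem alpha_sq_le (h : IsConvergentRun c η δ αinit n G Wt f r τ xstar Sstar) (k : ℕ) :
    τ.α k ^ 2 ≤ shiftSeq αinit τ.α k ^ 2 + n k := by
  obtain ⟨i, hi⟩ := h.step_eq k
  have h1 : τ.α k ≤ √(shiftSeq αinit τ.α k ^ 2 + n k) := hi ▸ h.trialStep_le k i _
  have h2 := h.n_nonneg k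
  calc τ.α k ^ 2 ≤ √(shiftSeq αinit τ.α k ^ 2 + n k) ^ 2 :=
        pow_le_pow_left₀ (h.alpha_pos k).le h1 2
    _ = _ := Real.sq_sqrt (by positivity)

/-- Up to the summable slack, the stepsizes decrease; hence they converge. -/
theorem exists_alpha_tendsto (h : IsConvergentRun c η δ αinit n G Wt f r τ xstar Sstar) :
    ∃ αl, 0 ≤ αl ∧ αl ^ 2 ≤ αinit ^ 2 + ∑' k, n k ∧ Tendsto τ.α atTop (𝓝 αl) := by
  let b : ℕ → ℝ := fun k => shiftSeq αinit τ.α k ^ 2 - ∑ j ∈ Finset.range k, n j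
  have hb : Antitone b := antitone_nat_of_succ_le fun k => by
    have h1 : τ.α k ^ 2 ≤ _ := h.alpha_sq_le k
    show τ.α k ^ 2 - _ ≤ _
    rw [Finset.sum_range_succ]
    show _ ≤ shiftSeq αinit τ.α k ^ 2 - ∑ j ∈ Finset.range k, n j
    linarith
  have hsum : ∀ k, ∑ j ∈ Finset.range k, n j ≤ ∑' k, n k := fun k =>
    h.n_summable.sum_le_tsum _ fun j _ => h.n_nonneg j
  have hbdd : BddBelow (Set.range b) := ⟨-∑' k, n k, by
    rintro _ ⟨k, rfl⟩
    have h1 := hsum k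
    have h2 : 0 ≤ shiftSeq αinit τ.α k ^ 2 := sq_nonneg _
    simp only [b]; linarith⟩
  have h1 : Tendsto (fun k => b (k + 1)) atTop (𝓝 (⨅ k, b k)) :=
    (tendsto_atTop_ciInf hb hbdd).comp (tendsto_add_atTop_nat 1)
  have h2 : Tendsto (fun k => ∑ j ∈ Finset.range (k + 1), n j) atTop (𝓝 (∑' k, n k)) :=
    h.n_summable.hasSum.tendsto_sum_nat.comp (tendsto_add_atTop_nat 1)
  have h3 : Tendsto (fun k => τ.α k ^ 2) atTop (𝓝 ((⨅ k, b k) + ∑' k, n k)) := by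
    refine (h1.add h2).congr fun k => ?_
    simp [b, shiftSeq]
  have h4 : Tendsto τ.α atTop (𝓝 (√((⨅ k, b k) + ∑' k, n k))) := by
    refine (h3.sqrt).congr fun k => Real.sqrt_sq (h.alpha_pos k).le
  refine ⟨_, Real.sqrt_nonneg _, ?_, h4⟩
  refine le_of_tendsto (h4.pow 2) (Eventually.of_forall fun k => ?_)
  have h5 : b (k + 1) ≤ b 0 := hb (Nat.zero_le _)
  simp only [b, shiftSeq, Finset.range_zero, Finset.sum_empty, sub_zero] at h5
  have := hsum (k + 1)
  linarith

theorem shift_tendsto {αl : ℝ} (hα : Tendsto τ.α atTop (𝓝 αl)) :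
    Tendsto (shiftSeq αinit τ.α) atTop (𝓝 αl) :=
  (tendsto_add_atTop_iff_nat 1).1 hα

theorem sqrt_shift_tendsto (h : IsConvergentRun c η δ αinit n G Wt f r τ xstar Sstar) {αl : ℝ}
    (h0 : 0 ≤ αl) (hα : Tendsto τ.α atTop (𝓝 αl)) :
    Tendsto (fun k => √(shiftSeq αinit τ.α k ^ 2 + n k)) atTop (𝓝 αl) := by
  have := (((shift_tendsto (αinit := αinit) hα).pow 2).add h.n_summable.tendsto_atTop_zero).sqrt
  rwa [add_zero, Real.sqrt_sq h0] at this

/-- If stepsizes at most `B` pass the test of every agent, backtracking cannot go below `η B`. -/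
theorem min_le_alpha (h : IsConvergentRun c η δ αinit n G Wt f r τ xstar Sstar) {k : ℕ} {B : ℝ}
    (hB : ∀ i, ∀ s ≤ τ.back k i, τ.trialStep c η δ αinit n k i s ≤ B →
      LineSearchTest (f i) δ (τ.trialStep c η δ αinit n k i s) (τ.X k i)
        (τ.trialPoint f (lazyMatrix c Wt) c η δ αinit n k i s)) :
    min (shiftSeq αinit τ.α k) (η * B) ≤ τ.α k := by
  obtain ⟨i, hi⟩ := h.step_eq k
  rw [hi]
  rcases Nat.eq_zero_or_pos (τ.back k i) with h0 | h0
  · rw [h0, Trajectory.trialStep, pow_zero, one_mul]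
    exact (min_le_left _ _).trans (h.shift_le_alphaTilde k i)
  · obtain ⟨s, hs⟩ : ∃ s, τ.back k i = s + 1 := ⟨τ.back k i - 1, by omega⟩
    have h1 : B < τ.trialStep c η δ αinit n k i s := by
      by_contra hle
      exact h.generated.search_fail k i s (by omega) (hB i s (by omega) (not_lt.1 hle))
    have h2 : τ.trialStep c η δ αinit n k i (s + 1) = η * τ.trialStep c η δ αinit n k i s := by
      simp only [Trajectory.trialStep]; ring
    rw [hs, h2]
    exact (min_le_right _ _).trans (mul_le_mul_of_nonneg_left h1.le h.eta_mem.1.le)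

theorem Xhalf_eq (k : ℕ) :
    τ.Xhalf (lazyMatrix c Wt) k = τ.X k - mixCLM (gossipLaplacian c Wt) (τ.X k) :=
  mix_lazyMatrix c Wt _

theorem Dhalf_eq (k : ℕ) :
    τ.Dhalf f (lazyMatrix c Wt) k =
      τ.residual f k - mixCLM (gossipLaplacian c Wt) (τ.residual f k) :=
  mix_lazyMatrix c Wt _

theorem D_succ_eq (h : IsConvergentRun c η δ αinit n G Wt f r τ xstar Sstar) (k : ℕ) :
    τ.D (k + 1) = τ.D k
      + (1 / τ.α k) • mixCLM (gossipLaplacian c Wt) (τ.X k - τ.α k • τ.residual f k) := by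
  have hα := (h.alpha_pos k).ne'
  rw [h.generated.D_succ, Xhalf_eq, Dhalf_eq, sub_sub_cancel, map_sub, map_smul, smul_sub,
    smul_smul, one_div_mul_cancel hα, one_smul]
  unfold Trajectory.residual
  abel

theorem alpha_smul_D_sub (h : IsConvergentRun c η δ αinit n G Wt f r τ xstar Sstar) (k : ℕ) :
    τ.α k • (τ.D (k + 1) - τ.D k)
      = mixCLM (gossipLaplacian c Wt) (τ.X k - τ.α k • τ.residual f k) := by
  rw [h.D_succ_eq, add_sub_cancel_left, smul_smul, mul_one_div_cancel (h.alpha_pos k).ne', one_smul]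

theorem alpha_smul_T_sub (h : IsConvergentRun c η δ αinit n G Wt f r τ xstar Sstar) (k : ℕ) :
    τ.α k • (τ.T (k + 1) - τ.T k) = τ.X k - τ.α k • τ.residual f k := by
  have h1 : τ.T (k + 1) - τ.T k = (1 / τ.α k) • τ.X k - τ.residual f k := by
    rw [h.generated.T_succ]; unfold Trajectory.residual; abel
  rw [h1, smul_sub, smul_smul, mul_one_div_cancel (h.alpha_pos k).ne', one_smul]

theorem D_eq (h : IsConvergentRun c η δ αinit n G Wt f r τ xstar Sstar) (k : ℕ) :
    τ.D k = mixCLM (gossipLaplacian c Wt) (τ.T k) := by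
  induction k with
  | zero => rw [h.generated.D_zero, h.generated.T_zero, map_zero]
  | succ k ih =>
    have h1 := h.alpha_smul_D_sub k
    rw [← h.alpha_smul_T_sub k, map_smul] at h1
    have h2 := smul_right_injective _ (h.alpha_pos k).ne' h1
    rw [map_sub, ← ih] at h2
    exact sub_left_injective h2

theorem A_succ_eq (h : IsConvergentRun c η δ αinit n G Wt f r τ xstar Sstar) (k : ℕ) :
    τ.A (k + 1) = (τ.X k - τ.α k • τ.residual f k)
      - mixCLM (gossipLaplacian c Wt) (τ.X k - τ.α k • τ.residual f k) := by
  rw [h.generated.A_succ, Xhalf_eq, Dhalf_eq, map_sub, map_smul, smul_sub]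
  abel

theorem A_succ_eq' (h : IsConvergentRun c η δ αinit n G Wt f r τ xstar Sstar) (k : ℕ) :
    τ.A (k + 1) = τ.X k - τ.α k • (gradF f (τ.X k) + τ.S k + τ.D (k + 1)) := by
  rw [h.A_succ_eq, ← h.alpha_smul_D_sub]
  unfold Trajectory.residual
  module

theorem X_add_S (h : IsConvergentRun c η δ αinit n G Wt f r τ xstar Sstar) (k : ℕ) :
    τ.X (k + 1) + τ.α k • τ.S (k + 1) = τ.A (k + 1) + τ.α k • τ.S k := by
  rw [h.generated.S_succ, smul_add, smul_smul, mul_one_div_cancel (h.alpha_pos k).ne', one_smul]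
  abel

theorem S_mem_subdiff (h : IsConvergentRun c η δ αinit n G Wt f r τ xstar Sstar) (k : ℕ)
    (i : Fin m) : τ.S (k + 1) i ∈ subdiff (r i) (τ.X (k + 1) i) := by
  have h1 := (h.generated.X_succ k i).mem_subdiff (h.problem.r_convex i) (h.alpha_pos k)
  have h2 : (1 / τ.α k) • (τ.A (k + 1) i + τ.α k • τ.S k i - τ.X (k + 1) i) = τ.S (k + 1) i := by
    rw [h.generated.S_succ, add_sub_right_comm, smul_add, smul_smul,
      one_div_mul_cancel (h.alpha_pos k).ne', one_smul]
    simp [add_comm]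
  rwa [h2] at h1

/-! ### Limits -/

theorem gradF_continuous (h : IsConvergentRun c η δ αinit n G Wt f r τ xstar Sstar) :
    Continuous (gradF f) := by
  have h1 : ∀ i, Continuous (gradient (f i)) := fun i => (h.problem.f_smooth i).2.continuous
  unfold gradF
  fun_prop

theorem gradF_tendsto (h : IsConvergentRun c η δ αinit n G Wt f r τ xstar Sstar) :
    Tendsto (fun k => gradF f (τ.X k)) atTop (𝓝 (gradF f (consensus m xstar))) :=
  (h.gradF_continuous.tendsto _).comp h.X_tendsto

theorem A_tendsto (h : IsConvergentRun c η δ αinit n G Wt f r τ xstar Sstar) :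
    Tendsto (fun k => τ.A (k + 1)) atTop (𝓝 (consensus m xstar)) := by
  obtain ⟨αl, -, -, hα⟩ := h.exists_alpha_tendsto
  have h1 := (tendsto_add_atTop_iff_nat 1).2 h.X_tendsto
  have h2 := (tendsto_add_atTop_iff_nat 1).2 h.S_tendsto
  have h3 := h1.add (hα.smul (h2.sub h.S_tendsto))
  rw [sub_self, smul_zero, add_zero] at h3
  refine h3.congr fun k => ?_
  rw [smul_sub, ← add_sub_assoc, h.X_add_S k, add_sub_cancel_right]

theorem alpha_smul_residual_tendsto
    (h : IsConvergentRun c η δ αinit n G Wt f r τ xstar Sstar) :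
    Tendsto (fun k => τ.α k • τ.residual f k) atTop (𝓝 0) := by
  let Y : ℕ → Stack m d := fun k => τ.X k - τ.α k • τ.residual f k
  have hY : Tendsto (fun k => Y k - consensus m xstar) atTop (𝓝 0) := by
    have hb : 0 < 1 - 2 * c := by have := h.two_c_lt_one; linarith
    have h1 : Tendsto (fun k => (1 - 2 * c)⁻¹ * ‖τ.A (k + 1) - consensus m xstar‖) atTop
        (𝓝 ((1 - 2 * c)⁻¹ * 0)) :=
      (tendsto_iff_norm_sub_tendsto_zero.1 h.A_tendsto).const_mul _
    rw [mul_zero] at h1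
    refine squeeze_zero_norm (fun k => ?_) h1
    rw [le_inv_mul_iff₀ hb]
    have h2 := mul_norm_le_norm_sub_apply h.c_pos h.lap_upper
      (Y k - consensus m xstar)
    refine h2.trans_eq ?_
    rw [map_sub, h.lap_consensus, sub_zero, h.A_succ_eq k, sub_right_comm]
  have h1 := (h.X_tendsto.sub_const (consensus m xstar)).sub hY
  rw [sub_self, sub_zero] at h1
  refine h1.congr fun k => ?_
  simp only [Y]; abel

theorem alpha_smul_residual_succ_tendsto
    (h : IsConvergentRun c η δ αinit n G Wt f r τ xstar Sstar) :
    Tendsto (fun k => τ.α k • τ.residual f (k + 1)) atTop (𝓝 0) := by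
  obtain ⟨αl, -, -, hα⟩ := h.exists_alpha_tendsto
  have hR := h.alpha_smul_residual_tendsto
  have hG := ((tendsto_add_atTop_iff_nat 1).2 h.gradF_tendsto).sub h.gradF_tendsto
  have hS := ((tendsto_add_atTop_iff_nat 1).2 h.S_tendsto).sub h.S_tendsto
  have hL : Tendsto (fun k => mixCLM (gossipLaplacian c Wt) (τ.X k - τ.α k • τ.residual f k)) atTop
      (𝓝 (mixCLM (gossipLaplacian c Wt) (consensus m xstar - 0))) :=
    ((mixCLM (gossipLaplacian c Wt)).continuous.tendsto _).comp (h.X_tendsto.sub hR)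
  rw [sub_zero, h.lap_consensus] at hL
  have h1 := ((hR.add (hα.smul hG)).add (hα.smul hS)).add hL
  simp only [sub_self, smul_zero, add_zero] at h1
  refine h1.congr fun k => ?_
  rw [← h.alpha_smul_D_sub]
  unfold Trajectory.residual
  module

theorem tendsto_row {Z : ℕ → Stack m d} {z : Stack m d} (hZ : Tendsto Z atTop (𝓝 z)) (i : Fin m) :
    Tendsto (fun k => Z k i) atTop (𝓝 (z i)) := by
  have : Continuous fun Z : Stack m d => Z i := by fun_prop
  exact (this.tendsto z).comp hZ

/-- The stepsizes stay away from `0`. Trial points with stepsizes up to `α^{k-1} / η` are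
eventually close to `x*`, because `α^{k-1} (∇F(𝐗^k) + 𝐒^k + 𝐃^k) → 0`; hence the local smoothness
of the losses at `x*` prevents any further decrease below a fixed threshold. -/
theorem exists_pos_le_alpha (h : IsConvergentRun c η δ αinit n G Wt f r τ xstar Sstar) :
    ∃ β > 0, ∀ᶠ k in atTop, β ≤ τ.α k := by
  have hη := h.eta_mem.1
  have hloc : ∀ i, ∃ K : NNReal, ∃ t ∈ 𝓝 xstar, LipschitzOnWith K (gradient (f i)) t :=
    fun i => (h.problem.f_smooth i).2 xstar
  choose K t ht hK using hloc
  obtain ⟨L, hL, hKL⟩ : ∃ L : ℝ, 0 < L ∧ ∀ i, (K i : ℝ) ≤ L :=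
    ⟨∑ i, (K i : ℝ) + 1, by positivity, fun i => by
      have := Finset.single_le_sum (f := fun i => (K i : ℝ)) (fun i _ => (K i).2)
        (Finset.mem_univ i)
      linarith⟩
  have ht' : ⋂ i, t i ∈ 𝓝 xstar := Filter.iInter_mem.2 ht
  obtain ⟨ρ, hρ, hball⟩ := Metric.mem_nhds_iff.1 ht'
  have hlip : ∀ i, ∀ x ∈ Metric.ball xstar ρ, ∀ y ∈ Metric.ball xstar ρ,
      ‖gradient (f i) y - gradient (f i) x‖ ≤ L * ‖y - x‖ := fun i x hx y hy =>
    ((hK i).norm_sub_le (Set.mem_iInter.1 (hball hy) i) (Set.mem_iInter.1 (hball hx) i)).trans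
      (mul_le_mul_of_nonneg_right (hKL i) (norm_nonneg _))
  have hXh : Tendsto (fun k => τ.Xhalf (lazyMatrix c Wt) (k + 1)) atTop
      (𝓝 (consensus m xstar)) := by
    have h1 : Tendsto (fun k => τ.X (k + 1) - mixCLM (gossipLaplacian c Wt) (τ.X (k + 1))) atTop
        (𝓝 (consensus m xstar - mixCLM (gossipLaplacian c Wt) (consensus m xstar))) := by
      have h2 := (tendsto_add_atTop_iff_nat 1).2 h.X_tendsto
      exact h2.sub (((mixCLM (gossipLaplacian c Wt)).continuous.tendsto _).comp h2)
    rw [h.lap_consensus, sub_zero] at h1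
    exact h1.congr fun k => (Xhalf_eq _).symm
  have hDh : Tendsto (fun k => τ.α k • τ.Dhalf f (lazyMatrix c Wt) (k + 1)) atTop (𝓝 0) := by
    have h1 := h.alpha_smul_residual_succ_tendsto
    have h2 := h1.sub (((mixCLM (gossipLaplacian c Wt)).continuous.tendsto _).comp h1)
    rw [map_zero, sub_zero] at h2
    refine h2.congr fun k => ?_
    rw [Dhalf_eq, Function.comp, map_smul, smul_sub]
  have hnear : ∀ᶠ k in atTop, ∀ i, τ.X (k + 1) i ∈ Metric.ball xstar ρ ∧
      ∀ a, 0 ≤ a → a ≤ τ.α k / η → τ.Xhalf (lazyMatrix c Wt) (k + 1) i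
        - a • τ.Dhalf f (lazyMatrix c Wt) (k + 1) i ∈ Metric.ball xstar ρ := by
    refine eventually_all.2 fun i => ?_
    have e1 := tendsto_row ((tendsto_add_atTop_iff_nat 1).2 h.X_tendsto) i
    have e2 := (tendsto_row hXh i).sub_const xstar
    have e3 := tendsto_row hDh i
    have e2' := e2.norm
    have e3' := e3.norm
    simp only [consensus, sub_self, norm_zero, PiLp.zero_apply] at e2' e3'
    filter_upwards [e1.eventually (Metric.ball_mem_nhds _ hρ),
      e2'.eventually_lt_const (show 0 < ρ / 2 by positivity),
      e3'.eventually_lt_const (show 0 < η * (ρ / 2) by positivity)] with k k1 k2 k3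
    refine ⟨k1, fun a ha0 ha => ?_⟩
    rw [PiLp.smul_apply, norm_smul, Real.norm_eq_abs, abs_of_pos (h.alpha_pos k)] at k3
    rw [mem_ball_iff_norm, sub_right_comm]
    refine (norm_sub_le _ _).trans_lt ?_
    rw [norm_smul, Real.norm_eq_abs, abs_of_nonneg ha0]
    have h4 : a * ‖τ.Dhalf f (lazyMatrix c Wt) (k + 1) i‖ ≤ ρ / 2 := by
      rw [le_div_iff₀ hη] at ha
      refine le_of_mul_le_mul_left (a := η) ?_ hη
      calc η * (a * ‖τ.Dhalf f (lazyMatrix c Wt) (k + 1) i‖)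
          = a * η * ‖τ.Dhalf f (lazyMatrix c Wt) (k + 1) i‖ := by ring
        _ ≤ τ.α k * ‖τ.Dhalf f (lazyMatrix c Wt) (k + 1) i‖ := by gcongr
        _ ≤ _ := k3.le
    linarith
  obtain ⟨K0, hK0⟩ := eventually_atTop.1 hnear
  have hδL : 0 < η * (δ / (2 * L)) := by
    have := h.delta_mem.1
    positivity
  refine ⟨min (τ.α K0) (η * (δ / (2 * L))), lt_min (h.alpha_pos _) hδL,
    eventually_atTop.2 ⟨K0, fun k hk => ?_⟩⟩
  induction k, hk using Nat.le_induction with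
  | base => exact min_le_left _ _
  | succ k hk ih =>
    have h1 := h.min_le_alpha (k := k + 1) (B := min (τ.α k / η) (δ / (2 * L)))
      fun i s _ hle => by
        obtain ⟨k1, k2⟩ := hK0 k hk i
        have hp := h.trialStep_pos (k + 1) i s
        exact lineSearchTest_of_le (h.problem.f_convex i) (h.problem.f_smooth i).1 hL hp
          (hlip i _ k1 _ (k2 _ hp.le (hle.trans (min_le_left _ _)))) (hle.trans (min_le_right _ _))
    rw [mul_min_of_nonneg _ _ hη.le, mul_div_cancel₀ _ hη.ne'] at h1
    refine le_trans (le_min ih ?_) h1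
    exact le_min ih (min_le_right _ _)

theorem alpha_limit_pos (h : IsConvergentRun c η δ αinit n G Wt f r τ xstar Sstar) {αl : ℝ}
    (hα : Tendsto τ.α atTop (𝓝 αl)) : 0 < αl := by
  obtain ⟨β, hβ, hle⟩ := h.exists_pos_le_alpha
  exact hβ.trans_le (ge_of_tendsto hα hle)

theorem residual_tendsto (h : IsConvergentRun c η δ αinit n G Wt f r τ xstar Sstar) :
    Tendsto (τ.residual f) atTop (𝓝 0) := by
  obtain ⟨αl, -, -, hα⟩ := h.exists_alpha_tendsto
  have h1 := (hα.inv₀ (h.alpha_limit_pos hα).ne').smul h.alpha_smul_residual_tendsto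
  rw [smul_zero] at h1
  refine h1.congr fun k => ?_
  rw [smul_smul, inv_mul_cancel₀ (h.alpha_pos k).ne', one_smul]

theorem D_tendsto (h : IsConvergentRun c η δ αinit n G Wt f r τ xstar Sstar) :
    Tendsto τ.D atTop (𝓝 (-(gradF f (consensus m xstar) + Sstar))) := by
  have h1 := h.residual_tendsto.sub (h.gradF_tendsto.add h.S_tendsto)
  rw [zero_sub] at h1
  refine h1.congr fun k => ?_
  unfold Trajectory.residual
  abel

/-- The limit satisfies the optimality condition `∇F(𝐗*) + 𝐒* + (I - W) 𝐓* = 0`. -/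
theorem exists_optimality (h : IsConvergentRun c η δ αinit n G Wt f r τ xstar Sstar) :
    ∃ Tstar : Stack m d, gradF f (consensus m xstar) + Sstar
      + mixCLM (gossipLaplacian c Wt) Tstar = 0 := by
  obtain ⟨Tstar, hT⟩ := exists_apply_eq_of_tendsto (Λ := mixCLM (gossipLaplacian c Wt))
    (h.D_tendsto.congr h.D_eq)
  exact ⟨Tstar, by rw [hT, add_neg_cancel]⟩

theorem Dhalf_tendsto (h : IsConvergentRun c η δ αinit n G Wt f r τ xstar Sstar) :
    Tendsto (τ.Dhalf f (lazyMatrix c Wt)) atTop (𝓝 0) := by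
  have h1 := h.residual_tendsto
  have h2 := h1.sub (((mixCLM (gossipLaplacian c Wt)).continuous.tendsto _).comp h1)
  rw [map_zero, sub_zero] at h2
  exact h2.congr fun k => (Dhalf_eq k).symm

theorem Xhalf_tendsto (h : IsConvergentRun c η δ αinit n G Wt f r τ xstar Sstar) :
    Tendsto (τ.Xhalf (lazyMatrix c Wt)) atTop (𝓝 (consensus m xstar)) := by
  have h1 := h.X_tendsto.sub
    (((mixCLM (gossipLaplacian c Wt)).continuous.tendsto _).comp h.X_tendsto)
  rw [h.lap_consensus, sub_zero] at h1
  exact h1.congr fun k => (Xhalf_eq k).symm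

end IsConvergentRun

end Algorithm

/-! ### The smoothness and tangent constants -/

section Constants

variable {m d : ℕ} {c η δ αinit : ℝ} {n : ℕ → ℝ} {G : SimpleGraph (Fin m)}
  {Wt : Matrix (Fin m) (Fin m) ℝ} {f : Fin m → Vec d → ℝ} {r : Fin m → Vec d → EReal}
  {τ : Trajectory m d} {xstar : Vec d} {Sstar : Stack m d}

theorem exists_norm_bound {H : Type*} [NormedAddCommGroup H] {u : ℕ → H} {y : H}
    (hu : Tendsto u atTop (𝓝 y)) : ∃ B, 0 ≤ B ∧ ∀ k, ‖u k‖ ≤ B := by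
  obtain ⟨B, hB⟩ := hu.norm.bddAbove_range
  exact ⟨B, (norm_nonneg _).trans (hB ⟨0, rfl⟩), fun k => hB ⟨k, rfl⟩⟩

theorem norm_row_le (Z : Stack m d) (i : Fin m) : ‖Z i‖ ≤ ‖Z‖ := PiLp.norm_apply_le Z i

theorem norm_le_mul_norm_of_rows {Y Z : Stack m d} {L : ℝ} (hL : 0 ≤ L)
    (h : ∀ i, ‖Y i‖ ≤ L * ‖Z i‖) : ‖Y‖ ≤ L * ‖Z‖ := by
  refine le_of_sq_le_sq ?_ (by positivity)
  rw [mul_pow, PiLp.norm_sq_eq_of_L2 _ Y, PiLp.norm_sq_eq_of_L2 _ Z, Finset.mul_sum]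
  refine Finset.sum_le_sum fun i _ => ?_
  rw [← mul_pow]
  exact pow_le_pow_left₀ (norm_nonneg _) (h i) 2

namespace IsConvergentRun

theorem exists_smoothnessConstant
    (h : IsConvergentRun c η δ αinit n G Wt f r τ xstar Sstar) :
    ∃ Lf, IsSmoothnessConstant τ f (lazyMatrix c Wt) c η δ αinit n Lf := by
  obtain ⟨αl, hl0, -, hα⟩ := h.exists_alpha_tendsto
  obtain ⟨B1, hB1, hX⟩ := exists_norm_bound h.X_tendsto
  obtain ⟨B2, hB2, hA⟩ := exists_norm_bound h.A_tendsto
  obtain ⟨B3, hB3, hXh⟩ := exists_norm_bound h.Xhalf_tendsto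
  obtain ⟨B4, hB4, hD⟩ := exists_norm_bound h.Dhalf_tendsto
  obtain ⟨B5, hB5, hs⟩ := exists_norm_bound (h.sqrt_shift_tendsto hl0 hα)
  have hsub : ∀ i, agentHull τ f (lazyMatrix c Wt) c η δ αinit n i ⊆
      Metric.closedBall 0 (B1 + B2 + (B3 + B5 * B4)) := fun i => by
    refine convexHull_min ?_ (convex_closedBall _ _)
    have hBB : 0 ≤ B5 * B4 := by positivity
    rintro z ⟨k, rfl | rfl | ⟨s, -, rfl⟩⟩
    · rw [mem_closedBall_zero_iff]
      linarith [hX k, norm_row_le (τ.X k) i]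
    · rw [mem_closedBall_zero_iff]
      linarith [hA k, norm_row_le (τ.A (k + 1)) i]
    · rw [mem_closedBall_zero_iff]
      refine (norm_sub_le _ _).trans ?_
      rw [norm_smul, Real.norm_eq_abs, abs_of_pos (h.trialStep_pos k i s)]
      have h1 := (h.trialStep_le k i s).trans ((Real.le_norm_self _).trans (hs k))
      have h2 := mul_le_mul h1 ((norm_row_le (τ.Dhalf f (lazyMatrix c Wt) k) i).trans (hD k))
        (norm_nonneg _) hB5
      linarith [hXh k, norm_row_le (τ.Xhalf (lazyMatrix c Wt) k) i]
  have hlip : ∀ i, ∃ K, LipschitzOnWith K (gradient (f i))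
      (Metric.closedBall 0 (B1 + B2 + (B3 + B5 * B4))) := fun i =>
    ((h.problem.f_smooth i).2.locallyLipschitzOn).exists_lipschitzOnWith_of_compact
      (isCompact_closedBall _ _)
  choose K hK using hlip
  refine ⟨∑ i, (K i : ℝ) + 1, by positivity, fun i x hx y hy => ?_⟩
  refine ((hK i).norm_sub_le (hsub i hx) (hsub i hy)).trans ?_
  have := Finset.single_le_sum (f := fun i => (K i : ℝ)) (fun i _ => (K i).2) (Finset.mem_univ i)
  exact mul_le_mul_of_nonneg_right (by linarith) (norm_nonneg _)

theorem X_mem_agentHull (k : ℕ) (i : Fin m) :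
    τ.X k i ∈ agentHull τ f (lazyMatrix c Wt) c η δ αinit n i :=
  subset_convexHull ℝ _ ⟨k, Or.inl rfl⟩

theorem A_mem_agentHull (k : ℕ) (i : Fin m) :
    τ.A (k + 1) i ∈ agentHull τ f (lazyMatrix c Wt) c η δ αinit n i :=
  subset_convexHull ℝ _ ⟨k, Or.inr (Or.inl rfl)⟩

theorem trialPoint_mem_agentHull {k : ℕ} {i : Fin m} {s : ℕ} (hs : s ≤ τ.back k i) :
    τ.trialPoint f (lazyMatrix c Wt) c η δ αinit n k i s ∈
      agentHull τ f (lazyMatrix c Wt) c η δ αinit n i :=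
  subset_convexHull ℝ _ ⟨k, Or.inr (Or.inr ⟨s, hs, rfl⟩)⟩

theorem min_le_alpha_of_smoothnessConstant
    (h : IsConvergentRun c η δ αinit n G Wt f r τ xstar Sstar) {Lf : ℝ}
    (hLf : IsSmoothnessConstant τ f (lazyMatrix c Wt) c η δ αinit n Lf) (k : ℕ) :
    min αinit (η * (δ / (2 * Lf))) ≤ shiftSeq αinit τ.α k := by
  induction k with
  | zero => exact min_le_left _ _
  | succ k ih =>
    have h1 := h.min_le_alpha (k := k) (B := δ / (2 * Lf)) fun i s hs hle =>
      lineSearchTest_of_le (h.problem.f_convex i) (h.problem.f_smooth i).1 hLf.1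
        (h.trialStep_pos k i s)
        (hLf.2 i _ (trialPoint_mem_agentHull hs) _ (X_mem_agentHull k i)) hle
    exact (le_min ih (min_le_right _ _)).trans h1

/-- The smoothness inequality extends to the limit of the iterates. -/
theorem norm_gradF_sub_le (h : IsConvergentRun c η δ αinit n G Wt f r τ xstar Sstar) {Lf : ℝ}
    (hLf : IsSmoothnessConstant τ f (lazyMatrix c Wt) c η δ αinit n Lf) (k : ℕ) :
    ‖gradF f (τ.X k) - gradF f (consensus m xstar)‖ ≤ Lf * ‖τ.X k - consensus m xstar‖ := by
  refine norm_le_mul_norm_of_rows hLf.1.le fun i => ?_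
  have h1 := ((tendsto_row h.gradF_tendsto i).const_sub (gradF f (τ.X k) i)).norm
  have h2 := (((tendsto_row h.X_tendsto i).const_sub (τ.X k i)).norm).const_mul Lf
  exact le_of_tendsto_of_tendsto h1 h2 (Eventually.of_forall fun l =>
    hLf.2 i _ (X_mem_agentHull k i) _ (X_mem_agentHull l i))

theorem subdiff_row_ne_top {M : AffineSubspace ℝ (Vec d)}
    (hM : ∀ i, IsPartlySmoothAt (r i) M xstar) (i : Fin m) :
    r i (consensus m xstar i) ≠ ⊤ :=
  subdiff_ne_top (hM i).proper.exists_ne_top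
    ((hM i).exists_subgrad.self_of_nhdsWithin (hM i).mem)

/-- Finite identification of the manifold by all agents. -/
theorem eventually_X_mem (h : IsConvergentRun c η δ αinit n G Wt f r τ xstar Sstar)
    {M : AffineSubspace ℝ (Vec d)} (hM : ∀ i, IsPartlySmoothAt (r i) M xstar)
    (hnd : Sstar ∈ intrinsicInterior ℝ (subdiff (sumR r) (consensus m xstar))) :
    ∀ᶠ k in atTop, ∀ i, τ.X k i ∈ M := by
  obtain ⟨ρ, hρ, hball⟩ := exists_ball_of_mem_intrinsicInterior
    (fun i => (hM i).proper.ne_bot) (subdiff_row_ne_top hM) hnd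
  refine eventually_all.2 fun i => ?_
  refine (hM i).eventually_mem hρ (hball i) (tendsto_row h.X_tendsto i)
    (tendsto_row h.S_tendsto i) ?_
  filter_upwards [eventually_ge_atTop 1] with k hk
  obtain ⟨l, rfl⟩ : ∃ l, k = l + 1 := ⟨k - 1, by omega⟩
  exact h.S_mem_subdiff l i

theorem Sstar_mem_subdiff {M : AffineSubspace ℝ (Vec d)}
    (hM : ∀ i, IsPartlySmoothAt (r i) M xstar)
    (hnd : Sstar ∈ intrinsicInterior ℝ (subdiff (sumR r) (consensus m xstar))) (i : Fin m) :
    Sstar i ∈ subdiff (r i) xstar :=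
  (mem_subdiff_sumR (fun i => (hM i).proper.ne_bot) (subdiff_row_ne_top hM)).1
    (intrinsicInterior_subset hnd) i

theorem exists_tangentConstant (h : IsConvergentRun c η δ αinit n G Wt f r τ xstar Sstar)
    {M : AffineSubspace ℝ (Vec d)} (hM : ∀ i, IsPartlySmoothAt (r i) M xstar)
    (hnd : Sstar ∈ intrinsicInterior ℝ (subdiff (sumR r) (consensus m xstar))) :
    ∃ Lr, IsTangentConstant τ M.direction (consensus m xstar) Sstar Lr := by
  choose L hL0 hL using fun i => (hM i).exists_tangent_lipschitz
  refine ⟨∑ i, L i, Finset.sum_nonneg fun i _ => hL0 i, ?_⟩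
  have hall : ∀ᶠ k in atTop, ∀ i, τ.X k i ∈ M → ∀ v ∈ subdiff (r i) (τ.X k i),
      ∀ w ∈ subdiff (r i) xstar, ‖M.direction.starProjection v - M.direction.starProjection w‖
        ≤ L i * ‖τ.X k i - xstar‖ :=
    eventually_all.2 fun i => (tendsto_row h.X_tendsto i).eventually (hL i)
  filter_upwards [hall, h.eventually_X_mem hM hnd, eventually_ge_atTop 1] with k h1 h2 hk
  obtain ⟨l, rfl⟩ : ∃ l, k = l + 1 := ⟨k - 1, by omega⟩
  refine norm_le_mul_norm_of_rows (Finset.sum_nonneg fun i _ => hL0 i) fun i => ?_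
  refine (h1 i (h2 i) _ (h.S_mem_subdiff l i) _ (Sstar_mem_subdiff hM hnd i)).trans ?_
  exact mul_le_mul_of_nonneg_right
    (Finset.single_le_sum (fun i _ => hL0 i) (Finset.mem_univ i)) (norm_nonneg _)

end IsConvergentRun

/-! ### Energy decrease along the run -/

/-- The line search of agent `i` tests a point `b` obtained with its own stepsize, while the next
iterate is computed at a point `a` with the common stepsize `α`. The descent inequality
persists at `a` up to a multiple of `‖a - b‖²`. -/
theorem bregman_le_of_lineSearchTest {f : Vec d → ℝ} (hf : ConvexOn ℝ Set.univ f)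
    (hd : Differentiable ℝ f) {x a b : Vec d} {α α' Lf : ℝ} (hδ0 : 0 ≤ δ) (hδ : δ < 1)
    (hα : 0 < α)
    (hαα : α ≤ α') (hlip : ‖gradient f a - gradient f x‖ ≤ Lf * ‖a - x‖)
    (ht : LineSearchTest f δ α' x b) :
    2 * α * (f a - f x - inner ℝ (gradient f x) (a - x)) ≤ (1 + δ) / 2 * ‖a - x‖ ^ 2
      + ((2 * δ + 2 * α * Lf) ^ 2 / (2 * (1 - δ)) + δ) * ‖a - b‖ ^ 2 := by
  have hα' : 0 < α' := hα.trans_le hαα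
  have h1 := hf.add_inner_gradient_le (hd a) b
  have h2 : inner ℝ (gradient f a) (b - a) = - inner ℝ (gradient f a) (a - b) := by
    rw [← inner_neg_right, neg_sub]
  have h3 := real_inner_le_norm (gradient f a - gradient f x) (a - b)
  rw [inner_sub_left] at h3
  have h4 : ‖gradient f a - gradient f x‖ * ‖a - b‖ ≤ Lf * ‖a - x‖ * ‖a - b‖ := by gcongr
  have h5 : inner ℝ (gradient f x) (a - x) =
      inner ℝ (gradient f x) (a - b) + inner ℝ (gradient f x) (b - x) := by
    rw [← inner_add_right, sub_add_sub_cancel]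
  unfold LineSearchTest at ht
  have h6 : ‖b - x‖ ≤ ‖a - x‖ + ‖a - b‖ := by
    have := norm_sub_le (a - x) (a - b)
    rwa [sub_sub_sub_cancel_left] at this
  have h7 : 2 * α * (δ / (2 * α') * ‖b - x‖ ^ 2) ≤ δ * (‖a - x‖ + ‖a - b‖) ^ 2 := by
    have h8 : 2 * α * (δ / (2 * α') * ‖b - x‖ ^ 2) = (α / α') * (δ * ‖b - x‖ ^ 2) := by
      field_simp
    rw [h8]
    have h9 : α / α' ≤ 1 := (div_le_one hα').2 hαα
    have h10 : δ * ‖b - x‖ ^ 2 ≤ δ * (‖a - x‖ + ‖a - b‖) ^ 2 := by gcongr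
    have h11 : 0 ≤ δ * ‖b - x‖ ^ 2 := by positivity
    nlinarith
  have h12 : f a - f x - inner ℝ (gradient f x) (a - x)
      ≤ δ / (2 * α') * ‖b - x‖ ^ 2 + Lf * ‖a - x‖ * ‖a - b‖ := by linarith
  have h13 := mul_le_mul_of_nonneg_left h12 (show 0 ≤ 2 * α by linarith)
  set p := ‖a - x‖
  set e := ‖a - b‖
  have hδ' : 0 < 1 - δ := by linarith
  -- Young's inequality for the mixed term
  have h14 : (2 * δ + 2 * α * Lf) * (p * e)
      ≤ (1 - δ) / 2 * p ^ 2 + (2 * δ + 2 * α * Lf) ^ 2 / (2 * (1 - δ)) * e ^ 2 := by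
    have h15 : (1 - δ) / 2 * p ^ 2 + (2 * δ + 2 * α * Lf) ^ 2 / (2 * (1 - δ)) * e ^ 2
        - (2 * δ + 2 * α * Lf) * (p * e)
        = ((1 - δ) * p - (2 * δ + 2 * α * Lf) * e) ^ 2 / (2 * (1 - δ)) := by
      field_simp; ring
    have h16 : 0 ≤ ((1 - δ) * p - (2 * δ + 2 * α * Lf) * e) ^ 2 / (2 * (1 - δ)) := by positivity
    linarith
  nlinarith

namespace Trajectory

/-- Squared distance to the limit `(𝐗*, 𝐒*, 𝐓*)`, with the limit stepsize as weight of the dual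
variables. -/
def energy (τ : Trajectory m d) (c : ℝ) (Wt : Matrix (Fin m) (Fin m) ℝ) (αl : ℝ) (xstar : Vec d)
    (Sstar Tstar : Stack m d) (k : ℕ) : ℝ :=
  ‖τ.X k - consensus m xstar‖ ^ 2 + αl ^ 2 * (‖τ.S k - Sstar‖ ^ 2
    + lapEnergy (mixCLM (gossipLaplacian c Wt)) (τ.T k - Tstar))

/-- The energy dissipated in iteration `k`. -/
def dissipation (τ : Trajectory m d) (δ αl μ : ℝ) (xstar : Vec d) (k : ℕ) : ℝ :=
  (1 - δ) / 2 * ‖τ.X k - τ.A (k + 1)‖ ^ 2 + αl * μ / 2 * ‖τ.X k - consensus m xstar‖ ^ 2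

end Trajectory

namespace IsConvergentRun

theorem energy_nonneg (h : IsConvergentRun c η δ αinit n G Wt f r τ xstar Sstar) (αl : ℝ)
    (Tstar : Stack m d) (k : ℕ) : 0 ≤ τ.energy c Wt αl xstar Sstar Tstar k := by
  have := lapEnergy_nonneg h.c_pos h.two_c_lt_one h.lap_upper (τ.T k - Tstar)
  unfold Trajectory.energy
  positivity

theorem dissipation_nonneg (h : IsConvergentRun c η δ αinit n G Wt f r τ xstar Sstar) {αl μ : ℝ}
    (hαl : 0 ≤ αl) (hμ : 0 ≤ μ) (k : ℕ) : 0 ≤ τ.dissipation δ αl μ xstar k := by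
  have : 0 ≤ 1 - δ := by have := h.delta_mem.2; linarith
  unfold Trajectory.dissipation
  positivity

theorem residual_eq (h : IsConvergentRun c η δ αinit n G Wt f r τ xstar Sstar)
    {Tstar : Stack m d} (hT : gradF f (consensus m xstar) + Sstar
      + mixCLM (gossipLaplacian c Wt) Tstar = 0) (k : ℕ) :
    τ.residual f k = (gradF f (τ.X k) - gradF f (consensus m xstar)) + (τ.S k - Sstar)
      + mixCLM (gossipLaplacian c Wt) (τ.T k - Tstar) := by
  rw [map_sub, ← h.D_eq k]
  unfold Trajectory.residual
  rw [eq_neg_of_add_eq_zero_right hT]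
  abel

/-- The residual, hence also the search direction, is controlled by the energy. -/
theorem exists_Dhalf_sq_le (h : IsConvergentRun c η δ αinit n G Wt f r τ xstar Sstar)
    {αl Lf : ℝ} (hαl : 0 < αl)
    (hLf : IsSmoothnessConstant τ f (lazyMatrix c Wt) c η δ αinit n Lf)
    {Tstar : Stack m d} (hT : gradF f (consensus m xstar) + Sstar
      + mixCLM (gossipLaplacian c Wt) Tstar = 0) :
    ∃ B, 0 ≤ B ∧ ∀ k, ‖τ.Dhalf f (lazyMatrix c Wt) k‖ ^ 2 ≤
      B * τ.energy c Wt αl xstar Sstar Tstar k := by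
  have hb : 0 < 1 - 2 * c := by have := h.two_c_lt_one; linarith
  have hc := h.c_pos
  refine ⟨3 * (Lf ^ 2 + (1 / αl ^ 2) * (1 + 2 * c / (1 - 2 * c))), by positivity, fun k => ?_⟩
  have h1 : ‖τ.Dhalf f (lazyMatrix c Wt) k‖ ≤ ‖τ.residual f k‖ := by
    rw [Dhalf_eq]
    exact norm_sub_apply_le_of_norm_sq_le h.c_pos h.two_c_lt_one.le h.lap_upper _
  have h2 := h.norm_gradF_sub_le hLf k
  rw [h.residual_eq hT] at h1
  have h3 := h1.trans (norm_add₃_le)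
  have h4 := mul_norm_sq_le_lapEnergy h.lap_upper (τ.T k - Tstar)
  have h5 := lapEnergy_nonneg h.c_pos h.two_c_lt_one h.lap_upper (τ.T k - Tstar)
  unfold Trajectory.energy
  set x := ‖τ.X k - consensus m xstar‖
  set s := ‖τ.S k - Sstar‖
  set q := lapEnergy (mixCLM (gossipLaplacian c Wt)) (τ.T k - Tstar)
  set l := ‖mixCLM (gossipLaplacian c Wt) (τ.T k - Tstar)‖
  set g := ‖gradF f (τ.X k) - gradF f (consensus m xstar)‖
  have h6 : l ^ 2 ≤ 2 * c / (1 - 2 * c) * q := by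
    rw [div_mul_eq_mul_div, le_div_iff₀ hb]; linarith
  have h7 : g ^ 2 ≤ Lf ^ 2 * x ^ 2 := by
    rw [← mul_pow]; exact pow_le_pow_left₀ (norm_nonneg _) h2 2
  have h8 : ‖τ.Dhalf f (lazyMatrix c Wt) k‖ ^ 2 ≤ (g + s + l) ^ 2 :=
    pow_le_pow_left₀ (norm_nonneg _) h3 2
  have h9 : (g + s + l) ^ 2 ≤ 3 * (g ^ 2 + s ^ 2 + l ^ 2) := by
    nlinarith [sq_nonneg (g - s), sq_nonneg (g - l), sq_nonneg (s - l)]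
  have h10 : 0 ≤ 2 * c / (1 - 2 * c) := by positivity
  set w := 2 * c / (1 - 2 * c)
  have h11 : (Lf ^ 2 + 1 / αl ^ 2 * (1 + w)) * (x ^ 2 + αl ^ 2 * (s ^ 2 + q))
      = Lf ^ 2 * x ^ 2 + (s ^ 2 + w * q) + (Lf ^ 2 * αl ^ 2 * (s ^ 2 + q)
        + 1 / αl ^ 2 * (1 + w) * x ^ 2 + (w * s ^ 2 + q)) := by
    field_simp; ring
  have h12 : 0 ≤ Lf ^ 2 * αl ^ 2 * (s ^ 2 + q)
        + 1 / αl ^ 2 * (1 + w) * x ^ 2 + (w * s ^ 2 + q) := by positivity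
  nlinarith

/-- The stepsizes of all agents merge, so that the descent inequality holds along the run up to
a vanishing fraction of the energy. -/
theorem eventually_bregman_le (h : IsConvergentRun c η δ αinit n G Wt f r τ xstar Sstar)
    {αl Lf : ℝ} (hα : Tendsto τ.α atTop (𝓝 αl))
    (hLf : IsSmoothnessConstant τ f (lazyMatrix c Wt) c η δ αinit n Lf)
    {Tstar : Stack m d} (hT : gradF f (consensus m xstar) + Sstar
      + mixCLM (gossipLaplacian c Wt) Tstar = 0) {ε : ℝ} (hε : 0 < ε) :
    ∀ᶠ k in atTop, 2 * τ.α k * (sumF f (τ.A (k + 1)) - sumF f (τ.X k)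
        - inner ℝ (gradF f (τ.X k)) (τ.A (k + 1) - τ.X k))
      ≤ (1 + δ) / 2 * ‖τ.X k - τ.A (k + 1)‖ ^ 2
        + ε * τ.energy c Wt αl xstar Sstar Tstar k := by
  have hαl := h.alpha_limit_pos hα
  obtain ⟨B, hB, hDB⟩ := h.exists_Dhalf_sq_le hαl hLf hT
  let w : ℕ → ℝ := fun k => (2 * δ + 2 * τ.α k * Lf) ^ 2 / (2 * (1 - δ)) + δ
  let β : ℕ → ℝ := fun k => √(shiftSeq αinit τ.α k ^ 2 + n k) - τ.α k
  have hδ1 : 0 < 1 - δ := by have := h.delta_mem.2; linarith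
  have hδ0 := h.delta_mem.1
  have hw : Tendsto w atTop (𝓝 ((2 * δ + 2 * αl * Lf) ^ 2 / (2 * (1 - δ)) + δ)) :=
    (((((hα.const_mul 2).mul_const Lf).const_add (2 * δ)).pow 2).div_const _).add_const _
  have hβ : Tendsto β atTop (𝓝 0) := by
    have := (h.sqrt_shift_tendsto hαl.le hα).sub hα
    rwa [sub_self] at this
  have hlim : Tendsto (fun k => w k * β k ^ 2 * B) atTop (𝓝 0) := by
    have := (hw.mul (hβ.pow 2)).mul_const B
    simpa using this
  filter_upwards [hlim.eventually_lt_const hε] with k hk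
  have hrow : ∀ i, 2 * τ.α k * (f i (τ.A (k + 1) i) - f i (τ.X k i)
      - inner ℝ (gradient (f i) (τ.X k i)) (τ.A (k + 1) i - τ.X k i))
      ≤ (1 + δ) / 2 * ‖(τ.X k - τ.A (k + 1)) i‖ ^ 2
        + w k * β k ^ 2 * ‖τ.Dhalf f (lazyMatrix c Wt) k i‖ ^ 2 := fun i => by
    have h1 := bregman_le_of_lineSearchTest (h.problem.f_convex i) (h.problem.f_smooth i).1
      (Lf := Lf) hδ0.le h.delta_mem.2 (h.alpha_pos k) (h.step_le k i)
      (hLf.2 i _ (A_mem_agentHull k i) _ (X_mem_agentHull k i)) (h.generated.search_pass k i)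
    have h2 : τ.A (k + 1) i - τ.trialPoint f (lazyMatrix c Wt) c η δ αinit n k i (τ.back k i)
        = (τ.trialStep c η δ αinit n k i (τ.back k i) - τ.α k) •
          τ.Dhalf f (lazyMatrix c Wt) k i := by
      rw [h.generated.A_succ, Trajectory.trialPoint, PiLp.sub_apply, PiLp.smul_apply]
      module
    have h3 : (τ.trialStep c η δ αinit n k i (τ.back k i) - τ.α k) ^ 2 ≤ β k ^ 2 :=
      pow_le_pow_left₀ (by linarith [h.step_le k i])
        (by simp only [β]; linarith [h.trialStep_le k i (τ.back k i)]) 2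
    rw [h2, norm_smul, mul_pow, Real.norm_eq_abs, sq_abs] at h1
    have hw0 : 0 ≤ w k := by simp only [w]; positivity
    have h4 : w k * ((τ.trialStep c η δ αinit n k i (τ.back k i) - τ.α k) ^ 2
        * ‖τ.Dhalf f (lazyMatrix c Wt) k i‖ ^ 2)
        ≤ w k * (β k ^ 2 * ‖τ.Dhalf f (lazyMatrix c Wt) k i‖ ^ 2) := by gcongr
    rw [PiLp.sub_apply, norm_sub_rev]
    rw [mul_assoc (w k)]
    exact h1.trans (by gcongr)
  have hsum := Finset.sum_le_sum fun i (_ : i ∈ Finset.univ) => hrow i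
  rw [Finset.sum_add_distrib, ← Finset.mul_sum, ← Finset.mul_sum, ← Finset.mul_sum,
    ← PiLp.norm_sq_eq_of_L2, ← PiLp.norm_sq_eq_of_L2, Finset.sum_sub_distrib,
    Finset.sum_sub_distrib] at hsum
  have h5 : inner ℝ (gradF f (τ.X k)) (τ.A (k + 1) - τ.X k)
      = ∑ i, inner ℝ (gradient (f i) (τ.X k i)) (τ.A (k + 1) i - τ.X k i) := by
    rw [PiLp.inner_apply]; rfl
  rw [h5]
  refine hsum.trans ?_
  have hw0 : 0 ≤ w k := by simp only [w]; positivity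
  have hE := h.energy_nonneg αl Tstar k
  have h6 : w k * β k ^ 2 * ‖τ.Dhalf f (lazyMatrix c Wt) k‖ ^ 2
      ≤ w k * β k ^ 2 * (B * τ.energy c Wt αl xstar Sstar Tstar k) :=
    mul_le_mul_of_nonneg_left (hDB k) (by positivity)
  have h7 : w k * β k ^ 2 * B * τ.energy c Wt αl xstar Sstar Tstar k
      ≤ ε * τ.energy c Wt αl xstar Sstar Tstar k := mul_le_mul_of_nonneg_right hk.le hE
  have h8 : ∀ e : ℝ, w k * β k ^ 2 * (B * e) = w k * β k ^ 2 * B * e := fun e => by ring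
  rw [h8] at h6
  linarith

/-- Lower bound for the monotonicity term of the gradient, from the three-point identity. -/
theorem inner_gradF_sub_ge (h : IsConvergentRun c η δ αinit n G Wt f r τ xstar Sstar)
    {μ : ℝ} {U : Set (Stack m d)} (hF : StrongConvexOn U μ (sumF f)) {X A : Stack m d}
    (hX : X ∈ U) (hXs : consensus m xstar ∈ U) :
    μ / 2 * ‖X - consensus m xstar‖ ^ 2
        - (sumF f A - sumF f X - inner ℝ (gradF f X) (A - X))
      ≤ inner ℝ (gradF f X - gradF f (consensus m xstar)) (A - consensus m xstar) := by
  have h1 := hF.add_deriv_le hX hXs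
    (hasDerivAt_sumF_line (fun i => (h.problem.f_smooth i).1) X (consensus m xstar - X))
  have h2 : sumF f (consensus m xstar)
      + inner ℝ (gradF f (consensus m xstar)) (A - consensus m xstar) ≤ sumF f A := by
    rw [PiLp.inner_apply]
    unfold sumF
    rw [← Finset.sum_add_distrib]
    exact Finset.sum_le_sum fun i _ => (h.problem.f_convex i).add_inner_gradient_le
      ((h.problem.f_smooth i).1 _) (A i)
  have h3 : inner ℝ (gradF f X) (A - consensus m xstar)
      = inner ℝ (gradF f X) (A - X) - inner ℝ (gradF f X) (consensus m xstar - X) := by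
    rw [← inner_sub_right, sub_sub_sub_cancel_right]
  rw [norm_sub_rev] at h1
  rw [inner_sub_left, h3]
  linarith

theorem monotone_step (h : IsConvergentRun c η δ αinit n G Wt f r τ xstar Sstar)
    (hS : ∀ i, Sstar i ∈ subdiff (r i) xstar) (k : ℕ) :
    0 ≤ inner ℝ (τ.X (k + 1) - consensus m xstar) (τ.S (k + 1) - Sstar) := by
  rw [real_inner_comm, PiLp.inner_apply]
  exact Finset.sum_nonneg fun i _ => inner_sub_nonneg_of_mem_subdiff
    (h.problem.r_convex i).ne_bot (h.problem.r_convex i).exists_ne_top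
    (h.S_mem_subdiff k i) (hS i)

/-- Passage from the energy weighted with the current stepsize `a` to the one weighted with the
limit stepsize `αl`. Here `x`, `y` stand for the primal and dual distances, `P` for the gradient
monotonicity term and `B` for the Bregman distance. -/
theorem energy_decrease_of_perturbed {a αl μ w ε x x' R y y' P B : ℝ} (hδ : δ < 1) (hαl : 0 < αl)
    (hμ : 0 < μ) (hw : 0 < w) (hw1 : w ≤ 1 / 2) (hwε : 8 * w ≤ ε) (k1 : a ^ 2 ≤ (1 + w) * αl ^ 2)
    (k2 : (1 - w) * αl ^ 2 ≤ a ^ 2) (k3 : αl / 2 ≤ a) (h1 : μ / 2 * x ^ 2 - B ≤ P)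
    (k5 : 2 * a * B ≤ (1 + δ) / 2 * R ^ 2 + w * (x ^ 2 + αl ^ 2 * y))
    (h2 : x' ^ 2 + a ^ 2 * y' + R ^ 2 + 2 * a * P ≤ x ^ 2 + a ^ 2 * y)
    (hy0 : 0 ≤ y) (hy0' : 0 ≤ y') :
    x' ^ 2 + αl ^ 2 * y' + ((1 - δ) / 2 * R ^ 2 + αl * μ / 2 * x ^ 2)
      ≤ (1 + ε) * (x ^ 2 + αl ^ 2 * y) := by
  have h3 := mul_le_mul_of_nonneg_left h1 (show 0 ≤ 2 * a by linarith)
  have h4 : αl * μ / 2 * x ^ 2 ≤ a * μ * x ^ 2 := by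
    have h5 : αl / 2 * (μ * x ^ 2) ≤ a * (μ * x ^ 2) :=
      mul_le_mul_of_nonneg_right k3 (by positivity)
    linarith
  have h6 : a ^ 2 * y ≤ (1 + w) * αl ^ 2 * y := mul_le_mul_of_nonneg_right k1 hy0
  have h7 : (1 - w) * αl ^ 2 * y' ≤ a ^ 2 * y' := mul_le_mul_of_nonneg_right k2 hy0'
  have hR0 : 0 ≤ (1 - δ) / 2 * R ^ 2 := mul_nonneg (by linarith) (sq_nonneg _)
  have hx0 : 0 ≤ αl * μ / 2 * x ^ 2 := by positivity
  obtain ⟨e, he⟩ : ∃ e, e = x ^ 2 + αl ^ 2 * y := ⟨_, rfl⟩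
  obtain ⟨e', he'⟩ : ∃ e', e' = x' ^ 2 + αl ^ 2 * y' := ⟨_, rfl⟩
  have he0 : 0 ≤ e := by rw [he]; positivity
  rw [← he] at k5 ⊢
  rw [← he']
  have hx2 : 0 ≤ w * x ^ 2 := by positivity
  have hx2' : 0 ≤ w * x' ^ 2 := by positivity
  -- the perturbed inequality, before absorbing `w * e'`
  have h8 : (1 - w) * e' + ((1 - δ) / 2 * R ^ 2 + αl * μ / 2 * x ^ 2) ≤ (1 + 2 * w) * e := by
    have h9 : x ^ 2 + (1 + w) * αl ^ 2 * y + w * e ≤ (1 + 2 * w) * e := by rw [he]; linarith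
    rw [he']
    linarith
  have h10 : e' ≤ 4 * e := by
    have h11 : (1 - w) * e' ≤ (1 + 2 * w) * e := by linarith
    by_contra hlt
    push Not at hlt
    nlinarith
  nlinarith

/-- The energy with respect to the limit stepsize decreases by the dissipation, up to a vanishing
relative perturbation. -/
theorem eventually_energy_decrease
    (h : IsConvergentRun c η δ αinit n G Wt f r τ xstar Sstar)
    {αl Lf : ℝ} (hα : Tendsto τ.α atTop (𝓝 αl))
    (hLf : IsSmoothnessConstant τ f (lazyMatrix c Wt) c η δ αinit n Lf)
    {Tstar : Stack m d} (hT : gradF f (consensus m xstar) + Sstar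
      + mixCLM (gossipLaplacian c Wt) Tstar = 0)
    (hS : ∀ i, Sstar i ∈ subdiff (r i) xstar)
    {μ : ℝ} (hμ : 0 < μ) {U : Set (Stack m d)} (hU : U ∈ 𝓝 (consensus m xstar))
    (hF : StrongConvexOn U μ (sumF f)) {ε : ℝ} (hε : 0 < ε) :
    ∀ᶠ k in atTop, τ.energy c Wt αl xstar Sstar Tstar (k + 1) + τ.dissipation δ αl μ xstar k
      ≤ (1 + ε) * τ.energy c Wt αl xstar Sstar Tstar k := by
  have hαl := h.alpha_limit_pos hα
  obtain ⟨w, hw, hw1, hwε⟩ : ∃ w : ℝ, 0 < w ∧ w ≤ 1 / 2 ∧ 8 * w ≤ ε :=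
    ⟨min (1 / 2) (ε / 8), by positivity, min_le_left _ _, by
      have := min_le_right (1 / 2) (ε / 8); linarith⟩
  have hup : ∀ᶠ k in atTop, τ.α k ^ 2 < (1 + w) * αl ^ 2 :=
    (hα.pow 2).eventually_lt_const (by nlinarith [pow_pos hαl 2])
  have hlo : ∀ᶠ k in atTop, (1 - w) * αl ^ 2 < τ.α k ^ 2 :=
    (hα.pow 2).eventually_const_lt (by nlinarith [pow_pos hαl 2])
  have hhalf : ∀ᶠ k in atTop, αl / 2 < τ.α k := hα.eventually_const_lt (by linarith)
  filter_upwards [hup, hlo, hhalf, h.X_tendsto.eventually hU,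
    h.eventually_bregman_le hα hLf hT hw] with k k1 k2 k3 k4 k5
  have hαk := h.alpha_pos k
  have h1 := h.inner_gradF_sub_ge hF (A := τ.A (k + 1)) k4 (mem_of_mem_nhds hU)
  have hDT : ∀ j, mixCLM (gossipLaplacian c Wt) (τ.T j - Tstar)
      = τ.D j + (gradF f (consensus m xstar) + Sstar) := fun j => by
    rw [map_sub, ← h.D_eq, eq_neg_of_add_eq_zero_right hT]; abel
  have h2 := energy_step h.c_pos h.two_c_lt_one h.lap_symm h.lap_upper
    (x := τ.X k - consensus m xstar) (s := τ.S k - Sstar)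
    (g := gradF f (τ.X k) - gradF f (consensus m xstar)) (t := τ.T k - Tstar)
    (t' := τ.T (k + 1) - Tstar) (a := τ.A (k + 1) - consensus m xstar)
    (x' := τ.X (k + 1) - consensus m xstar) (s' := τ.S (k + 1) - Sstar)
    (z := consensus m xstar) hαk (h.lap_consensus xstar)
    (by rw [hDT, h.A_succ_eq']; module)
    (by rw [sub_sub_sub_cancel_right, smul_sub, ← map_smul, h.alpha_smul_T_sub, ← h.A_succ_eq,
          sub_add_cancel])
    (by have := h.X_add_S k
        rw [smul_sub, smul_sub, sub_add_sub_comm, this, ← sub_add_sub_comm])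
    (h.monotone_step hS k)
  rw [sub_sub_sub_cancel_right] at h2
  have hq := lapEnergy_nonneg h.c_pos h.two_c_lt_one h.lap_upper (τ.T k - Tstar)
  have hq' := lapEnergy_nonneg h.c_pos h.two_c_lt_one h.lap_upper (τ.T (k + 1) - Tstar)
  exact energy_decrease_of_perturbed h.delta_mem.2 hαl hμ hw hw1 hwε k1.le k2.le k3.le h1 k5 h2
    (add_nonneg (sq_nonneg _) hq) (add_nonneg (sq_nonneg _) hq')

end IsConvergentRun

end Constants

/-! ### The dissipation controls the energy -/

section Bound

/-- The factor of the rate that does not depend on the condition numbers or the network, for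
`L_f α` ranging in `[a₀, a₁]`. -/
def rateFactor (c δ a₀ a₁ : ℝ) : ℝ :=
  4 / a₀ + 8 * a₁ + 24 / ((1 - δ) * c) + 14 * a₁ / c + 2

theorem two_le_rateFactor {c δ a₀ a₁ : ℝ} (hc : 0 < c) (hδ : δ < 1) (ha₀ : 0 < a₀)
    (ha₁ : 0 ≤ a₁) : 2 ≤ rateFactor c δ a₀ a₁ := by
  have hδ' : 0 < 1 - δ := by linarith
  have : 0 ≤ 4 / a₀ + 8 * a₁ + 24 / ((1 - δ) * c) + 14 * a₁ / c := by positivity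
  unfold rateFactor
  linarith

theorem le_rateFactor_mul {c δ a₀ a₁ Q D D' D2 D2' : ℝ} (hc : 0 < c) (hδ : δ < 1) (ha₀ : 0 < a₀)
    (ha₁ : 0 ≤ a₁) (hQ : 0 ≤ Q) (hD : 0 ≤ D) (hD' : 0 ≤ D') (hD2 : 0 ≤ D2) (hD2' : 0 ≤ D2') :
    4 / a₀ * Q * D' + 4 * a₁ * Q * D' + 4 * a₁ * Q * D
        + 1 / c * (3 * (8 / (1 - δ) * Q * D2) + 4 * (2 * a₁ * Q * D) + 3 * (2 * a₁ * Q * D))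
      ≤ rateFactor c δ a₀ a₁ * Q * (D2 + D + (D2' + D')) := by
  have hδ' : 0 < 1 - δ := by linarith
  have hfin : rateFactor c δ a₀ a₁ * Q * (D2 + D + (D2' + D'))
      - (4 / a₀ * Q * D' + 4 * a₁ * Q * D' + 4 * a₁ * Q * D
      + 1 / c * (3 * (8 / (1 - δ) * Q * D2) + 4 * (2 * a₁ * Q * D) + 3 * (2 * a₁ * Q * D)))
      = Q * ((4 / a₀ + 8 * a₁ + 14 * a₁ / c + 2) * (D2 + D2')
        + 24 / ((1 - δ) * c) * (D + D2' + D')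
        + (4 / a₀ + 4 * a₁ + 2) * D + (4 * a₁ + 14 * a₁ / c + 2) * D') := by
    unfold rateFactor
    field_simp
    ring
  have hpos : 0 ≤ Q * ((4 / a₀ + 8 * a₁ + 14 * a₁ / c + 2) * (D2 + D2')
        + 24 / ((1 - δ) * c) * (D + D2' + D')
        + (4 / a₀ + 4 * a₁ + 2) * D + (4 * a₁ + 14 * a₁ / c + 2) * D') := by positivity
  linarith

/-- Arithmetic of the rate: `X`, `X'` are squared distances of consecutive primal iterates, `R` is
the squared length of the forward step, `κ` and `ν` stand for `κ_f` and `κ_r²`, `l` for `L_f α` and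
`hg` for the spectral gap. -/
theorem energy_le_of_components {c δ a₀ a₁ κ ν l hg αl α μ Lf Lr X X' R R' E' : ℝ}
    (hc : 0 < c) (hδ : δ < 1) (ha₀ : 0 < a₀) (hl₀ : a₀ ≤ l) (hl₁ : l ≤ a₁) (hμ : 0 < μ)
    (hμL : μ ≤ Lf) (hαl : 0 < αl) (hα : αl / 2 ≤ α) (hhg : 0 < hg) (hhg2 : hg ≤ 2)
    (hX : 0 ≤ X) (hX' : 0 ≤ X') (hR : 0 ≤ R) (hR' : 0 ≤ R')
    (hκ : κ = Lf / μ) (hν : ν = (Lr / μ) ^ 2) (hl : l = Lf * αl)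
    (hE : E' ≤ X' + αl ^ 2 * ((Lr ^ 2 * X' + Lf ^ 2 * X)
      + (3 * (R / α ^ 2 + Lf ^ 2 * X + Lr ^ 2 * X) + Lf ^ 2 * X) / (c * hg))) :
    E' ≤ rateFactor c δ a₀ a₁ * (κ * (1 + ν) / hg) *
      (((1 - δ) / 2 * R + αl * μ / 2 * X) + ((1 - δ) / 2 * R' + αl * μ / 2 * X')) := by
  have hLf : 0 < Lf := hμ.trans_le hμL
  have hδ' : 0 < 1 - δ := by linarith
  have hα0 : 0 < α := by linarith
  have hl0 : 0 < l := ha₀.trans_le hl₀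
  have ha₁0 : 0 < a₁ := hl0.trans_le hl₁
  have hκ1 : 1 ≤ κ := by rw [hκ, one_le_div hμ]; exact hμL
  have hν0 : 0 ≤ ν := by rw [hν]; positivity
  obtain ⟨D, hD⟩ : ∃ D, D = αl * μ / 2 * X := ⟨_, rfl⟩
  obtain ⟨D', hD'⟩ : ∃ D', D' = αl * μ / 2 * X' := ⟨_, rfl⟩
  obtain ⟨D2, hD2⟩ : ∃ D2, D2 = (1 - δ) / 2 * R := ⟨_, rfl⟩
  obtain ⟨D2', hD2'⟩ : ∃ D2, D2 = (1 - δ) / 2 * R' := ⟨_, rfl⟩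
  have hD0 : 0 ≤ D := by rw [hD]; positivity
  have hD0' : 0 ≤ D' := by rw [hD']; positivity
  have hD20 : 0 ≤ D2 := by rw [hD2]; positivity
  have hD20' : 0 ≤ D2' := by rw [hD2']; positivity
  -- each component as a multiple of the dissipation
  have e1 : X' = 2 * κ / l * D' := by rw [hκ, hl, hD']; field_simp
  have e2 : ∀ Z, αl ^ 2 * (Lr ^ 2 * Z) = 2 * l * (ν / κ) * (αl * μ / 2 * Z) := fun Z => by
    rw [hκ, hl, hν]; field_simp
  have e3 : αl ^ 2 * (Lf ^ 2 * X) = 2 * l * κ * D := by rw [hκ, hl, hD]; field_simp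
  have e4 : αl ^ 2 * (R / α ^ 2) ≤ 8 / (1 - δ) * D2 := by
    have h1 : αl ^ 2 / α ^ 2 ≤ 4 := by
      rw [div_le_iff₀ (by positivity)]
      have := pow_le_pow_left₀ hαl.le (show αl ≤ 2 * α by linarith) 2
      linarith
    calc αl ^ 2 * (R / α ^ 2) = αl ^ 2 / α ^ 2 * R := by ring
      _ ≤ 4 * R := by gcongr
      _ = 8 / (1 - δ) * D2 := by rw [hD2]; field_simp; ring
  obtain ⟨p, hp⟩ : ∃ p, p = κ * (1 + ν) := ⟨_, rfl⟩
  obtain ⟨Q, hQ⟩ : ∃ Q, Q = p / hg := ⟨_, rfl⟩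
  have hpκ : κ ≤ p := by
    rw [hp]; exact le_mul_of_one_le_right (by linarith) (by linarith)
  have hpν : ν / κ ≤ p := by
    have h1 : ν / κ ≤ ν := div_le_self hν0 hκ1
    have h2 : 1 + ν ≤ p := by rw [hp]; exact le_mul_of_one_le_left (by linarith) hκ1
    linarith
  have hp1 : 1 ≤ p := hκ1.trans hpκ
  have hp0 : 0 < p := by linarith
  have hpQ : p ≤ 2 * Q := by
    rw [hQ, ← mul_div_assoc, le_div_iff₀ hhg]
    have := mul_le_mul_of_nonneg_left hhg2 hp0.le
    linarith
  have hQ0 : 0 < Q := by rw [hQ]; positivity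
  have hgQ : 1 / hg * p = Q := by rw [hQ]; ring
  have b1 : X' ≤ 4 / a₀ * Q * D' := by
    rw [e1]
    refine mul_le_mul_of_nonneg_right ?_ hD0'
    calc 2 * κ / l ≤ 2 * (2 * Q) / a₀ := by gcongr; linarith
      _ = 4 / a₀ * Q := by ring
  have b2 : αl ^ 2 * (Lr ^ 2 * X') ≤ 4 * a₁ * Q * D' := by
    rw [e2, ← hD']
    refine mul_le_mul_of_nonneg_right ?_ hD0'
    calc 2 * l * (ν / κ) ≤ 2 * a₁ * (2 * Q) := by gcongr; linarith
      _ = 4 * a₁ * Q := by ring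
  have b3 : αl ^ 2 * (Lf ^ 2 * X) ≤ 4 * a₁ * Q * D := by
    rw [e3]
    refine mul_le_mul_of_nonneg_right ?_ hD0
    calc 2 * l * κ ≤ 2 * a₁ * (2 * Q) := by gcongr; linarith
      _ = 4 * a₁ * Q := by ring
  have b4 : αl ^ 2 * (R / α ^ 2) * (1 / hg) ≤ 8 / (1 - δ) * Q * D2 := by
    calc αl ^ 2 * (R / α ^ 2) * (1 / hg) ≤ 8 / (1 - δ) * D2 * (1 / hg * p) := by
          gcongr
          exact le_mul_of_one_le_right (by positivity) hp1
      _ = _ := by rw [hgQ]; ring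
  have b5 : αl ^ 2 * (Lf ^ 2 * X) * (1 / hg) ≤ 2 * a₁ * Q * D := by
    rw [e3]
    calc 2 * l * κ * D * (1 / hg) ≤ 2 * a₁ * p * D * (1 / hg) := by gcongr
      _ = 2 * a₁ * (1 / hg * p) * D := by ring
      _ = _ := by rw [hgQ]
  have b6 : αl ^ 2 * (Lr ^ 2 * X) * (1 / hg) ≤ 2 * a₁ * Q * D := by
    rw [e2, ← hD]
    calc 2 * l * (ν / κ) * D * (1 / hg) ≤ 2 * a₁ * p * D * (1 / hg) := by gcongr
      _ = 2 * a₁ * (1 / hg * p) * D := by ring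
      _ = _ := by rw [hgQ]
  have hsplit : X' + αl ^ 2 * ((Lr ^ 2 * X' + Lf ^ 2 * X)
      + (3 * (R / α ^ 2 + Lf ^ 2 * X + Lr ^ 2 * X) + Lf ^ 2 * X) / (c * hg))
      = X' + αl ^ 2 * (Lr ^ 2 * X') + αl ^ 2 * (Lf ^ 2 * X)
        + 1 / c * (3 * (αl ^ 2 * (R / α ^ 2) * (1 / hg)) + 4 * (αl ^ 2 * (Lf ^ 2 * X) * (1 / hg))
          + 3 * (αl ^ 2 * (Lr ^ 2 * X) * (1 / hg))) := by
    field_simp; ring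
  have b7 : 1 / c * (3 * (αl ^ 2 * (R / α ^ 2) * (1 / hg)) + 4 * (αl ^ 2 * (Lf ^ 2 * X) * (1 / hg))
      + 3 * (αl ^ 2 * (Lr ^ 2 * X) * (1 / hg)))
      ≤ 1 / c * (3 * (8 / (1 - δ) * Q * D2) + 4 * (2 * a₁ * Q * D) + 3 * (2 * a₁ * Q * D)) := by
    gcongr
  rw [hsplit] at hE
  rw [← hp, ← hQ, ← hD, ← hD', ← hD2, ← hD2']
  have b8 : E' ≤ 4 / a₀ * Q * D' + 4 * a₁ * Q * D' + 4 * a₁ * Q * D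
      + 1 / c * (3 * (8 / (1 - δ) * Q * D2) + 4 * (2 * a₁ * Q * D) + 3 * (2 * a₁ * Q * D)) := by
    linarith
  exact b8.trans (le_rateFactor_mul hc hδ ha₀ ha₁0.le hQ0.le hD0 hD0' hD20 hD20')

variable {m d : ℕ} {c η δ αinit : ℝ} {n : ℕ → ℝ} {G : SimpleGraph (Fin m)}
  {Wt : Matrix (Fin m) (Fin m) ℝ} {f : Fin m → Vec d → ℝ} {r : Fin m → Vec d → EReal}
  {τ : Trajectory m d} {xstar : Vec d} {Sstar : Stack m d}

/-- Projection of the rows onto the normal space `Tᗮ`. -/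
def rowNormal (m : ℕ) (T : Submodule ℝ (Vec d)) : Stack m d →L[ℝ] Stack m d :=
  ContinuousLinearMap.id ℝ (Stack m d) - rowProjCLM m T

theorem rowNormal_apply (T : Submodule ℝ (Vec d)) (Z : Stack m d) :
    rowNormal m T Z = Z - rowProjCLM m T Z := rfl

theorem norm_sq_eq_add_rowNormal (T : Submodule ℝ (Vec d)) (Z : Stack m d) :
    ‖Z‖ ^ 2 = ‖rowProjCLM m T Z‖ ^ 2 + ‖rowNormal m T Z‖ ^ 2 :=
  norm_sq_eq_rowProjCLM T Z

theorem norm_rowProjCLM_le (T : Submodule ℝ (Vec d)) (Z : Stack m d) :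
    ‖rowProjCLM m T Z‖ ≤ ‖Z‖ :=
  le_of_sq_le_sq (by rw [norm_sq_eq_add_rowNormal T Z]; linarith [sq_nonneg ‖rowNormal m T Z‖])
    (norm_nonneg _)

theorem norm_rowNormal_le (T : Submodule ℝ (Vec d)) (Z : Stack m d) :
    ‖rowNormal m T Z‖ ≤ ‖Z‖ :=
  le_of_sq_le_sq (by rw [norm_sq_eq_add_rowNormal T Z]; linarith [sq_nonneg ‖rowProjCLM m T Z‖])
    (norm_nonneg _)

theorem rowNormal_mixCLM (T : Submodule ℝ (Vec d)) (B : Matrix (Fin m) (Fin m) ℝ)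
    (Z : Stack m d) : rowNormal m T (mixCLM B Z) = mixCLM B (rowNormal m T Z) := by
  rw [rowNormal_apply, rowNormal_apply, map_sub, rowProjCLM_mixCLM]

theorem rowNormal_sub_consensus_eq_zero {M : AffineSubspace ℝ (Vec d)} (hx : xstar ∈ M)
    {X : Stack m d} (hX : ∀ i, X i ∈ M) :
    rowNormal m M.direction (X - consensus m xstar) = 0 := by
  rw [rowNormal_apply, sub_eq_zero]
  refine PiLp.ext fun i => ?_
  rw [rowProjCLM_apply_row]
  exact (Submodule.starProjection_eq_self_iff.2
    (AffineSubspace.vsub_mem_direction (hX i) hx)).symm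

namespace IsConvergentRun

/-- The dissipation of two consecutive iterations controls the energy. The normal components of the
dual variables are determined by the gradient; the tangential component of `𝐒^k` is controlled by
the tangent constant, that of `𝐃^{k+1}` by the primal-dual equation. -/
theorem eventually_energy_le (h : IsConvergentRun c η δ αinit n G Wt f r τ xstar Sstar)
    {αl Lf Lr a₀ a₁ : ℝ} (hα : Tendsto τ.α atTop (𝓝 αl))
    (hLf : IsSmoothnessConstant τ f (lazyMatrix c Wt) c η δ αinit n Lf)
    {Tstar : Stack m d} (hT : gradF f (consensus m xstar) + Sstar
      + mixCLM (gossipLaplacian c Wt) Tstar = 0)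
    {M : AffineSubspace ℝ (Vec d)} (hxM : xstar ∈ M) (hid : ∀ᶠ k in atTop, ∀ i, τ.X k i ∈ M)
    (hLr : IsTangentConstant τ M.direction (consensus m xstar) Sstar Lr)
    {μ : ℝ} (hμ : 0 < μ) (hμL : μ ≤ Lf) (ha₀ : 0 < a₀) (hl₀ : a₀ ≤ Lf * αl)
    (hl₁ : Lf * αl ≤ a₁) :
    ∀ᶠ k in atTop, τ.energy c Wt αl xstar Sstar Tstar (k + 1) ≤
      rateFactor c δ a₀ a₁ * ((Lf / μ) * (1 + (Lr / μ) ^ 2) /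
        (1 - lambda2 h.two_le h.gossip.isHermitian)) *
      (τ.dissipation δ αl μ xstar k + τ.dissipation δ αl μ xstar (k + 1)) := by
  have hαl := h.alpha_limit_pos hα
  have hgap := h.gossip.lambda2_lt_one h.connected h.two_le
  have hgap2 := h.gossip.neg_one_le_lambda2 h.two_le
  have hDT : ∀ j, mixCLM (gossipLaplacian c Wt) (τ.T j - Tstar)
      = τ.D j + (gradF f (consensus m xstar) + Sstar) := fun j => by
    rw [map_sub, ← h.D_eq, eq_neg_of_add_eq_zero_right hT]; abel
  obtain ⟨K, hK⟩ := eventually_atTop.1 hid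
  have hnormal := normal_components_eq (L := mixCLM (gossipLaplacian c Wt))
    (Q := rowNormal m M.direction) (rowNormal_mixCLM M.direction _)
    (x := fun k => τ.X k - consensus m xstar) (s := fun k => τ.S k - Sstar)
    (g := fun k => gradF f (τ.X k) - gradF f (consensus m xstar))
    (d := fun k => mixCLM (gossipLaplacian c Wt) (τ.T k - Tstar)) h.alpha_pos (K := K)
    (fun k hk => rowNormal_sub_consensus_eq_zero hxM (hK k hk))
    (fun k _ => by
      have h1 := h.X_add_S k
      rw [h.A_succ_eq'] at h1
      rw [hDT, smul_sub, sub_add_sub_comm, h1]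
      module)
    (fun k _ => by
      rw [hDT, hDT, add_sub_add_right_eq_sub, h.alpha_smul_D_sub, ← hDT, ← sub_eq_zero, ← map_sub]
      rw [h.residual_eq hT, sub_sub_sub_cancel_right]
      simp only [sub_sub_self, h.lap_consensus])
    (by simpa using h.gradF_tendsto.sub_const (gradF f (consensus m xstar)))
    (by
      have h1 := h.D_tendsto.add_const (gradF f (consensus m xstar) + Sstar)
      rw [neg_add_cancel] at h1
      exact h1.congr fun k => (hDT k).symm)
  have hhalf : ∀ᶠ k in atTop, αl / 2 < τ.α k := hα.eventually_const_lt (by linarith)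
  filter_upwards [eventually_ge_atTop K, hhalf, hLr.2,
    (tendsto_add_atTop_nat 1).eventually hLr.2] with k hk k3 k4 k5
  obtain ⟨hd, hs⟩ := hnormal k hk
  have hg := h.norm_gradF_sub_le hLf k
  set g := gradF f (τ.X k) - gradF f (consensus m xstar) with hgdef
  have hgn : ‖rowNormal m M.direction g‖ ≤ ‖g‖ := norm_rowNormal_le _ _
  have hg2 : ‖g‖ ^ 2 ≤ Lf ^ 2 * ‖τ.X k - consensus m xstar‖ ^ 2 := by
    rw [← mul_pow]; exact pow_le_pow_left₀ (norm_nonneg _) hg 2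
  have hr : ∀ j, ‖rowProj M.direction (τ.S j) - rowProj M.direction Sstar‖
      = ‖rowProjCLM m M.direction (τ.S j - Sstar)‖ := fun j => by
    rw [map_sub, rowProjCLM_apply, rowProjCLM_apply]
  rw [hr] at k4 k5
  -- the dual variable of the nonsmooth term
  have hS : ‖τ.S (k + 1) - Sstar‖ ^ 2 ≤ Lr ^ 2 * ‖τ.X (k + 1) - consensus m xstar‖ ^ 2
      + Lf ^ 2 * ‖τ.X k - consensus m xstar‖ ^ 2 := by
    rw [norm_sq_eq_add_rowNormal M.direction]
    refine add_le_add ?_ ?_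
    · rw [← mul_pow]; exact pow_le_pow_left₀ (norm_nonneg _) k5 2
    · refine le_trans (pow_le_pow_left₀ (norm_nonneg _) ?_ 2) hg2
      rw [hs, norm_neg]
      exact (norm_sub_apply_le_of_norm_sq_le h.c_pos h.two_c_lt_one.le h.lap_upper _).trans hgn
  -- the dual variable of the consensus constraint
  have hαk := h.alpha_pos k
  have hDeq : mixCLM (gossipLaplacian c Wt) (τ.T (k + 1) - Tstar)
      = (1 / τ.α k) • (τ.X k - τ.A (k + 1)) - g - (τ.S k - Sstar) := by
    rw [hDT, h.A_succ_eq', sub_sub_cancel, smul_smul, one_div_mul_cancel hαk.ne', one_smul, hgdef]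
    abel
  have hD : ‖mixCLM (gossipLaplacian c Wt) (τ.T (k + 1) - Tstar)‖ ^ 2
      ≤ 3 * (‖τ.X k - τ.A (k + 1)‖ ^ 2 / τ.α k ^ 2 + Lf ^ 2 * ‖τ.X k - consensus m xstar‖ ^ 2
        + Lr ^ 2 * ‖τ.X k - consensus m xstar‖ ^ 2)
        + Lf ^ 2 * ‖τ.X k - consensus m xstar‖ ^ 2 := by
    rw [norm_sq_eq_add_rowNormal M.direction]
    refine add_le_add ?_ ?_
    · rw [hDeq, map_sub, map_sub, map_smul]
      have n1 : ‖(1 / τ.α k) • rowProjCLM m M.direction (τ.X k - τ.A (k + 1))‖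
          ≤ ‖τ.X k - τ.A (k + 1)‖ / τ.α k := by
        rw [norm_smul, Real.norm_eq_abs, abs_of_pos (by positivity), one_div_mul_eq_div]
        gcongr
        exact norm_rowProjCLM_le _ _
      have n2 : ‖rowProjCLM m M.direction g‖ ≤ ‖g‖ := norm_rowProjCLM_le _ _
      have n3 := norm_sub_le ((1 / τ.α k) • rowProjCLM m M.direction (τ.X k - τ.A (k + 1))
        - rowProjCLM m M.direction g) (rowProjCLM m M.direction (τ.S k - Sstar))
      have n4 := norm_sub_le ((1 / τ.α k) • rowProjCLM m M.direction (τ.X k - τ.A (k + 1)))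
        (rowProjCLM m M.direction g)
      have n5 : ‖(1 / τ.α k) • rowProjCLM m M.direction (τ.X k - τ.A (k + 1))
          - rowProjCLM m M.direction g - rowProjCLM m M.direction (τ.S k - Sstar)‖
          ≤ ‖τ.X k - τ.A (k + 1)‖ / τ.α k + Lf * ‖τ.X k - consensus m xstar‖
            + Lr * ‖τ.X k - consensus m xstar‖ := by linarith
      refine (pow_le_pow_left₀ (norm_nonneg _) n5 2).trans ?_
      rw [← div_pow, ← mul_pow, ← mul_pow]
      generalize ‖τ.X k - τ.A (k + 1)‖ / τ.α k = u
      generalize Lf * ‖τ.X k - consensus m xstar‖ = v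
      generalize Lr * ‖τ.X k - consensus m xstar‖ = w
      nlinarith [sq_nonneg (u - v), sq_nonneg (u - w), sq_nonneg (v - w)]
    · refine le_trans (pow_le_pow_left₀ (norm_nonneg _) ?_ 2) hg2
      rw [hd, norm_neg]
      exact (norm_apply_le_of_norm_sq_le h.c_pos h.two_c_lt_one.le h.lap_upper _).trans hgn
  have hc := h.c_mem.1
  have hγ : 0 < c * (1 - lambda2 h.two_le h.gossip.isHermitian) := mul_pos hc (by linarith)
  have hq := (lapEnergy_le hγ h.lap_lower (τ.T (k + 1) - Tstar)).trans
    (div_le_div_of_nonneg_right hD hγ.le)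
  refine energy_le_of_components (α := τ.α k) hc h.delta_mem.2 ha₀ hl₀ hl₁ hμ hμL hαl k3.le
    (sub_pos.2 hgap) (by linarith) (sq_nonneg _) (sq_nonneg _) (sq_nonneg _) (sq_nonneg _)
    rfl rfl rfl ?_
  unfold Trajectory.energy
  gcongr

/-- If the condition number is less than one, the run terminates at the solution. -/
theorem eventually_eq_of_lt (h : IsConvergentRun c η δ αinit n G Wt f r τ xstar Sstar)
    {Lf μ : ℝ} (hLf : IsSmoothnessConstant τ f (lazyMatrix c Wt) c η δ αinit n Lf)
    {U : Set (Stack m d)} (hU : U ∈ 𝓝 (consensus m xstar)) (hF : StrongConvexOn U μ (sumF f))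
    (hlt : Lf < μ) : ∀ᶠ k in atTop, ‖τ.X k - consensus m xstar‖ = 0 := by
  filter_upwards [h.X_tendsto.eventually hU] with k hk
  have hd := fun i => (h.problem.f_smooth i).1
  have h1 := hF.add_deriv_le hk (mem_of_mem_nhds hU) (hasDerivAt_sumF_line hd (τ.X k) _)
  have h2 := hF.add_deriv_le (mem_of_mem_nhds hU) hk (hasDerivAt_sumF_line hd _ (τ.X k - _))
  have h3 := real_inner_le_norm (gradF f (τ.X k) - gradF f (consensus m xstar))
    (τ.X k - consensus m xstar)
  have h4 := mul_le_mul_of_nonneg_right (h.norm_gradF_sub_le hLf k)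
    (norm_nonneg (τ.X k - consensus m xstar))
  rw [norm_sub_rev] at h1
  have h5 : inner ℝ (gradF f (τ.X k)) (consensus m xstar - τ.X k)
      = - inner ℝ (gradF f (τ.X k)) (τ.X k - consensus m xstar) := by
    rw [← inner_neg_right, neg_sub]
  rw [inner_sub_left] at h3
  by_contra hne
  have h6 : 0 < ‖τ.X k - consensus m xstar‖ := lt_of_le_of_ne (norm_nonneg _) (Ne.symm hne)
  nlinarith [pow_pos h6 2]

/-- Linear convergence of the primal iterates. -/
theorem exists_norm_le_exp (h : IsConvergentRun c η δ αinit n G Wt f r τ xstar Sstar)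
    {Lf Lr : ℝ} (hLf : IsSmoothnessConstant τ f (lazyMatrix c Wt) c η δ αinit n Lf)
    {M : AffineSubspace ℝ (Vec d)} (hM : ∀ i, IsPartlySmoothAt (r i) M xstar)
    (hnd : Sstar ∈ intrinsicInterior ℝ (subdiff (sumR r) (consensus m xstar)))
    (hLr : IsTangentConstant τ M.direction (consensus m xstar) Sstar Lr)
    {μ : ℝ} (hμ : 0 < μ) {U : Set (Stack m d)} (hU : U ∈ 𝓝 (consensus m xstar))
    (hF : StrongConvexOn U μ (sumF f)) {b : ℝ}
    (hb : b = 16 * (rateFactor c δ (min (Lf * αinit) (η * δ / 2))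
      (√((Lf * αinit) ^ 2 + Lf ^ 2 * ∑' k, n k)) * ((Lf / μ) * (1 + (Lr / μ) ^ 2) /
        (1 - lambda2 h.two_le h.gossip.isHermitian)))) :
    ∃ C, ∀ k : ℕ, ‖τ.X k - consensus m xstar‖ ≤ C * Real.exp (-(k / b)) := by
  rcases lt_or_ge Lf μ with hlt | hμL
  · obtain ⟨K, hK⟩ := eventually_atTop.1 (h.eventually_eq_of_lt hLf hU hF hlt)
    have hterm : ∀ j : ℕ, 0 ≤ ‖τ.X j - consensus m xstar‖ / Real.exp (-(j / b)) := fun j => by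
      positivity
    refine ⟨∑ j ∈ Finset.range K, ‖τ.X j - consensus m xstar‖ / Real.exp (-(j / b)), fun k => ?_⟩
    rw [← div_le_iff₀ (Real.exp_pos _)]
    by_cases hk : k < K
    · exact Finset.single_le_sum
        (f := fun j : ℕ => ‖τ.X j - consensus m xstar‖ / Real.exp (-(j / b)))
        (fun j _ => hterm j) (Finset.mem_range.2 hk)
    · rw [hK k (by omega), zero_div]
      exact Finset.sum_nonneg fun j _ => hterm j
  obtain ⟨αl, hl0, hlsq, hα⟩ := h.exists_alpha_tendsto
  obtain ⟨Tstar, hT⟩ := h.exists_optimality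
  have hLf0 := hLf.1
  have hη := h.eta_mem.1
  have hδ := h.delta_mem.1
  have hinit := h.alpha_init_pos
  have hgap := h.gossip.lambda2_lt_one h.connected h.two_le
  have hgap2 := h.gossip.neg_one_le_lambda2 h.two_le
  set a₀ := min (Lf * αinit) (η * δ / 2) with ha₀
  set a₁ := √((Lf * αinit) ^ 2 + Lf ^ 2 * ∑' k, n k) with ha₁
  have ha₀pos : 0 < a₀ := by rw [ha₀]; positivity
  have hl₀ : a₀ ≤ Lf * αl := by
    have h1 : min αinit (η * (δ / (2 * Lf))) ≤ αl :=
      ge_of_tendsto (shift_tendsto hα)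
        (Eventually.of_forall (h.min_le_alpha_of_smoothnessConstant hLf))
    have h2 : a₀ = Lf * min αinit (η * (δ / (2 * Lf))) := by
      rw [mul_min_of_nonneg _ _ hLf0.le, ha₀]
      congr 1
      field_simp
    rw [h2]
    exact mul_le_mul_of_nonneg_left h1 hLf0.le
  have hl₁ : Lf * αl ≤ a₁ := by
    refine Real.le_sqrt_of_sq_le ?_
    have := mul_le_mul_of_nonneg_left hlsq (sq_nonneg Lf)
    linarith
  obtain ⟨Q, hQ⟩ : ∃ Q, Q = (Lf / μ) * (1 + (Lr / μ) ^ 2) /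
      (1 - lambda2 h.two_le h.gossip.isHermitian) := ⟨_, rfl⟩
  have hdiss := h.eventually_energy_le hα hLf hT (hM ⟨0, by have := h.two_le; omega⟩).mem
    (h.eventually_X_mem hM hnd) hLr hμ hμL ha₀pos hl₀ hl₁
  rw [← hQ] at hdiss hb
  have hQ1 : 1 / 2 ≤ Q := by
    rw [hQ, le_div_iff₀ (by linarith)]
    have h1 : 1 ≤ Lf / μ := by rw [one_le_div hμ]; exact hμL
    nlinarith [sq_nonneg (Lr / μ), mul_nonneg (show 0 ≤ Lf / μ by linarith) (sq_nonneg (Lr / μ))]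
  have hK : 1 ≤ rateFactor c δ a₀ a₁ * Q := by
    have := two_le_rateFactor h.c_mem.1 h.delta_mem.2 ha₀pos (Real.sqrt_nonneg _ : 0 ≤ a₁)
    nlinarith
  obtain ⟨C, hC⟩ := exists_le_exp_of_dissipation hK (h.energy_nonneg αl Tstar)
    (h.dissipation_nonneg hl0 hμ.le)
    (fun ε hε => h.eventually_energy_decrease hα hLf hT (Sstar_mem_subdiff hM hnd) hμ hU hF hε)
    hdiss
  refine ⟨√C, fun k => ?_⟩
  have h1 : ‖τ.X k - consensus m xstar‖ ^ 2 ≤ τ.energy c Wt αl xstar Sstar Tstar k := by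
    have := lapEnergy_nonneg h.c_pos h.two_c_lt_one h.lap_upper (τ.T k - Tstar)
    unfold Trajectory.energy
    exact le_add_of_nonneg_right (by positivity)
  have hC0 : 0 ≤ C := by
    have h2 := (h.energy_nonneg αl Tstar 0).trans (hC 0)
    exact nonneg_of_mul_nonneg_left h2 (Real.exp_pos _)
  refine le_of_sq_le_sq ((h1.trans (hC k)).trans_eq ?_) (by positivity)
  rw [mul_pow, Real.sq_sqrt hC0, ← Real.exp_nat_mul, hb]
  congr 2
  field_simp
  ring

end IsConvergentRun

end Bound

end

theorem corollary5p7 (c η δ : ℝ) (hc : c ∈ Set.Ioo (0 : ℝ) (1 / 2)) (hη : η ∈ Set.Ioo (0 : ℝ) 1)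
    (hδ : δ ∈ Set.Ioo (0 : ℝ) 1) :
    -- the hidden constant is a function of `c, η, δ, Lf * α^{-1}` and `Lf² * ∑ n^k` only
    ∃ C : ℝ → ℝ → ℝ,
    ∀ (m d : ℕ) (hm : 2 ≤ m) (G : SimpleGraph (Fin m)) (_hG : G.Connected)
      (Wt : Matrix (Fin m) (Fin m) ℝ) (hW : IsGossipMatrix G Wt)
      (f : Fin m → Vec d → ℝ) (r : Fin m → Vec d → EReal) (_hP : IsAdmissibleProblem f r)
      (αinit : ℝ) (_hα : 0 < αinit) (n : ℕ → ℝ) (_hn : ∀ k, 0 ≤ n k) (_hns : Summable n)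
      (τ : Trajectory m d) (_hτ : IsGenerated f r (lazyMatrix c Wt) c η δ αinit n τ)
      -- the limits `𝐗* = 𝟏 (x*)ᵀ` and `𝐒*` of the iterates
      (xstar : Vec d) (_hX : Tendsto τ.X atTop (𝓝 (consensus m xstar)))
      (Sstar : Stack m d) (_hS : Tendsto τ.S atTop (𝓝 Sstar))
      -- local strong convexity of `F`
      (μ : ℝ) (_hμ : 0 < μ) (U : Set (Stack m d)) (_hU : U ∈ 𝓝 (consensus m xstar))
      (_hF : StrongConvexOn U μ (sumF f))
      -- partial smoothness relative to an affine manifold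
      (M : AffineSubspace ℝ (Vec d)) (_hM : ∀ i, IsPartlySmoothAt (r i) M xstar)
      -- non-degeneracy
      (_hnd : Sstar ∈ intrinsicInterior ℝ (subdiff (sumR r) (consensus m xstar))),
      (∃ Lf, IsSmoothnessConstant τ f (lazyMatrix c Wt) c η δ αinit n Lf) ∧
      (∃ Lr, IsTangentConstant τ M.direction (consensus m xstar) Sstar Lr) ∧
      ∀ Lf Lr : ℝ, IsSmoothnessConstant τ f (lazyMatrix c Wt) c η δ αinit n Lf →
        IsTangentConstant τ M.direction (consensus m xstar) Sstar Lr →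
        ∃ N : ℝ → ℕ,
          (∀ ε > 0, ∀ k ≥ N ε, ‖τ.X k - consensus m xstar‖ ≤ ε) ∧
          ∀ᶠ ε in 𝓝[>] (0 : ℝ),
            (N ε : ℝ) ≤ C (Lf * αinit) (Lf ^ 2 * ∑' k, n k) *
              ((Lf / μ) * (1 + (Lr / μ) ^ 2) / (1 - lambda2 hm hW.isHermitian) *
                Real.log (1 / ε)) := by
  refine ⟨fun u v => 32 * rateFactor c δ (min u (η * δ / 2)) (√(u ^ 2 + v)), ?_⟩
  intro m d hm G hG Wt hW f r hP αinit hα n hn hns τ hτ xstar hX Sstar hS μ hμ U hU hF M hM hnd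
  have h : IsConvergentRun c η δ αinit n G Wt f r τ xstar Sstar :=
    ⟨hc, hη, hδ, hm, hG, hW, hP, hα, hn, hns, hτ, hX, hS⟩
  refine ⟨h.exists_smoothnessConstant, h.exists_tangentConstant hM hnd, fun Lf Lr hLf hLr => ?_⟩
  obtain ⟨C, hC⟩ := h.exists_norm_le_exp hLf hM hnd hLr hμ hU hF rfl
  have hgap := hW.lambda2_lt_one hG hm
  have hLf0 := hLf.1
  have hfac := two_le_rateFactor hc.1 hδ.2
    (show 0 < min (Lf * αinit) (η * δ / 2) from
      lt_min (mul_pos hLf0 hα) (by have := mul_pos hη.1 hδ.1; linarith))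
    (Real.sqrt_nonneg ((Lf * αinit) ^ 2 + Lf ^ 2 * ∑' k, n k))
  have hQ : 0 < (Lf / μ) * (1 + (Lr / μ) ^ 2) / (1 - lambda2 hm hW.isHermitian) := by
    have : 0 < 1 - lambda2 hm hW.isHermitian := by linarith
    positivity
  obtain ⟨N, hN, hlog⟩ := exists_iteration_count (mul_pos (by norm_num)
    (mul_pos (by linarith) hQ)) hC
  refine ⟨N, hN, hlog.mono fun ε hε => hε.trans_eq ?_⟩
  ring
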